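/- Notation. Let $U\subset\mathbb{R}^4$ be a simply connected open set (a local coordinate neighbourhood of a point of a 4-manifold $M$, with coordinates $x^0,\dots,x^3$) carrying a smooth Lorentzian metric $g_{\alpha\beta}$ of signature $(+,-,-,-)$; put $o_{jk}=o^{jk}=\mathrm{diag}(1,-1,-1,-1)$. All fields are smooth on $U$, and differential forms are identified with antisymmetric tensors. A coframe is a quartet of real covector fields $\vartheta^j$, $j=0,1,2,3$, with $g=o_{jk}\,\vartheta^j\otimes\vartheta^k$. Fix a reference coframe $\boldsymbol\vartheta$ with $\det\boldsymbol\vartheta^j_\alpha>0$; the coframes considered below are those with $\det\vartheta^j_\alpha>0$ and $\boldsymbol\vartheta^0\cdot\vartheta^0>0$. For a coframe put $l=\vartheta^0+\vartheta^3$, $m=\vartheta^1+i\vartheta^2$, $T^{\mathrm{ax}}=\frac13 o_{jk}\,\vartheta^j\wedge d\vartheta^k$ and $L_{\mathrm{tele}}(\vartheta)=l\wedge T^{\mathrm{ax}}$. Two complex fields are equal modulo $\mathrm U(1)$ if they differ by a constant complex factor of modulus 1. Let $H$ be the group of all Lorentz transformations $\vartheta^j\mapsto\Lambda^j{}_k\vartheta^k$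 (with $\Lambda^j{}_k$ real scalar functions such that $o_{jk}\Lambda^j{}_r\Lambda^k{}_s=o_{rs}$) which preserve $l\wedge m$ modulo $\mathrm U(1)$. Two coframes are equivalent if they differ by a transformation from $H$; two spinor fields $\xi=(\xi^1,\xi^2):U\to\mathbb{C}^2$ are equivalent if they are equal modulo $\mathrm U(1)$, and a class of spinor fields is nonvanishing if its representatives vanish at no point. Let $\epsilon_{ab}=\epsilon^{ab}=\epsilon_{\dot a\dot b}=\epsilon^{\dot a\dot b}=\begin{pmatrix}0&1\\-1&0\end{pmatrix}$, and let $\sigma_{\alpha a\dot b}$ be Pauli matrices for $g$: Hermitian $2\times2$ matrices with $\sigma^\alpha{}_{a\dot b}\sigma^{\beta c\dot b}+\sigma^\beta{}_{a\dot b}\sigma^{\alpha c\dot b}=2g^{\alpha\beta}\delta_a{}^c$ (where $\sigma^{\alpha a\dot b}=\epsilon^{ac}\epsilon^{\dot b\dot d}\sigma^\alpha{}_{c\dot d}$), such that at each point the covectors $\sigma_{\alpha a\dot b}\xi^a\bar\xi^{\dot b}$, $0\neq\xi\in\mathbb C^2$, form the forward light cone $\{c_j\boldsymbol\vartheta^j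 : o^{jk}c_jc_k=0,\ c_0>0\}$, and such that the second order Pauli matrices $$\sigma_{\alpha\beta ac}=\tfrac12\big(\sigma_{\alpha a\dot b}\epsilon^{\dot b\dot d}\sigma_{\beta c\dot d}-\sigma_{\beta a\dot b}\epsilon^{\dot b\dot d}\sigma_{\alpha c\dot d}\big)$$ satisfy $*\sigma=-i\sigma$, where $(*\sigma)_{\gamma\delta ab}=\frac12\sqrt{|\det g|}\,\sigma^{\alpha\beta}{}_{ab}\,\varepsilon_{\alpha\beta\gamma\delta}$ and $\varepsilon$ is totally antisymmetric with $\varepsilon_{0123}=1$. With $\Gamma^\beta{}_{\alpha\gamma}$ the Christoffel symbols of $g$, put $$\nabla_\alpha\xi^a=\partial_\alpha\xi^a+\tfrac14\sigma_\beta{}^{a\dot c}\big(\partial_\alpha\sigma^\beta{}_{b\dot c}+\Gamma^\beta{}_{\alpha\gamma}\sigma^\gamma{}_{b\dot c}\big)\xi^b,\qquad \nabla_\alpha\bar\xi^{\dot a}=\overline{\nabla_\alpha\xi^a},$$ $$L_{\mathrm{Weyl}}(\xi)=\tfrac i2\big(\bar\xi^{\dot b}\sigma^\alpha{}_{a\dot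 b}\nabla_\alpha\xi^a-\xi^a\sigma^\alpha{}_{a\dot b}\nabla_\alpha\bar\xi^{\dot b}\big)*1,$$ where $*1$ is the volume 4-form, with components $\sqrt{|\det g|}\,\varepsilon_{\alpha\beta\gamma\delta}$. Theorem. The equivalence classes of coframes $\vartheta$ and the equivalence classes of nonvanishing spinor fields $\xi$ are in a one-to-one correspondence given by the formula $$(l\wedge m)_{\alpha\beta}=\sigma_{\alpha\beta ab}\,\xi^a\xi^b\quad\text{modulo }\mathrm U(1),$$ where $\vartheta$ and $\xi$ are arbitrary representatives of the corresponding classes. Under this correspondence $$L_{\mathrm{tele}}(\vartheta)=-\tfrac43\,L_{\mathrm{Weyl}}(\xi).$$ -/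

import Mathlib

open scoped ContDiff

noncomputable section

namespace WeylTele

/-! ### Coordinates, tensors and forms

Everything lives on an open set `U` of `ℝ⁴`, the range of a local coordinate system. Tensor fields
are given by their components in these coordinates, and differential forms are identified with
antisymmetric tensors. All fields are total functions; only their values on `U` matter. -/

/-- Points of the coordinate domain (coordinates `x⁰, x¹, x², x³`). -/
abbrev Pt : Type := Fin 4 → ℝ

/-- The partial derivative `∂_α f` at `x`. -/
def pd {F : Type*} [NormedAddCommGroup F] [NormedSpace ℝ F]
    (α : Fin 4) (f : Pt → F) (x : Pt) : F :=
  fderiv ℝ f x (Pi.single α 1)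

/-- `o_{jk} = o^{jk} = diag(1, -1, -1, -1)`. -/
def o : Matrix (Fin 4) (Fin 4) ℝ := Matrix.diagonal ![1, -1, -1, -1]

/-- The totally antisymmetric symbol with `ε_{0123} = 1`. -/
def leviCivita (α β γ δ : Fin 4) : ℝ :=
  (Matrix.of fun i j : Fin 4 => if ![α, β, γ, δ] i = j then (1 : ℝ) else 0).det

/-- Wedge product of two covectors. -/
def wedge11 {R : Type*} [CommRing R] (u v : Fin 4 → R) : Fin 4 → Fin 4 → R :=
  fun α β => u α * v β - u β * v α

/-- Wedge product of a covector with a (antisymmetric) 2-form. -/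
def wedge12 {R : Type*} [CommRing R] (u : Fin 4 → R) (F : Fin 4 → Fin 4 → R) :
    Fin 4 → Fin 4 → Fin 4 → R :=
  fun α β γ => u α * F β γ + u β * F γ α + u γ * F α β

/-- Wedge product of a covector with a (totally antisymmetric) 3-form. -/
def wedge13 {R : Type*} [CommRing R] (u : Fin 4 → R) (T : Fin 4 → Fin 4 → Fin 4 → R) :
    Fin 4 → Fin 4 → Fin 4 → Fin 4 → R :=
  fun α β γ δ => u α * T β γ δ - u β * T α γ δ + u γ * T α β δ - u δ * T α β γ

/-- Exterior derivative of a covector field, `(dw)_{αβ} = ∂_α w_β - ∂_β w_α`. -/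
def extD (w : Pt → Fin 4 → ℝ) (x : Pt) : Fin 4 → Fin 4 → ℝ :=
  fun α β => pd α (fun y => w y β) x - pd β (fun y => w y α) x

/-- Equality modulo `U(1)` on `U`: the fields differ by a constant complex factor of modulus 1. -/
def EqModU1 {V : Type*} [AddCommGroup V] [Module ℂ V] (U : Set Pt) (F G : Pt → V) : Prop :=
  ∃ c : ℂ, ‖c‖ = 1 ∧ ∀ x ∈ U, F x = c • G x

theorem EqModU1.refl {V : Type*} [AddCommGroup V] [Module ℂ V] (U : Set Pt) (F : Pt → V) :
    EqModU1 U F F := ⟨1, by simp, fun x _ => by simp⟩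

theorem EqModU1.symm {V : Type*} [AddCommGroup V] [Module ℂ V] {U : Set Pt} {F G : Pt → V}
    (h : EqModU1 U F G) : EqModU1 U G F := by
  obtain ⟨c, hc, h⟩ := h
  have hc0 : c ≠ 0 := by
    rintro rfl
    simp at hc
  exact ⟨c⁻¹, by simp [hc], fun x hx => by rw [h x hx, smul_smul, inv_mul_cancel₀ hc0, one_smul]⟩

theorem EqModU1.trans {V : Type*} [AddCommGroup V] [Module ℂ V] {U : Set Pt} {F G K : Pt → V}
    (h : EqModU1 U F G) (h' : EqModU1 U G K) : EqModU1 U F K := by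
  obtain ⟨c, hc, h⟩ := h
  obtain ⟨d, hd, h'⟩ := h'
  exact ⟨c * d, by simp [hc, hd], fun x hx => by rw [h x hx, h' x hx, smul_smul]⟩

theorem EqModU1.congr_right {V : Type*} [AddCommGroup V] [Module ℂ V] {U : Set Pt}
    {F G K : Pt → V} (h : EqModU1 U F G) (h' : ∀ x ∈ U, G x = K x) : EqModU1 U F K :=
  h.trans ⟨1, by simp, fun x hx => by simp [h' x hx]⟩

/-! ### Metric and coframes -/

/-- A smooth field of real `4 × 4` matrices on `U`. -/
def SmoothMat (U : Set Pt) (A : Pt → Matrix (Fin 4) (Fin 4) ℝ) : Prop :=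
  ∀ i j, ContDiffOn ℝ ∞ (fun x => A x i j) U

/-- `g = (g_{αβ})` is a smooth Lorentzian metric on `U`, of signature `(+,-,-,-)`. -/
def IsLorentzianMetric (U : Set Pt) (g : Pt → Matrix (Fin 4) (Fin 4) ℝ) : Prop :=
  SmoothMat U g ∧ ∀ x ∈ U, ∃ A : Matrix (Fin 4) (Fin 4) ℝ, A.det ≠ 0 ∧ g x = A.transpose * o * A

/-- A coframe of `g`: a smooth quartet of real covector fields, `θ x j α = ϑ^j_α(x)`, with
`g_{αβ} = o_{jk} ϑ^j_α ϑ^k_β`. -/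
def IsCoframe (U : Set Pt) (g θ : Pt → Matrix (Fin 4) (Fin 4) ℝ) : Prop :=
  SmoothMat U θ ∧ ∀ x ∈ U, g x = (θ x).transpose * o * θ x

/-- The coframes admitted as dynamical variables: positively oriented, and with
`ref⁰ · ϑ⁰ > 0`, where `ref` is the reference coframe. -/
def IsAdmissible (U : Set Pt) (g ref θ : Pt → Matrix (Fin 4) (Fin 4) ℝ) : Prop :=
  IsCoframe U g θ ∧ (∀ x ∈ U, 0 < (θ x).det) ∧
    ∀ x ∈ U, 0 < ∑ α, ∑ β, (g x)⁻¹ α β * ref x 0 α * θ x 0 β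

/-- `l = ϑ⁰ + ϑ³`. -/
def lForm (θ : Pt → Matrix (Fin 4) (Fin 4) ℝ) (x : Pt) : Fin 4 → ℝ :=
  fun α => θ x 0 α + θ x 3 α

/-- `m = ϑ¹ + i ϑ²`. -/
def mForm (θ : Pt → Matrix (Fin 4) (Fin 4) ℝ) (x : Pt) : Fin 4 → ℂ :=
  fun α => (θ x 1 α : ℂ) + Complex.I * (θ x 2 α : ℂ)

/-- The complex 2-form `l ∧ m`. -/
def lm (θ : Pt → Matrix (Fin 4) (Fin 4) ℝ) (x : Pt) : Fin 4 → Fin 4 → ℂ :=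
  wedge11 (fun α => (lForm θ x α : ℂ)) (mForm θ x)

/-- Axial torsion `T^ax = (1/3) o_{jk} ϑ^j ∧ dϑ^k`. -/
def axialTorsion (θ : Pt → Matrix (Fin 4) (Fin 4) ℝ) (x : Pt) : Fin 4 → Fin 4 → Fin 4 → ℝ :=
  fun α β γ => (1 / 3) * ∑ j, ∑ k, o j k * wedge12 (θ x j) (extD (fun y => θ y k) x) α β γ

/-- The teleparallel Lagrangian, the 4-form `l ∧ T^ax`. -/
def teleLagrangian (θ : Pt → Matrix (Fin 4) (Fin 4) ℝ) (x : Pt) :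
    Fin 4 → Fin 4 → Fin 4 → Fin 4 → ℝ :=
  wedge13 (lForm θ x) (axialTorsion θ x)

/-! ### The gauge group and equivalence of coframes -/

/-- Lorentz transformations: smooth matrix functions with `o_{jk} Λ^j_r Λ^k_s = o_{rs}`. -/
def IsLorentz (U : Set Pt) (Λ : Pt → Matrix (Fin 4) (Fin 4) ℝ) : Prop :=
  SmoothMat U Λ ∧ ∀ x ∈ U, (Λ x).transpose * o * Λ x = o

/-- The action on coframes, `ϑ^j ↦ Λ^j_k ϑ^k`. -/
def act (Λ θ : Pt → Matrix (Fin 4) (Fin 4) ℝ) : Pt → Matrix (Fin 4) (Fin 4) ℝ :=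
  fun x => Λ x * θ x

/-- The gauge group `H`: the Lorentz transformations that preserve `l ∧ m` modulo `U(1)`. -/
def MemH (U : Set Pt) (g Λ : Pt → Matrix (Fin 4) (Fin 4) ℝ) : Prop :=
  IsLorentz U Λ ∧ ∀ θ, IsCoframe U g θ → EqModU1 U (lm θ) (lm (act Λ θ))

/-- The admissible coframes. -/
def Coframe (U : Set Pt) (g ref : Pt → Matrix (Fin 4) (Fin 4) ℝ) : Type :=
  {θ : Pt → Matrix (Fin 4) (Fin 4) ℝ // IsAdmissible U g ref θ}

/-- Two coframes are equivalent if, on `U`, they differ by a transformation from `H`. -/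
def CoframeEquiv (U : Set Pt) (g ref : Pt → Matrix (Fin 4) (Fin 4) ℝ)
    (θ θ' : Coframe U g ref) : Prop :=
  ∃ Λ, MemH U g Λ ∧ ∀ x ∈ U, θ'.1 x = act Λ θ.1 x

theorem o_mul_o : o * o = 1 := by
  ext i j
  fin_cases i <;> fin_cases j <;> simp [o, Matrix.mul_apply, Matrix.diagonal]

theorem SmoothMat.mul {U : Set Pt} {A B : Pt → Matrix (Fin 4) (Fin 4) ℝ}
    (hA : SmoothMat U A) (hB : SmoothMat U B) : SmoothMat U (fun x => A x * B x) := by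
  intro i j
  simp only [Matrix.mul_apply]
  exact ContDiffOn.sum fun k _ => (hA i k).mul (hB k j)

theorem SmoothMat.const (U : Set Pt) (A : Matrix (Fin 4) (Fin 4) ℝ) :
    SmoothMat U (fun _ => A) := fun _ _ => contDiffOn_const

theorem lorentz_left_inv {A : Matrix (Fin 4) (Fin 4) ℝ} (h : A.transpose * o * A = o) :
    o * A.transpose * o * A = 1 := by
  rw [Matrix.mul_assoc, Matrix.mul_assoc, ← Matrix.mul_assoc A.transpose, h, o_mul_o]

theorem lorentz_right_inv {A : Matrix (Fin 4) (Fin 4) ℝ} (h : A.transpose * o * A = o) :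
    A * (o * A.transpose * o) = 1 :=
  mul_eq_one_comm.mp (lorentz_left_inv h)

theorem lorentz_inv {A : Matrix (Fin 4) (Fin 4) ℝ} (h : A.transpose * o * A = o) :
    (o * A.transpose * o).transpose * o * (o * A.transpose * o) = o := by
  have ho : o.transpose = o := by simp [o]
  have e : A * o * A.transpose = o := by
    have h1 := lorentz_right_inv h
    calc A * o * A.transpose = A * (o * A.transpose * o) * o := by
          simp only [Matrix.mul_assoc, o_mul_o, Matrix.mul_one]
      _ = o := by rw [h1, Matrix.one_mul]
  simp only [Matrix.transpose_mul, Matrix.transpose_transpose, ho]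
  calc o * (A * o) * o * (o * A.transpose * o)
      = o * A * o * (o * o) * A.transpose * o := by simp only [Matrix.mul_assoc]
    _ = o * (A * o * A.transpose) * o := by
          rw [o_mul_o]
          simp only [Matrix.mul_assoc, Matrix.one_mul]
    _ = o := by rw [e, o_mul_o, Matrix.one_mul]

theorem IsCoframe.act {U : Set Pt} {g Λ θ : Pt → Matrix (Fin 4) (Fin 4) ℝ}
    (hΛ : IsLorentz U Λ) (hθ : IsCoframe U g θ) : IsCoframe U g (act Λ θ) := by
  refine ⟨hΛ.1.mul hθ.1, fun x hx => ?_⟩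
  rw [hθ.2 x hx, WeylTele.act, Matrix.transpose_mul]
  calc (θ x).transpose * o * θ x
      = (θ x).transpose * ((Λ x).transpose * o * Λ x) * θ x := by rw [hΛ.2 x hx]
    _ = _ := by simp only [Matrix.mul_assoc]

theorem lm_congr {θ θ' : Pt → Matrix (Fin 4) (Fin 4) ℝ} {x : Pt} (h : θ x = θ' x) :
    lm θ x = lm θ' x := by
  unfold lm lForm mForm
  rw [h]

theorem coframeEquiv_equivalence (U : Set Pt) (g ref : Pt → Matrix (Fin 4) (Fin 4) ℝ) :
    Equivalence (CoframeEquiv U g ref) where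
  refl θ := by
    refine ⟨fun _ => 1, ⟨⟨SmoothMat.const U 1, fun x _ => by simp⟩, fun η _ => ?_⟩,
      fun x _ => by simp [act]⟩
    exact (EqModU1.refl U _).congr_right fun x _ => lm_congr (by simp [act])
  symm := by
    rintro θ θ' ⟨Λ, ⟨hΛ, hH⟩, h⟩
    have hinv : IsLorentz U (fun x => o * (Λ x).transpose * o) :=
      ⟨((SmoothMat.const U o).mul fun i j => hΛ.1 j i).mul (SmoothMat.const U o),
        fun x hx => lorentz_inv (hΛ.2 x hx)⟩
    refine ⟨fun x => o * (Λ x).transpose * o, ⟨hinv, fun η hη => ?_⟩, fun x hx => ?_⟩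
    · refine ((hH _ (hη.act hinv)).congr_right fun x hx => lm_congr ?_).symm
      simp only [act]
      rw [← Matrix.mul_assoc, lorentz_right_inv (hΛ.2 x hx), Matrix.one_mul]
    · rw [act, h x hx, act, ← Matrix.mul_assoc, lorentz_left_inv (hΛ.2 x hx), Matrix.one_mul]
  trans := by
    rintro θ θ' θ'' ⟨Λ, ⟨hΛ, hH⟩, h⟩ ⟨Λ', ⟨hΛ', hH'⟩, h'⟩
    refine ⟨fun x => Λ' x * Λ x, ⟨⟨hΛ'.1.mul hΛ.1, fun x hx => ?_⟩, fun η hη => ?_⟩,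
      fun x hx => ?_⟩
    · rw [Matrix.transpose_mul]
      calc (Λ x).transpose * (Λ' x).transpose * o * (Λ' x * Λ x)
          = (Λ x).transpose * ((Λ' x).transpose * o * Λ' x) * Λ x := by
            simp only [Matrix.mul_assoc]
        _ = o := by rw [hΛ'.2 x hx, hΛ.2 x hx]
    · refine ((hH η hη).trans (hH' _ (hη.act hΛ))).congr_right fun x _ => lm_congr ?_
      simp only [act, Matrix.mul_assoc]
    · rw [h' x hx, act, h x hx, act, act, Matrix.mul_assoc]

/-- Equivalence of coframes modulo `H`. -/
def coframeSetoid (U : Set Pt) (g ref : Pt → Matrix (Fin 4) (Fin 4) ℝ) :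
    Setoid (Coframe U g ref) :=
  ⟨CoframeEquiv U g ref, coframeEquiv_equivalence U g ref⟩

/-! ### Spinor fields -/

/-- Nonvanishing smooth spinor fields `ξ^a` on `U`. -/
def Spinor (U : Set Pt) : Type :=
  {ξ : Pt → Fin 2 → ℂ // (∀ a, ContDiffOn ℝ ∞ (fun x => ξ x a) U) ∧ ∀ x ∈ U, ξ x ≠ 0}

/-- Equivalence of spinor fields: equality modulo `U(1)`. -/
def spinorSetoid (U : Set Pt) : Setoid (Spinor U) where
  r ξ η := EqModU1 U ξ.1 η.1
  iseqv := ⟨fun ξ => EqModU1.refl U ξ.1, EqModU1.symm, EqModU1.trans⟩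

/-- The metric spinor `ε`, the same for all positions and kinds of its indices. -/
def eps : Matrix (Fin 2) (Fin 2) ℂ := !![0, 1; -1, 0]

/-- Raising both spinor indices: `s^{a ḃ} = ε^{ac} ε^{ḃ ḋ} s_{c ḋ}`. -/
def spinUp (s : Matrix (Fin 2) (Fin 2) ℂ) : Matrix (Fin 2) (Fin 2) ℂ :=
  fun a b => ∑ c, ∑ d, eps a c * eps b d * s c d

/-- Raising the tensor index: `σ^α_{a ḃ} = g^{αβ} σ_{β a ḃ}`, where `σ x β a b = σ_{β a ḃ}(x)`. -/
def tensUp (g : Pt → Matrix (Fin 4) (Fin 4) ℝ) (σ : Pt → Fin 4 → Matrix (Fin 2) (Fin 2) ℂ)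
    (x : Pt) (α : Fin 4) : Matrix (Fin 2) (Fin 2) ℂ :=
  fun a b => ∑ β, ((g x)⁻¹ α β : ℂ) * σ x β a b

/-- Second order Pauli matrices
`σ_{αβac} = (1/2)(σ_{α a ḃ} ε^{ḃ ḋ} σ_{β c ḋ} - σ_{β a ḃ} ε^{ḃ ḋ} σ_{α c ḋ})`. -/
def sigma2 (σ : Pt → Fin 4 → Matrix (Fin 2) (Fin 2) ℂ) (x : Pt)
    (α β : Fin 4) (a c : Fin 2) : ℂ :=
  (1 / 2) * ∑ b, ∑ d,
    (σ x α a b * eps b d * σ x β c d - σ x β a b * eps b d * σ x α c d)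

/-- The Hodge dual
`(*σ)_{γδab} = (1/2) √|det g| σ^{αβ}_{ab} ε_{αβγδ}` of the second order Pauli matrices. -/
def hodgeSigma2 (g : Pt → Matrix (Fin 4) (Fin 4) ℝ)
    (σ : Pt → Fin 4 → Matrix (Fin 2) (Fin 2) ℂ) (x : Pt)
    (γ δ : Fin 4) (a b : Fin 2) : ℂ :=
  (1 / 2) * (Real.sqrt |(g x).det| : ℂ) * ∑ α, ∑ β,
    (∑ μ, ∑ ν, ((g x)⁻¹ α μ : ℂ) * ((g x)⁻¹ β ν : ℂ) * sigma2 σ x μ ν a b) *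
      (leviCivita α β γ δ : ℂ)

/-- The covector `σ_{α a ḃ} ξ^a ξ̄^ḃ` of a spinor. -/
def current (σ : Pt → Fin 4 → Matrix (Fin 2) (Fin 2) ℂ) (x : Pt) (ξ : Fin 2 → ℂ) : Fin 4 → ℂ :=
  fun α => ∑ a, ∑ b, σ x α a b * ξ a * (starRingEnd ℂ) (ξ b)

/-- The forward light cone of the coframe `θ` at `x`: the covectors `c_j ϑ^j` with
`o^{jk} c_j c_k = 0` and `c_0 > 0`, regarded as complex covectors. -/
def forwardCone (θ : Pt → Matrix (Fin 4) (Fin 4) ℝ) (x : Pt) : Set (Fin 4 → ℂ) :=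
  {v | ∃ c : Fin 4 → ℝ, (∑ j, ∑ k, o j k * c j * c k) = 0 ∧ 0 < c 0 ∧
    ∀ α, v α = ((∑ j, c j * θ x j α : ℝ) : ℂ)}

/-- Pauli matrices `σ_{α a ḃ}` for the metric `g`, agreeing in time direction and orientation with
the reference coframe: smooth Hermitian matrices with
`σ^α_{a ḃ} σ^{β c ḃ} + σ^β_{a ḃ} σ^{α c ḃ} = 2 g^{αβ} δ_a^c`, whose covectors
`σ_{α a ḃ} ξ^a ξ̄^ḃ`, `ξ ≠ 0`, form the forward light cone, and with `*σ = -iσ`. -/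
structure IsPauli (U : Set Pt) (g ref : Pt → Matrix (Fin 4) (Fin 4) ℝ)
    (σ : Pt → Fin 4 → Matrix (Fin 2) (Fin 2) ℂ) : Prop where
  smooth : ∀ α a b, ContDiffOn ℝ ∞ (fun x => σ x α a b) U
  hermitian : ∀ x ∈ U, ∀ α, (σ x α).IsHermitian
  clifford : ∀ x ∈ U, ∀ α β a c,
    ∑ b, (tensUp g σ x α a b * spinUp (tensUp g σ x β) c b +
      tensUp g σ x β a b * spinUp (tensUp g σ x α) c b) =
    2 * ((g x)⁻¹ α β : ℂ) * (if a = c then 1 else 0)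
  cone : ∀ x ∈ U, {v | ∃ ξ : Fin 2 → ℂ, ξ ≠ 0 ∧ v = current σ x ξ} = forwardCone ref x
  polarization : ∀ x ∈ U, ∀ γ δ a b,
    hodgeSigma2 g σ x γ δ a b = -Complex.I * sigma2 σ x γ δ a b

/-- The 2-form `σ_{αβab} ξ^a ξ^b`. -/
def spinorForm (σ : Pt → Fin 4 → Matrix (Fin 2) (Fin 2) ℂ) (ξ : Pt → Fin 2 → ℂ) (x : Pt) :
    Fin 4 → Fin 4 → ℂ :=
  fun α β => ∑ a, ∑ b, sigma2 σ x α β a b * ξ x a * ξ x b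

/-! ### The Weyl Lagrangian -/

/-- Christoffel symbols
`Γ^β_{αγ} = (1/2) g^{βδ} (∂_α g_{γδ} + ∂_γ g_{αδ} - ∂_δ g_{αγ})` of the metric. -/
def christoffel (g : Pt → Matrix (Fin 4) (Fin 4) ℝ) (x : Pt) (β α γ : Fin 4) : ℝ :=
  (1 / 2) * ∑ δ, (g x)⁻¹ β δ *
    (pd α (fun y => g y γ δ) x + pd γ (fun y => g y α δ) x - pd δ (fun y => g y α γ) x)

/-- The Levi-Civita covariant derivative of a spinor field,
`∇_α ξ^a = ∂_α ξ^a + (1/4) σ_β^{a ċ} (∂_α σ^β_{b ċ} + Γ^β_{αγ} σ^γ_{b ċ}) ξ^b`. -/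
def covDeriv (g : Pt → Matrix (Fin 4) (Fin 4) ℝ) (σ : Pt → Fin 4 → Matrix (Fin 2) (Fin 2) ℂ)
    (ξ : Pt → Fin 2 → ℂ) (x : Pt) (α : Fin 4) (a : Fin 2) : ℂ :=
  pd α (fun y => ξ y a) x + (1 / 4) * ∑ β, ∑ b, ∑ c, spinUp (σ x β) a c *
    (pd α (fun y => tensUp g σ y β b c) x +
      ∑ γ, (christoffel g x β α γ : ℂ) * tensUp g σ x γ b c) * ξ x b

/-- The Weyl Lagrangian, the 4-form
`(i/2) (ξ̄^ḃ σ^α_{a ḃ} ∇_α ξ^a - ξ^a σ^α_{a ḃ} ∇_α ξ̄^ḃ) *1`, where `∇_α ξ̄^ḃ` is the complex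
conjugate of `∇_α ξ^b` and `*1` has components `√|det g| ε_{αβγδ}`. -/
def weylLagrangian (g : Pt → Matrix (Fin 4) (Fin 4) ℝ)
    (σ : Pt → Fin 4 → Matrix (Fin 2) (Fin 2) ℂ) (ξ : Pt → Fin 2 → ℂ) (x : Pt) :
    Fin 4 → Fin 4 → Fin 4 → Fin 4 → ℂ :=
  fun κ μ ν ρ => (Complex.I / 2) * (∑ α, ∑ a, ∑ b,
    ((starRingEnd ℂ) (ξ x b) * tensUp g σ x α a b * covDeriv g σ ξ x α a -
      ξ x a * tensUp g σ x α a b * (starRingEnd ℂ) (covDeriv g σ ξ x α b))) *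
    ((Real.sqrt |(g x).det| * leviCivita κ μ ν ρ : ℝ) : ℂ)

end WeylTele

end

noncomputable section

namespace WeylTele

open Matrix Topology Filter

/-! An admissible coframe is, up to a sign, the same thing as a unimodular spin frame. If `B` has
determinant 1, the Hermitian matrices `B σ_α Bᴴ` have real coefficients in the basis `tau`, and
these coefficients form a quartet of covectors; `Adapted` records this relation. The determinant is
the quadratic form of Minkowski space and is unchanged by unimodular `B`, so the quartet is
orthonormal (`Adapted.metric_eq`); the polarization `*σ = -iσ` makes it positively oriented
(`Adapted.det_pos`); the cone condition gives it the right time direction. Conversely, every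
admissible frame at a point arises from some `B` (`exists_adapted`): Hermitian tetrads have a normal
form, and its one undetermined sign is fixed by orientation.

The matrix `frameMat` has first row `(l, m)`. Hence the first row `ξ` of `B` satisfies `σ_{αβab} ξ^a
ξ^b = (l ∧ m)_{αβ}` (`Adapted.row_zero`), and this is the correspondence. From coframe to spinor,
`B` is fixed pointwise up to sign; its first row is a smooth field modulo sign, which lifts through
the double covering of the nonzero spinors because `U` is simply connected
(`exists_smooth_adapted`). From spinor to coframe, `ξ` is completed to a unimodular matrix
(`exists_coframe_of_spinor`). The choice of second row is immaterial, because coframes with the same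
`l ∧ m` modulo `U(1)` are equivalent (`coframeEquiv_iff`). Equal bivectors modulo `U(1)` give
spinors whose ratio is a continuous square root of a constant, hence constant (`eqModU1_row_zero`).

For the Lagrangians, the spinor `ξ` is constant in the adapted spin frame, so `∇ξ` reduces to
connection coefficients, expressed by derivatives of the frame and Christoffel symbols
(`connection_conj`). They enter the Weyl density through the constants `tauCubic`, which are totally
antisymmetric once the frame indices are lowered. The Christoffel symbols, being symmetric, cancel,
and what survives is `l` contracted with the axial torsion (`weylDensity_im`). Comparison with the
frame expansion `teleLagrangian_eq` gives the factor `-4/3`. -/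

/-! ### Constant Pauli matrices and adapted spin frames -/

/-- The constant Pauli matrices of Minkowski space, with the polarization of `IsPauli`. -/
def tau : Fin 4 → Matrix (Fin 2) (Fin 2) ℂ :=
  ![1, !![0, 1; 1, 0], !![0, Complex.I; -Complex.I, 0], !![1, 0; 0, -1]]

/-- The Pauli matrices `τ_j ϑ^j_α` of a quartet of covectors. -/
def frameMat (T : Matrix (Fin 4) (Fin 4) ℝ) (α : Fin 4) : Matrix (Fin 2) (Fin 2) ℂ :=
  ∑ j, (T j α : ℂ) • tau j

theorem frameMat_eq (T : Matrix (Fin 4) (Fin 4) ℝ) (α : Fin 4) :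
    frameMat T α = !![(T 0 α : ℂ) + T 3 α, (T 1 α : ℂ) + Complex.I * T 2 α;
      (T 1 α : ℂ) - Complex.I * T 2 α, (T 0 α : ℂ) - T 3 α] := by
  ext i j
  fin_cases i <;> fin_cases j <;>
    simp [frameMat, tau, Fin.sum_univ_four] <;> ring

/-- The unimodular matrix `B`, whose rows are two spinors, brings the Pauli matrices `s` to the
constant Pauli matrices in the frame `T`. -/
structure Adapted (s : Fin 4 → Matrix (Fin 2) (Fin 2) ℂ) (T : Matrix (Fin 4) (Fin 4) ℝ)
    (B : Matrix (Fin 2) (Fin 2) ℂ) : Prop where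
  det : B.det = 1
  eq : ∀ α, B * s α * Bᴴ = frameMat T α

/-- Antisymmetric 2 × 2 matrices form a line, on which congruence by `B` acts through the
determinant. Unimodular changes of spin frame therefore preserve `eps`. -/
theorem eps_conj (B : Matrix (Fin 2) (Fin 2) ℂ) : B * eps * Bᵀ = B.det • eps := by
  ext i j
  fin_cases i <;> fin_cases j <;>
    simp [eps, Matrix.mul_apply, Matrix.det_fin_two, Fin.sum_univ_two] <;> ring

theorem det_conjTranspose_eq_one {B : Matrix (Fin 2) (Fin 2) ℂ} (h : B.det = 1) :
    Bᴴ.det = 1 := by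
  rw [Matrix.det_conjTranspose, h, star_one]

/-- The matrix of `σ_{αβac}` in the spinor indices. -/
def bivectorMat (s : Fin 4 → Matrix (Fin 2) (Fin 2) ℂ) (α β : Fin 4) :
    Matrix (Fin 2) (Fin 2) ℂ :=
  (1 / 2 : ℂ) • (s α * eps * (s β)ᵀ - s β * eps * (s α)ᵀ)

theorem sigma2_eq (σ : Pt → Fin 4 → Matrix (Fin 2) (Fin 2) ℂ) (x : Pt) (α β : Fin 4)
    (a c : Fin 2) : sigma2 σ x α β a c = bivectorMat (σ x) α β a c := by
  simp [sigma2, bivectorMat, Matrix.mul_apply, Fin.sum_univ_two]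
  ring

theorem spinorForm_eq (σ : Pt → Fin 4 → Matrix (Fin 2) (Fin 2) ℂ) (ξ : Pt → Fin 2 → ℂ) (x : Pt)
    (α β : Fin 4) : spinorForm σ ξ x α β = ξ x ⬝ᵥ (bivectorMat (σ x) α β *ᵥ ξ x) := by
  simp only [spinorForm, sigma2_eq, dotProduct, mulVec, Fin.sum_univ_two]
  ring

namespace Adapted

variable {s : Fin 4 → Matrix (Fin 2) (Fin 2) ℂ} {T : Matrix (Fin 4) (Fin 4) ℝ}
  {B : Matrix (Fin 2) (Fin 2) ℂ}

/-- The contracted dotted index sees only `Bᴴ`, which is unimodular and so disappears into `eps`;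
the undotted indices transform by `B`. -/
theorem mul_eps_mul (h : Adapted s T B) (α β : Fin 4) :
    B * (s α * eps * (s β)ᵀ) * Bᵀ = frameMat T α * eps * (frameMat T β)ᵀ := by
  have e : Bᴴ * eps * Bᴴᵀ = eps := by
    rw [eps_conj, det_conjTranspose_eq_one h.det, one_smul]
  rw [← h.eq, ← h.eq]
  simp only [Matrix.transpose_mul]
  calc B * (s α * eps * (s β)ᵀ) * Bᵀ = B * (s α * (Bᴴ * eps * Bᴴᵀ) * (s β)ᵀ) * Bᵀ := by rw [e]
    _ = _ := by simp only [Matrix.mul_assoc]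

theorem bivectorMat_conj (h : Adapted s T B) (α β : Fin 4) :
    B * bivectorMat s α β * Bᵀ = bivectorMat (frameMat T) α β := by
  simp only [bivectorMat, Matrix.mul_smul, Matrix.smul_mul, Matrix.mul_sub, Matrix.sub_mul,
    h.mul_eps_mul]

/-- The quadratic form of `σ_{αβab}` on the spinor with components `w` in the adapted frame. -/
theorem quadratic (h : Adapted s T B) (w : Fin 2 → ℂ) (α β : Fin 4) :
    (w ᵥ* B) ⬝ᵥ (bivectorMat s α β *ᵥ (w ᵥ* B)) =
      w ⬝ᵥ (bivectorMat (frameMat T) α β *ᵥ w) := by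
  rw [← h.bivectorMat_conj, ← Matrix.dotProduct_mulVec, Matrix.mulVec_mulVec,
    ← Matrix.mulVec_transpose, Matrix.mulVec_mulVec]

theorem mul_adjugate (h : Adapted s T B) : B * B.adjugate = 1 := by
  rw [Matrix.mul_adjugate, h.det, one_smul]

theorem adjugate_mul (h : Adapted s T B) : B.adjugate * B = 1 := by
  rw [Matrix.adjugate_mul, h.det, one_smul]

end Adapted

/-- The components of `l ∧ m` in a frame. -/
def lmAt (T : Matrix (Fin 4) (Fin 4) ℝ) (α β : Fin 4) : ℂ :=
  ((T 0 α : ℂ) + T 3 α) * (T 1 β + Complex.I * T 2 β) -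
    ((T 0 β : ℂ) + T 3 β) * (T 1 α + Complex.I * T 2 α)

theorem lm_eq (θ : Pt → Matrix (Fin 4) (Fin 4) ℝ) (x : Pt) (α β : Fin 4) :
    lm θ x α β = lmAt (θ x) α β := by
  simp [lm, wedge11, lForm, mForm, lmAt]

/-- The first row of `frameMat` is `(l, m)`, and `eps` pairs the first rows at `α` and `β` into `l_α
m_β - m_α l_β`. This is where `l ∧ m` enters. -/
theorem bivectorMat_frameMat_zero (T : Matrix (Fin 4) (Fin 4) ℝ) (α β : Fin 4) :
    bivectorMat (frameMat T) α β 0 0 = lmAt T α β := by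
  simp only [bivectorMat, frameMat_eq, eps, lmAt, Matrix.smul_apply, Matrix.sub_apply,
    Matrix.mul_apply, Fin.sum_univ_two, Matrix.transpose_apply]
  simp
  ring

theorem Adapted.row_zero {s : Fin 4 → Matrix (Fin 2) (Fin 2) ℂ} {T : Matrix (Fin 4) (Fin 4) ℝ}
    {B : Matrix (Fin 2) (Fin 2) ℂ} (h : Adapted s T B) (α β : Fin 4) :
    B 0 ⬝ᵥ (bivectorMat s α β *ᵥ B 0) = lmAt T α β := by
  have := h.quadratic (Pi.single 0 1) α β
  rw [Matrix.single_one_vecMul, Matrix.mulVec_single_one, single_one_dotProduct] at this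
  exact this.trans (bivectorMat_frameMat_zero T α β)

/-! ### Metric -/

/-- Raising both spinor indices and transposing is the adjugate, so the Clifford relation becomes a
statement about determinants of 2 × 2 matrices. -/
theorem mul_eps_conj_transpose (X Y : Matrix (Fin 2) (Fin 2) ℂ) (a c : Fin 2) :
    ∑ b, X a b * spinUp Y c b = (X * Y.adjugate) a c := by
  fin_cases a <;> fin_cases c <;>
    simp [spinUp, eps, Matrix.mul_apply, Matrix.adjugate_fin_two, Fin.sum_univ_two]

theorem adjugate_add_two (X Y : Matrix (Fin 2) (Fin 2) ℂ) :
    (X + Y).adjugate = X.adjugate + Y.adjugate := by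
  ext i j
  fin_cases i <;> fin_cases j <;> simp [Matrix.adjugate_fin_two, add_comm]

theorem adjugate_smul_two (c : ℂ) (X : Matrix (Fin 2) (Fin 2) ℂ) :
    (c • X).adjugate = c • X.adjugate := by
  ext i j
  fin_cases i <;> fin_cases j <;> simp [Matrix.adjugate_fin_two]

theorem adjugate_sum_two {ι : Type*} (S : Finset ι) (X : ι → Matrix (Fin 2) (Fin 2) ℂ) :
    (∑ i ∈ S, X i).adjugate = ∑ i ∈ S, (X i).adjugate := by
  classical
  induction S using Finset.induction_on with
  | empty =>
    ext i j
    fin_cases i <;> fin_cases j <;> simp [Matrix.adjugate_fin_two]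
  | insert a S ha ih => rw [Finset.sum_insert ha, Finset.sum_insert ha, adjugate_add_two, ih]

/-- The polarized determinant, the left side of the Clifford relation. -/
def cliff (X Y : Matrix (Fin 2) (Fin 2) ℂ) : Matrix (Fin 2) (Fin 2) ℂ :=
  X * Y.adjugate + Y * X.adjugate

theorem cliff_sum_left {ι : Type*} (S : Finset ι) (c : ι → ℂ) (X : ι → Matrix (Fin 2) (Fin 2) ℂ)
    (Y : Matrix (Fin 2) (Fin 2) ℂ) :
    cliff (∑ i ∈ S, c i • X i) Y = ∑ i ∈ S, c i • cliff (X i) Y := by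
  simp only [cliff, adjugate_sum_two, adjugate_smul_two, Finset.sum_mul, Finset.mul_sum,
    smul_mul_assoc, mul_smul_comm, ← Finset.sum_add_distrib, smul_add]

theorem cliff_comm (X Y : Matrix (Fin 2) (Fin 2) ℂ) : cliff X Y = cliff Y X := add_comm _ _

theorem cliff_sum_right {ι : Type*} (S : Finset ι) (c : ι → ℂ) (X : ι → Matrix (Fin 2) (Fin 2) ℂ)
    (Y : Matrix (Fin 2) (Fin 2) ℂ) :
    cliff Y (∑ i ∈ S, c i • X i) = ∑ i ∈ S, c i • cliff Y (X i) := by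
  rw [cliff_comm, cliff_sum_left]
  simp only [cliff_comm]

/-- The factors `Bᴴ` and `Bᴴ.adjugate` meet and cancel, leaving a similarity by `B`; scalar
matrices, the values required by the Clifford relation, are therefore unchanged. -/
theorem cliff_conj {B : Matrix (Fin 2) (Fin 2) ℂ} (h : B.det = 1)
    (X Y : Matrix (Fin 2) (Fin 2) ℂ) :
    cliff (B * X * Bᴴ) (B * Y * Bᴴ) = B * cliff X Y * B.adjugate := by
  have e : Bᴴ * Bᴴ.adjugate = 1 := by
    rw [Matrix.mul_adjugate, det_conjTranspose_eq_one h, one_smul]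
  have key (X Y : Matrix (Fin 2) (Fin 2) ℂ) :
      B * X * Bᴴ * (B * Y * Bᴴ).adjugate = B * (X * Y.adjugate) * B.adjugate := by
    rw [Matrix.adjugate_mul_distrib, Matrix.adjugate_mul_distrib]
    calc _ = B * X * (Bᴴ * Bᴴ.adjugate) * Y.adjugate * B.adjugate := by
          simp only [Matrix.mul_assoc]
      _ = _ := by rw [e]; simp only [Matrix.mul_assoc, Matrix.one_mul]
  rw [cliff, key, key, cliff, Matrix.mul_add, Matrix.add_mul]

/-- The determinant of `Σ t_j τ_j` is the Minkowski square `t_0² - t_1² - t_2² - t_3²`; this is its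
polarization. -/
theorem cliff_frameMat (T : Matrix (Fin 4) (Fin 4) ℝ) (α β : Fin 4) :
    cliff (frameMat T α) (frameMat T β) 0 0 = 2 * ((Tᵀ * o * T) α β : ℝ) := by
  simp [cliff, frameMat_eq, o, Matrix.mul_apply, Fin.sum_univ_four, Matrix.adjugate_fin_two,
    Matrix.diagonal]
  ring_nf
  simp
  ring

theorem o_transpose : oᵀ = o := by simp [o]

theorem IsLorentzianMetric.transpose_eq {U : Set Pt} {g : Pt → Matrix (Fin 4) (Fin 4) ℝ}
    (hg : IsLorentzianMetric U g) {x : Pt} (hx : x ∈ U) : (g x)ᵀ = g x := by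
  obtain ⟨A, -, h⟩ := hg.2 x hx
  rw [h, Matrix.transpose_mul, Matrix.transpose_mul, o_transpose, Matrix.transpose_transpose,
    Matrix.mul_assoc]

theorem det_o : o.det = -1 := by simp [o, Fin.prod_univ_four]

theorem IsLorentzianMetric.det_ne_zero {U : Set Pt} {g : Pt → Matrix (Fin 4) (Fin 4) ℝ}
    (hg : IsLorentzianMetric U g) {x : Pt} (hx : x ∈ U) : (g x).det ≠ 0 := by
  obtain ⟨A, hA, h⟩ := hg.2 x hx
  rw [h, Matrix.det_mul, Matrix.det_mul, Matrix.det_transpose, det_o]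
  simpa using hA

theorem tensUp_eq (g : Pt → Matrix (Fin 4) (Fin 4) ℝ)
    (σ : Pt → Fin 4 → Matrix (Fin 2) (Fin 2) ℂ) (x : Pt) (α : Fin 4) :
    tensUp g σ x α = ∑ β, ((g x)⁻¹ α β : ℂ) • σ x β := by
  ext a b
  simp [tensUp, Matrix.sum_apply]

theorem IsPauli.cliff_tensUp {U : Set Pt} {g ref : Pt → Matrix (Fin 4) (Fin 4) ℝ}
    {σ : Pt → Fin 4 → Matrix (Fin 2) (Fin 2) ℂ} (hσ : IsPauli U g ref σ) {x : Pt} (hx : x ∈ U)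
    (α β : Fin 4) :
    cliff (tensUp g σ x α) (tensUp g σ x β) = (2 * ((g x)⁻¹ α β : ℂ)) • 1 := by
  ext a c
  have := hσ.clifford x hx α β a c
  rw [Finset.sum_add_distrib, mul_eps_conj_transpose, mul_eps_conj_transpose] at this
  rw [cliff, Matrix.add_apply, this]
  simp [Matrix.one_apply]

theorem sum_metric_tensUp {U : Set Pt} {g : Pt → Matrix (Fin 4) (Fin 4) ℝ}
    (hg : IsLorentzianMetric U g) (σ : Pt → Fin 4 → Matrix (Fin 2) (Fin 2) ℂ) {x : Pt}
    (hx : x ∈ U) (α : Fin 4) : ∑ β, (g x α β : ℂ) • tensUp g σ x β = σ x α := by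
  simp only [tensUp_eq, Finset.smul_sum, smul_smul]
  rw [Finset.sum_comm]
  have h : g x * (g x)⁻¹ = 1 := Matrix.mul_nonsing_inv _ (hg.det_ne_zero hx).isUnit
  have h' (γ : Fin 4) : ∑ β, (g x α β : ℂ) * ((g x)⁻¹ β γ : ℂ) = if α = γ then 1 else 0 := by
    have := congrFun (congrFun h α) γ
    rw [Matrix.mul_apply, Matrix.one_apply] at this
    have := congrArg (fun r : ℝ => (r : ℂ)) this
    push_cast at this
    rw [this]
    split_ifs <;> simp
  simp only [← Finset.sum_smul, h']
  simp

/-- The defining relation has both tensor indices raised; bilinearity of `cliff` allows them to be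
lowered one at a time. -/
theorem IsPauli.cliff_eq {U : Set Pt} {g ref : Pt → Matrix (Fin 4) (Fin 4) ℝ}
    {σ : Pt → Fin 4 → Matrix (Fin 2) (Fin 2) ℂ} (hg : IsLorentzianMetric U g)
    (hσ : IsPauli U g ref σ) {x : Pt} (hx : x ∈ U)
    (α β : Fin 4) :
    cliff (σ x α) (σ x β) = (2 * (g x α β : ℂ)) • 1 := by
  rw [← sum_metric_tensUp hg σ hx α, cliff_sum_left]
  have (i : Fin 4) : cliff (tensUp g σ x i) (σ x β) = (if i = β then 2 else 0 : ℂ) • 1 := by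
    rw [← sum_metric_tensUp hg σ hx β, cliff_sum_right]
    simp only [hσ.cliff_tensUp hx, smul_smul, ← Finset.sum_smul]
    congr 1
    have h : (g x)⁻¹ * g x = 1 := Matrix.nonsing_inv_mul _ (hg.det_ne_zero hx).isUnit
    have := congrFun (congrFun h i) β
    rw [Matrix.mul_apply, Matrix.one_apply] at this
    have := congrArg (fun r : ℝ => 2 * (r : ℂ)) this
    push_cast at this
    rw [Finset.mul_sum] at this
    rw [show (if i = β then 2 else 0 : ℂ) = 2 * ((if i = β then 1 else 0 : ℝ) : ℂ) by
      split_ifs <;> simp, ← this]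
    refine Finset.sum_congr rfl fun j _ => ?_
    have hs : g x β j = g x j β := congrFun (congrFun (hg.transpose_eq hx) j) β
    rw [hs]
    ring
  simp only [this, smul_smul, ← Finset.sum_smul]
  congr 1
  simp [mul_comm]

/-- A frame with an adapted spin frame is orthonormal. -/
theorem Adapted.metric_eq {U : Set Pt} {g ref : Pt → Matrix (Fin 4) (Fin 4) ℝ}
    {σ : Pt → Fin 4 → Matrix (Fin 2) (Fin 2) ℂ} (hg : IsLorentzianMetric U g)
    (hσ : IsPauli U g ref σ) {x : Pt} (hx : x ∈ U) {T : Matrix (Fin 4) (Fin 4) ℝ}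
    {B : Matrix (Fin 2) (Fin 2) ℂ} (h : Adapted (σ x) T B) : g x = Tᵀ * o * T := by
  ext α β
  have e := cliff_frameMat T α β
  rw [← h.eq, ← h.eq, cliff_conj h.det, hσ.cliff_eq hg hx, Matrix.mul_smul, Matrix.smul_mul,
    Matrix.mul_one, h.mul_adjugate] at e
  simp at e
  exact_mod_cast e

/-! ### Lifting through the double covering `ξ ↦ ± ξ` -/

/-- The nonzero vectors of `ℂ²`. -/
abbrev NonzeroSpinor : Type := {v : Fin 2 → ℂ // v ≠ 0}

theorem units_int_smul_ne_zero (u : ℤˣ) {v : Fin 2 → ℂ} (hv : v ≠ 0) : (u : ℤ) • v ≠ 0 := by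
  rcases Int.units_eq_one_or u with rfl | rfl <;> simpa

instance : MulAction ℤˣ NonzeroSpinor where
  smul u v := ⟨(u : ℤ) • v.1, units_int_smul_ne_zero u v.2⟩
  one_smul v := Subtype.ext (by
    change ((1 : ℤˣ) : ℤ) • v.1 = v.1
    simp)
  mul_smul u w v := Subtype.ext (by
    change ((u * w : ℤˣ) : ℤ) • v.1 = (u : ℤ) • (w : ℤ) • v.1
    rw [Units.val_mul, mul_smul])

theorem NonzeroSpinor.coe_smul (u : ℤˣ) (v : NonzeroSpinor) :
    (u • v : NonzeroSpinor).1 = (u : ℤ) • v.1 := rfl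

instance : ContinuousConstSMul ℤˣ NonzeroSpinor where
  continuous_const_smul u := by
    refine Continuous.subtype_mk ?_ _
    exact continuous_subtype_val.const_smul (u : ℤ)

instance : IsCancelSMul ℤˣ NonzeroSpinor where
  right_cancel' u w v h := by
    have h' : (u : ℤ) • v.1 = (w : ℤ) • v.1 := congrArg Subtype.val h
    have hv : v.1 ≠ -v.1 := fun e => v.2 (self_eq_neg.mp e)
    rcases Int.units_eq_one_or u with rfl | rfl <;>
      rcases Int.units_eq_one_or w with rfl | rfl
    · rfl
    · exact absurd (by simpa using h') hv
    · exact absurd (by simpa using h'.symm) hv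
    · rfl

instance : LocallyCompactSpace NonzeroSpinor :=
  (isOpen_ne (x := (0 : Fin 2 → ℂ))).locallyCompactSpace

/-- The finite group `±1` acts freely on the locally compact Hausdorff space of nonzero spinors; the
instances above supply what is needed for the quotient map to be a covering. -/
theorem isCoveringMap_mk_nonzeroSpinor :
    IsCoveringMap (Quotient.mk (MulAction.orbitRel ℤˣ NonzeroSpinor)) :=
  (isQuotientCoveringMap_quotientMk_of_properlyDiscontinuousSMul
    (G := ℤˣ) (E := NonzeroSpinor)).isCoveringMap

theorem mk_nonzeroSpinor_eq {v w : NonzeroSpinor} :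
    Quotient.mk (MulAction.orbitRel ℤˣ NonzeroSpinor) v = Quotient.mk _ w ↔
      v.1 = w.1 ∨ v.1 = -w.1 := by
  rw [Quotient.eq, MulAction.orbitRel_apply, MulAction.mem_orbit_iff]
  constructor
  · rintro ⟨u, rfl⟩
    rcases Int.units_eq_one_or u with rfl | rfl <;> simp [NonzeroSpinor.coe_smul]
  · rintro (h | h)
    · exact ⟨1, Subtype.ext (by simp [h])⟩
    · exact ⟨-1, Subtype.ext (by simp [NonzeroSpinor.coe_smul, h])⟩

/-- A nonvanishing vector field that is locally continuous up to sign has, on a simply connected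
open set, a continuous choice of signs. -/
theorem exists_continuousOn_lift {U : Set Pt} (hU : IsOpen U) (hUsc : IsSimplyConnected U)
    (ξ₀ : Pt → Fin 2 → ℂ) (h0 : ∀ x ∈ U, ξ₀ x ≠ 0)
    (hloc : ∀ x ∈ U, ∃ s : Pt → Fin 2 → ℂ, ContinuousAt s x ∧
      ∀ᶠ y in 𝓝 x, s y = ξ₀ y ∨ s y = -ξ₀ y) :
    ∃ ξ : Pt → Fin 2 → ℂ, ContinuousOn ξ U ∧ ∀ x ∈ U, ξ x = ξ₀ x ∨ ξ x = -ξ₀ x := by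
  have := hUsc.simplyConnectedSpace
  have := hU.locallyPathConnectedSpace
  let q := Quotient.mk (MulAction.orbitRel ℤˣ NonzeroSpinor)
  let p : U → NonzeroSpinor := fun x => ⟨ξ₀ x, h0 x x.2⟩
  have hcont : Continuous (q ∘ p) := by
    rw [continuous_iff_continuousAt]
    intro x
    obtain ⟨s, hs, hs'⟩ := hloc x x.2
    classical
    -- The local section `s` is controlled only near `x`. The modified `s'` equals `±ξ₀` everywhere,
    -- so it has the same image in the quotient, and it agrees with `s` near `x`, so it is
    -- continuous there.
    let s' : U → NonzeroSpinor := fun y =>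
      if s y = ξ₀ y then p y else ⟨-ξ₀ y, neg_ne_zero.mpr (h0 y y.2)⟩
    have e : q ∘ p = q ∘ s' := by
      funext y
      refine mk_nonzeroSpinor_eq.mpr ?_
      by_cases h : s y = ξ₀ y <;> simp [s', h, p]
    have hc : ContinuousAt s' x := by
      rw [IsInducing.continuousAt_iff (g := (Subtype.val : NonzeroSpinor → Fin 2 → ℂ)) ⟨rfl⟩]
      refine (hs.comp (f := fun y : U => (y : Pt)) continuousAt_subtype_val).congr ?_
      filter_upwards [continuousAt_subtype_val.eventually hs'] with y hy
      by_cases h : s y = ξ₀ y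
      · simp [s', h, p]
      · simp only [s', h, if_false, Function.comp_apply]
        exact hy.resolve_left h
    rw [e]
    exact (continuous_quotient_mk'.continuousAt).comp hc
  obtain ⟨x₀, hx₀⟩ := hUsc.nonempty
  obtain ⟨F, ⟨-, hF⟩, -⟩ := isCoveringMap_mk_nonzeroSpinor.existsUnique_continuousMap_lifts
    ⟨q ∘ p, hcont⟩ ⟨x₀, hx₀⟩ (p ⟨x₀, hx₀⟩) rfl
  classical
  refine ⟨fun x => if h : x ∈ U then (F ⟨x, h⟩).1 else 0, ?_, fun x hx => ?_⟩
  · rw [continuousOn_iff_continuous_domRestrict]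
    refine (continuous_subtype_val.comp F.continuous).congr fun x => ?_
    simp
  · have := congrFun hF ⟨x, hx⟩
    simpa [hx, p] using mk_nonzeroSpinor_eq.mp this

/-- Local smooth square root of a rank one symmetric spinor. -/
theorem exists_local_contDiffAt_root {ξ₀ : Pt → Fin 2 → ℂ} {x : Pt} (h0 : ξ₀ x ≠ 0)
    (hs : ∀ a b, ContDiffAt ℝ ∞ (fun y => ξ₀ y a * ξ₀ y b) x) :
    ∃ s : Pt → Fin 2 → ℂ, (∀ a, ContDiffAt ℝ ∞ (fun y => s y a) x) ∧
      ∀ᶠ y in 𝓝 x, s y = ξ₀ y ∨ s y = -ξ₀ y := by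
  obtain ⟨a, ha⟩ : ∃ a, ξ₀ x a ≠ 0 := by
    by_contra! h
    exact h0 (funext h)
  set c := ξ₀ x a with hc
  -- Normalizing by the value at `x` puts `z x = 1` in the slit plane, where the principal logarithm
  -- is smooth. Then `r` is a smooth square root of `(ξ₀ a)²`, and `ξ₀ a * ξ₀ b / r` equals `±ξ₀ b`.
  let z : Pt → ℂ := fun y => (ξ₀ y a * ξ₀ y a) / (c * c)
  let r : Pt → ℂ := fun y => c * Complex.exp (Complex.log (z y) / 2)
  have hz : ContDiffAt ℝ ∞ z x := (hs a a).div_const _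
  have hzx : z x = 1 := by
    simp only [z, ← hc]
    field_simp
  have hr : ContDiffAt ℝ ∞ r x := by
    refine contDiffAt_const.mul (ContDiffAt.cexp (ContDiffAt.div_const ?_ 2))
    have hlog : ContDiffAt ℝ ∞ Complex.log (z x) :=
      (Complex.contDiffAt_log (by rw [hzx]; exact Complex.one_mem_slitPlane)).restrict_scalars ℝ
    exact hlog.comp x hz
  have hrx : r x ≠ 0 := mul_ne_zero ha (Complex.exp_ne_zero _)
  refine ⟨fun y b => ξ₀ y a * ξ₀ y b / r y, fun b => by
    simp only [div_eq_mul_inv]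
    exact (hs a b).mul (hr.inv hrx), ?_⟩
  filter_upwards [hz.continuousAt.eventually_ne (show z x ≠ 0 by simp [hzx])] with y hy
  have hsq : r y ^ 2 = ξ₀ y a ^ 2 := by
    have : Complex.exp (Complex.log (z y) / 2) ^ 2 = z y := by
      rw [← Complex.exp_nat_mul]
      push_cast
      rw [mul_div_cancel₀ _ two_ne_zero, Complex.exp_log hy]
    simp only [r, mul_pow, this, z]
    field_simp
  have hya : ξ₀ y a ≠ 0 := fun h => hy (by simp [z, h])
  rcases sq_eq_sq_iff_eq_or_eq_neg.mp hsq with h | h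
  · left
    funext b
    rw [h]
    field_simp
  · right
    funext b
    simp only [h, Pi.neg_apply]
    field_simp

/-- On a simply connected open set, a nonvanishing spinor field whose symmetric square is smooth
is smooth after a suitable choice of signs. -/
theorem exists_contDiffOn_lift {U : Set Pt} (hU : IsOpen U) (hUsc : IsSimplyConnected U)
    (ξ₀ : Pt → Fin 2 → ℂ) (h0 : ∀ x ∈ U, ξ₀ x ≠ 0)
    (hs : ∀ a b, ContDiffOn ℝ ∞ (fun y => ξ₀ y a * ξ₀ y b) U) :
    ∃ ξ : Pt → Fin 2 → ℂ, (∀ a, ContDiffOn ℝ ∞ (fun x => ξ x a) U) ∧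
      ∀ x ∈ U, ξ x = ξ₀ x ∨ ξ x = -ξ₀ x := by
  have key (x : Pt) (hx : x ∈ U) := exists_local_contDiffAt_root (h0 x hx)
    fun a b => (hs a b).contDiffAt (hU.mem_nhds hx)
  obtain ⟨ξ, hξ, hξ'⟩ := exists_continuousOn_lift hU hUsc ξ₀ h0 fun x hx => by
    obtain ⟨s, hs, h⟩ := key x hx
    exact ⟨s, continuousAt_pi.mpr fun a => (hs a).continuousAt, h⟩
  refine ⟨ξ, fun b x hx => ?_, hξ'⟩
  obtain ⟨s, hs, h⟩ := key x hx
  have hx0 := h.self_of_nhds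
  have hξc : ContinuousAt ξ x := hξ.continuousAt (hU.mem_nhds hx)
  have hsc : ContinuousAt s x := continuousAt_pi.mpr fun a => (hs a).continuousAt
  have hUe := hU.eventually_mem hx
  have hne : ξ x ≠ 0 := by
    rcases hξ' x hx with e | e <;> simpa [e] using h0 x hx
  refine ContDiffAt.contDiffWithinAt ?_
  have hpm : ∀ᶠ y in 𝓝 x, ξ y = s y ∨ ξ y = -s y := by
    filter_upwards [h, hUe] with y hy hyU
    rcases hy with e | e <;> rcases hξ' y hyU with e' | e' <;> simp [e, e']
  -- The continuous lift `ξ` and the smooth local root `s` agree up to sign near `x`. Since `ξ x ≠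
  -- 0`, the sign at `x` persists nearby, and `ξ` inherits smoothness.
  rcases hpm.self_of_nhds with e | e
  · have : ∀ᶠ y in 𝓝 x, ξ y = s y := by
      have : ∀ᶠ y in 𝓝 x, ξ y + s y ≠ 0 :=
        (hξc.add hsc).eventually_ne (by
          rw [Pi.add_apply, ← e, ← two_smul ℂ]
          exact smul_ne_zero two_ne_zero hne)
      filter_upwards [this, hpm] with y h1 h2
      refine h2.resolve_right fun h3 => h1 (by simp [h3])
    refine (hs b).congr_of_eventuallyEq ?_
    filter_upwards [this] with y hy
    rw [hy]
  · have : ∀ᶠ y in 𝓝 x, ξ y = -s y := by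
      have : ∀ᶠ y in 𝓝 x, ξ y - s y ≠ 0 :=
        (hξc.sub hsc).eventually_ne (by
          rw [Pi.sub_apply, ← neg_eq_iff_eq_neg.mpr e, sub_neg_eq_add, ← two_smul ℂ]
          exact smul_ne_zero two_ne_zero hne)
      filter_upwards [this, hpm] with y h1 h2
      refine h2.resolve_left fun h3 => h1 (by simp [h3])
    refine (hs b).neg.congr_of_eventuallyEq ?_
    filter_upwards [this] with y hy
    rw [hy, Pi.neg_apply]

/-! ### Contractions with the Levi-Civita symbol -/

/-- The determinant of four rows. -/
def det4 {R : Type*} [CommRing R] (u v w z : Fin 4 → R) : R := (Matrix.of ![u, v, w, z]).det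

theorem det4_eq {R : Type*} [CommRing R] (u v w z : Fin 4 → R) :
    det4 u v w z =
      u 0 * v 1 * w 2 * z 3 - u 0 * v 1 * w 3 * z 2 - u 0 * v 2 * w 1 * z 3
      + u 0 * v 2 * w 3 * z 1 + u 0 * v 3 * w 1 * z 2 - u 0 * v 3 * w 2 * z 1
      - u 1 * v 0 * w 2 * z 3 + u 1 * v 0 * w 3 * z 2 + u 1 * v 2 * w 0 * z 3
      - u 1 * v 2 * w 3 * z 0 - u 1 * v 3 * w 0 * z 2 + u 1 * v 3 * w 2 * z 0
      + u 2 * v 0 * w 1 * z 3 - u 2 * v 0 * w 3 * z 1 - u 2 * v 1 * w 0 * z 3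
      + u 2 * v 1 * w 3 * z 0 + u 2 * v 3 * w 0 * z 1 - u 2 * v 3 * w 1 * z 0
      - u 3 * v 0 * w 1 * z 2 + u 3 * v 0 * w 2 * z 1 + u 3 * v 1 * w 0 * z 2
      - u 3 * v 1 * w 2 * z 0 - u 3 * v 2 * w 0 * z 1 + u 3 * v 2 * w 1 * z 0 := by
  simp [det4, Matrix.det_succ_row_zero, Fin.sum_univ_succ, Fin.succAbove]
  ring

theorem leviCivita_eq (α β γ δ : Fin 4) :
    leviCivita α β γ δ =
      det4 (Pi.single α 1) (Pi.single β 1) (Pi.single γ 1) (Pi.single δ 1) := by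
  unfold leviCivita det4
  congr 1
  ext i j
  fin_cases i <;> simp [Pi.single_apply, eq_comm]

theorem leviCivita_cast (α β γ δ : Fin 4) :
    (leviCivita α β γ δ : ℂ) =
      det4 (Pi.single α 1) (Pi.single β 1) (Pi.single γ 1) (Pi.single δ 1) := by
  rw [leviCivita_eq, det4_eq, det4_eq]
  have (a i : Fin 4) : ((Pi.single a 1 : Fin 4 → ℝ) i : ℂ) = (Pi.single a 1 : Fin 4 → ℂ) i := by
    rw [Pi.single_apply, Pi.single_apply]
    split_ifs <;> simp
  push_cast
  simp only [this]

section
variable {R : Type*} [CommRing R]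

theorem sum_mul_det4_first (u v w z : Fin 4 → R) :
    ∑ α, u α * det4 (Pi.single α 1) v w z = det4 u v w z := by
  simp [det4_eq, Fin.sum_univ_four, Pi.single_apply]
  ring

theorem sum_mul_det4_second (u v w z : Fin 4 → R) :
    ∑ α, v α * det4 u (Pi.single α 1) w z = det4 u v w z := by
  simp [det4_eq, Fin.sum_univ_four, Pi.single_apply]
  ring

theorem sum_mul_det4_third (u v w z : Fin 4 → R) :
    ∑ α, w α * det4 u v (Pi.single α 1) z = det4 u v w z := by
  simp [det4_eq, Fin.sum_univ_four, Pi.single_apply]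
  ring

theorem sum_mul_det4_fourth (u v w z : Fin 4 → R) :
    ∑ α, z α * det4 u v w (Pi.single α 1) = det4 u v w z := by
  simp [det4_eq, Fin.sum_univ_four, Pi.single_apply]
  ring

theorem det4_swap (u v w z : Fin 4 → R) : det4 v u w z = -det4 u v w z := by
  rw [det4_eq, det4_eq]
  ring

/-- The two terms of the wedge product contribute equally because the determinant is alternating;
the resulting 2 cancels the `1/2` in the Hodge dual. -/
theorem sum_wedge_mul_det4 (p q w z : Fin 4 → R) :
    ∑ α, ∑ β, (p α * q β - p β * q α) * det4 (Pi.single α 1) (Pi.single β 1) w z =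
      2 * det4 p q w z := by
  have h (p q : Fin 4 → R) :
      ∑ α, ∑ β, p α * q β * det4 (Pi.single α 1) (Pi.single β 1) w z = det4 p q w z := by
    simp only [mul_assoc, ← Finset.mul_sum, sum_mul_det4_second, sum_mul_det4_first]
  simp only [sub_mul, Finset.sum_sub_distrib]
  rw [h, Finset.sum_comm, show det4 p q w z = -det4 q p w z from det4_swap _ _ _ _, ← h q p]
  have : ∑ y, ∑ x, p y * q x * det4 (Pi.single x 1) (Pi.single y 1) w z =
      ∑ α, ∑ β, -(p α * q β * det4 (Pi.single α 1) (Pi.single β 1) w z) := by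
    refine Finset.sum_congr rfl fun a _ => Finset.sum_congr rfl fun b _ => ?_
    rw [det4_swap]
    ring
  rw [this, h q p]
  simp only [Finset.sum_neg_distrib]
  rw [h p q, det4_swap q p]
  ring

theorem det4_mulVec (N : Matrix (Fin 4) (Fin 4) R) (u v w z : Fin 4 → R) :
    det4 (N *ᵥ u) (N *ᵥ v) (N *ᵥ w) (N *ᵥ z) = N.det * det4 u v w z := by
  have : Matrix.of ![N *ᵥ u, N *ᵥ v, N *ᵥ w, N *ᵥ z] = Matrix.of ![u, v, w, z] * Nᵀ := by
    ext i j
    fin_cases i <;> simp [Matrix.mul_apply, mulVec, dotProduct, mul_comm]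
  rw [det4, this, Matrix.det_mul, Matrix.det_transpose, det4, mul_comm]

end

/-! ### Orientation -/

section Orientation
variable {U : Set Pt} {g ref : Pt → Matrix (Fin 4) (Fin 4) ℝ}
  {σ : Pt → Fin 4 → Matrix (Fin 2) (Fin 2) ℂ} {x : Pt} {T : Matrix (Fin 4) (Fin 4) ℝ}

theorem frame_det_ne_zero (hg : IsLorentzianMetric U g) (hx : x ∈ U) (h : g x = Tᵀ * o * T) :
    T.det ≠ 0 := by
  have := hg.det_ne_zero hx
  rw [h, Matrix.det_mul] at this
  exact right_ne_zero_of_mul this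

theorem metric_inv_eq (hg : IsLorentzianMetric U g) (hx : x ∈ U) (h : g x = Tᵀ * o * T) :
    (g x)⁻¹ = T⁻¹ * o * (T⁻¹)ᵀ := by
  have hT := (frame_det_ne_zero hg hx h).isUnit
  refine Matrix.inv_eq_left_inv ?_
  rw [h]
  calc T⁻¹ * o * (T⁻¹)ᵀ * (Tᵀ * o * T) = T⁻¹ * o * ((T⁻¹)ᵀ * Tᵀ) * o * T := by
        simp only [Matrix.mul_assoc]
    _ = T⁻¹ * (o * o) * T := by
        rw [← Matrix.transpose_mul, Matrix.mul_nonsing_inv _ hT, Matrix.transpose_one,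
          Matrix.mul_one, Matrix.mul_assoc T⁻¹ o o]
    _ = 1 := by rw [o_mul_o, Matrix.mul_one, Matrix.nonsing_inv_mul _ hT]

theorem metric_inv_mul_transpose (hg : IsLorentzianMetric U g) (hx : x ∈ U)
    (h : g x = Tᵀ * o * T) : (g x)⁻¹ * Tᵀ = T⁻¹ * o := by
  have hT := (frame_det_ne_zero hg hx h).isUnit
  rw [metric_inv_eq hg hx h, Matrix.mul_assoc, ← Matrix.transpose_mul,
    Matrix.mul_nonsing_inv _ hT, Matrix.transpose_one, Matrix.mul_one]

/-- Contracting the polarization condition with a spinor whose bivector is simple, `p ∧ q`, turns it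
into an identity between a determinant and that bivector. Tested on frame vectors, this identity
detects orientation. -/
theorem hodge_contract (hσ : IsPauli U g ref σ) (hx : x ∈ U) (v : Fin 2 → ℂ) (p q : Fin 4 → ℂ)
    (hpq : ∀ α β, v ⬝ᵥ (bivectorMat (σ x) α β *ᵥ v) = p α * q β - p β * q α) (γ δ : Fin 4) :
    (Real.sqrt |(g x).det| : ℂ) * det4 (((g x)⁻¹.map Complex.ofReal) *ᵥ p)
      (((g x)⁻¹.map Complex.ofReal) *ᵥ q) (Pi.single γ 1) (Pi.single δ 1) =
      -Complex.I * (p γ * q δ - p δ * q γ) := by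
  have hq (M : Matrix (Fin 2) (Fin 2) ℂ) : v ⬝ᵥ (M *ᵥ v) = ∑ a, ∑ b, v a * v b * M a b := by
    simp only [dotProduct, mulVec, Fin.sum_univ_two]
    ring
  have key : ∑ a, ∑ b, v a * v b * hodgeSigma2 g σ x γ δ a b =
      -Complex.I * (p γ * q δ - p δ * q γ) := by
    rw [← hpq, hq, Finset.mul_sum]
    refine Finset.sum_congr rfl fun a _ => ?_
    rw [Finset.mul_sum]
    refine Finset.sum_congr rfl fun b _ => ?_
    rw [hσ.polarization x hx, sigma2_eq]
    ring
  rw [← key]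
  set H := (g x)⁻¹ with hH
  have hup (α β : Fin 4) : ∑ a, ∑ b, v a * v b *
      (∑ μ, ∑ ν, (H α μ : ℂ) * (H β ν : ℂ) * sigma2 σ x μ ν a b) =
      (H.map Complex.ofReal *ᵥ p) α * (H.map Complex.ofReal *ᵥ q) β -
        (H.map Complex.ofReal *ᵥ p) β * (H.map Complex.ofReal *ᵥ q) α := by
    have h1 : ∑ a, ∑ b, v a * v b *
      (∑ μ, ∑ ν, (H α μ : ℂ) * (H β ν : ℂ) * sigma2 σ x μ ν a b) =
      ∑ μ, ∑ ν, (H α μ : ℂ) * (H β ν : ℂ) * (p μ * q ν - p ν * q μ) := by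
      simp only [← hpq, sigma2_eq, Fin.sum_univ_two, Finset.mul_sum,
        ← Finset.sum_add_distrib]
      refine Finset.sum_congr rfl fun μ _ => Finset.sum_congr rfl fun ν _ => ?_
      rw [hq]
      simp only [Fin.sum_univ_two]
      ring
    rw [h1]
    rw [mul_comm ((H.map Complex.ofReal *ᵥ p) β)]
    simp only [mulVec, dotProduct, Matrix.map_apply]
    rw [Finset.sum_mul_sum, Finset.sum_mul_sum, ← Finset.sum_sub_distrib]
    simp only [← Finset.sum_sub_distrib]
    refine Finset.sum_congr rfl fun μ _ => Finset.sum_congr rfl fun ν _ => ?_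
    ring
  have h2 : ∑ a, ∑ b, v a * v b * hodgeSigma2 g σ x γ δ a b =
      (1 / 2) * (Real.sqrt |(g x).det| : ℂ) * ∑ α, ∑ β,
        (∑ a, ∑ b, v a * v b *
          (∑ μ, ∑ ν, (H α μ : ℂ) * (H β ν : ℂ) * sigma2 σ x μ ν a b)) *
        (leviCivita α β γ δ : ℂ) := by
    simp only [hodgeSigma2, ← hH, Fin.sum_univ_two (fun a : Fin 2 => _), Finset.mul_sum,
      ← Finset.sum_add_distrib, Finset.sum_mul]
    refine Finset.sum_congr rfl fun α _ => Finset.sum_congr rfl fun β _ =>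
      Finset.sum_congr rfl fun μ _ => Finset.sum_congr rfl fun ν _ => ?_
    ring
  rw [h2]
  simp only [hup, leviCivita_cast, sum_wedge_mul_det4]
  ring

/-- Frames with an adapted spin frame are positively oriented. -/
theorem Adapted.det_pos (hg : IsLorentzianMetric U g) (hσ : IsPauli U g ref σ) (hx : x ∈ U)
    {B : Matrix (Fin 2) (Fin 2) ℂ} (h : Adapted (σ x) T B) : 0 < T.det := by
  have hm := h.metric_eq hg hσ hx
  have hT := (frame_det_ne_zero hg hx hm).isUnit
  let p : Fin 4 → ℂ := fun α => (T 0 α : ℂ) + T 3 α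
  let q : Fin 4 → ℂ := fun α => (T 1 α : ℂ) + Complex.I * T 2 α
  have hc := hodge_contract hσ hx (B 0) p q fun α β => by
    rw [h.row_zero]
    rfl
  let E : Matrix (Fin 4) (Fin 4) ℂ := T⁻¹.map Complex.ofReal
  have hE : E.det = (T.det : ℂ)⁻¹ := by
    have : E.det = ((T⁻¹.det : ℝ) : ℂ) := (RingHom.map_det Complex.ofRealHom T⁻¹).symm
    rw [this, Matrix.det_nonsing_inv, Ring.inverse_eq_inv']
    push_cast
    rfl
  have hHT (j α : Fin 4) : ∑ β, ((g x)⁻¹ α β : ℂ) * T j β = E α j * o j j := by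
    have := congrFun (congrFun (metric_inv_mul_transpose hg hx hm) α) j
    rw [o, Matrix.mul_diagonal] at this
    have := congrArg (fun r : ℝ => (r : ℂ)) this
    simp only [Matrix.mul_apply, Matrix.transpose_apply] at this
    push_cast at this
    rw [this]
    simp [E, o]
  have hp : (g x)⁻¹.map Complex.ofReal *ᵥ p = E *ᵥ ![1, 0, 0, -1] := by
    funext α
    simp only [mulVec, dotProduct, Matrix.map_apply, p, mul_add, Finset.sum_add_distrib, hHT]
    simp [o, Fin.sum_univ_four]
  have hq : (g x)⁻¹.map Complex.ofReal *ᵥ q = E *ᵥ ![0, -1, -Complex.I, 0] := by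
    funext α
    simp only [mulVec, dotProduct, Matrix.map_apply, q, mul_add, Finset.sum_add_distrib,
      mul_left_comm _ Complex.I, ← Finset.mul_sum, hHT]
    simp [o, Fin.sum_univ_four]
    ring
  have hTE (j k : Fin 4) : ∑ α, (T j α : ℂ) * E α k = if j = k then 1 else 0 := by
    have := congrFun (congrFun (Matrix.mul_nonsing_inv _ hT) j) k
    rw [Matrix.mul_apply, Matrix.one_apply] at this
    have := congrArg (fun r : ℝ => (r : ℂ)) this
    push_cast at this
    rw [show ∑ α, (T j α : ℂ) * E α k = _ from this]
    split_ifs <;> simp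
  have hpE (k : Fin 4) : ∑ α, E α k * p α = if k = 0 ∨ k = 3 then 1 else 0 := by
    have : ∑ α, E α k * p α = ∑ α, (T 0 α : ℂ) * E α k + ∑ α, (T 3 α : ℂ) * E α k := by
      rw [← Finset.sum_add_distrib]
      exact Finset.sum_congr rfl fun α _ => by simp only [p]; ring
    rw [this, hTE, hTE]
    fin_cases k <;> simp
  have hqE (k : Fin 4) : ∑ α, E α k * q α =
      if k = 1 then 1 else if k = 2 then Complex.I else 0 := by
    have : ∑ α, E α k * q α =
        ∑ α, (T 1 α : ℂ) * E α k + Complex.I * ∑ α, (T 2 α : ℂ) * E α k := by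
      rw [Finset.mul_sum, ← Finset.sum_add_distrib]
      exact Finset.sum_congr rfl fun α _ => by simp only [q]; ring
    rw [this, hTE, hTE]
    fin_cases k <;> simp
  -- Evaluation of the duality identity for `l ∧ m` on the frame vectors `e_0, e_1`. The right side
  -- is `-i`, as `l(e_0) = m(e_1) = 1` and `m(e_0) = l(e_1) = 0`; the left side is `-i √|det g| /
  -- det T`. Hence `det T = √|det g|`.
  have hsum : ∑ γ, ∑ δ, E γ 0 * (E δ 1 * ((Real.sqrt |(g x).det| : ℂ) *
      det4 (E *ᵥ ![1, 0, 0, -1]) (E *ᵥ ![0, -1, -Complex.I, 0]) (Pi.single γ 1)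
        (Pi.single δ 1))) = ∑ γ, ∑ δ, E γ 0 * (E δ 1 *
          (-Complex.I * (p γ * q δ - p δ * q γ))) := by
    simp only [← hp, ← hq, hc]
  have hr : ∑ γ, ∑ δ, E γ 0 * (E δ 1 * (-Complex.I * (p γ * q δ - p δ * q γ))) =
      -Complex.I := by
    have : ∑ γ, ∑ δ, E γ 0 * (E δ 1 * (-Complex.I * (p γ * q δ - p δ * q γ))) =
        -Complex.I * ((∑ γ, E γ 0 * p γ) * (∑ δ, E δ 1 * q δ) -
          (∑ γ, E γ 0 * q γ) * (∑ δ, E δ 1 * p δ)) := by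
      rw [Finset.sum_mul_sum, Finset.sum_mul_sum, ← Finset.sum_sub_distrib]
      simp only [← Finset.sum_sub_distrib]
      simp only [Finset.mul_sum]
      refine Finset.sum_congr rfl fun γ _ => Finset.sum_congr rfl fun δ _ => ?_
      ring
    rw [this, hpE, hpE, hqE, hqE]
    simp
  have hl : ∑ γ, ∑ δ, E γ 0 * (E δ 1 * ((Real.sqrt |(g x).det| : ℂ) *
      det4 (E *ᵥ ![1, 0, 0, -1]) (E *ᵥ ![0, -1, -Complex.I, 0]) (Pi.single γ 1)
        (Pi.single δ 1))) = (Real.sqrt |(g x).det| : ℂ) * (E.det * -Complex.I) := by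
    have e0 : (fun γ => E γ 0) = E *ᵥ Pi.single 0 1 := by
      funext γ
      simp
    have e1 : (fun γ => E γ 1) = E *ᵥ Pi.single 1 1 := by
      funext γ
      simp
    simp only [← mul_left_comm (Real.sqrt |(g x).det| : ℂ), ← Finset.mul_sum]
    simp only [sum_mul_det4_fourth _ _ _ (fun δ => E δ 1),
      sum_mul_det4_third _ _ (fun δ => E δ 0)]
    rw [e0, e1, det4_mulVec]
    congr 2
    simp [det4_eq]
  rw [hl, hr, hE, ← mul_assoc, mul_eq_right₀ (neg_ne_zero.mpr Complex.I_ne_zero)] at hsum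
  have h1 : Real.sqrt |(g x).det| * T.det⁻¹ = 1 := by exact_mod_cast hsum
  have h2 : 0 ≤ Real.sqrt |(g x).det| := Real.sqrt_nonneg _
  by_contra hneg
  have : T.det⁻¹ ≤ 0 := inv_nonpos.mpr (not_lt.mp hneg)
  nlinarith [mul_nonneg_of_nonpos_of_nonpos this (neg_nonpos.mpr h2)]

end Orientation

/-! ### Normal form of Hermitian tetrads -/

/-- Four Hermitian matrices that satisfy the Clifford relations of Minkowski space. -/
structure IsTetrad (s : Fin 4 → Matrix (Fin 2) (Fin 2) ℂ) : Prop where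
  hermitian : ∀ j, (s j).IsHermitian
  cliff : ∀ i j, cliff (s i) (s j) = (2 * (o i j : ℂ)) • 1

theorem cliff_apply_zero (X Y : Matrix (Fin 2) (Fin 2) ℂ) :
    cliff X Y 0 0 = X 0 0 * Y 1 1 + X 1 1 * Y 0 0 - X 0 1 * Y 1 0 - X 1 0 * Y 0 1 := by
  simp [cliff, Matrix.mul_apply, Matrix.adjugate_fin_two, Fin.sum_univ_two]
  ring

theorem IsTetrad.polar {s : Fin 4 → Matrix (Fin 2) (Fin 2) ℂ} (h : IsTetrad s) (i j : Fin 4) :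
    s i 0 0 * s j 1 1 + s i 1 1 * s j 0 0 - s i 0 1 * s j 1 0 - s i 1 0 * s j 0 1 =
      2 * (o i j : ℂ) := by
  rw [← cliff_apply_zero, h.cliff]
  simp

theorem IsTetrad.conj {s : Fin 4 → Matrix (Fin 2) (Fin 2) ℂ} (h : IsTetrad s)
    {B : Matrix (Fin 2) (Fin 2) ℂ} (hB : B.det = 1) : IsTetrad fun j => B * s j * Bᴴ where
  hermitian j := Matrix.isHermitian_mul_mul_conjTranspose B (h.hermitian j)
  cliff i j := by
    rw [cliff_conj hB, h.cliff, Matrix.mul_smul, Matrix.smul_mul, Matrix.mul_one,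
      Matrix.mul_adjugate, hB, one_smul]

theorem IsTetrad.entries {s : Fin 4 → Matrix (Fin 2) (Fin 2) ℂ} (h : IsTetrad s) (j : Fin 4) :
    s j 1 0 = star (s j 0 1) ∧ (((s j 0 0).re : ℝ) : ℂ) = s j 0 0 ∧
      (((s j 1 1).re : ℝ) : ℂ) = s j 1 1 :=
  ⟨((h.hermitian j).apply 1 0).symm, Complex.conj_eq_iff_re.mp ((h.hermitian j).apply 0 0),
    Complex.conj_eq_iff_re.mp ((h.hermitian j).apply 1 1)⟩

theorem conj_fin_two (a b c d : ℂ) (X : Matrix (Fin 2) (Fin 2) ℂ) :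
    !![a, b; c, d] * X * !![a, b; c, d]ᴴ =
      !![(a * X 0 0 + b * X 1 0) * (starRingEnd ℂ) a + (a * X 0 1 + b * X 1 1) * (starRingEnd ℂ) b,
        (a * X 0 0 + b * X 1 0) * (starRingEnd ℂ) c + (a * X 0 1 + b * X 1 1) * (starRingEnd ℂ) d;
        (c * X 0 0 + d * X 1 0) * (starRingEnd ℂ) a + (c * X 0 1 + d * X 1 1) * (starRingEnd ℂ) b,
        (c * X 0 0 + d * X 1 0) * (starRingEnd ℂ) c +
          (c * X 0 1 + d * X 1 1) * (starRingEnd ℂ) d] := by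
  ext i j
  fin_cases i <;> fin_cases j <;>
    simp [Matrix.mul_apply, Fin.sum_univ_two, Matrix.vecMul, dotProduct]

/-- Cholesky step. -/
theorem IsTetrad.exists_normalize_zero {s : Fin 4 → Matrix (Fin 2) (Fin 2) ℂ} (h : IsTetrad s)
    (hpos : 0 < (s 0 0 0).re) :
    ∃ B : Matrix (Fin 2) (Fin 2) ℂ, B.det = 1 ∧ B * s 0 * Bᴴ = 1 := by
  obtain ⟨h10, h00, h11⟩ := h.entries 0
  set p := (s 0 0 0).re with hp
  set k : ℂ := ((Real.sqrt p : ℝ) : ℂ) with hk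
  have hk2 : k * k = s 0 0 0 := by
    rw [hk, ← h00, ← Complex.ofReal_mul, Real.mul_self_sqrt hpos.le]
  have hk0 : k ≠ 0 := by
    rw [hk, Complex.ofReal_ne_zero]
    exact (Real.sqrt_pos.mpr hpos).ne'
  have hks : (starRingEnd ℂ) k = k := Complex.conj_ofReal _
  have hdet := h.polar 0 0
  have ho : (o 0 0 : ℂ) = 1 := by simp [o]
  rw [ho] at hdet
  -- With `k = √(s_0)_{00}`, this lower triangular matrix clears the off-diagonal entries. The last
  -- diagonal entry becomes `det s_0`, which is 1 by the Clifford relation for the index pair `0,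
  -- 0`.
  refine ⟨!![k⁻¹, 0; -(s 0 1 0) * k⁻¹, k], by simp [Matrix.det_fin_two, hk0], ?_⟩
  have hq : (starRingEnd ℂ) (s 0 1 0) = s 0 0 1 := by rw [h10]; simp
  rw [conj_fin_two]
  ext i j
  fin_cases i <;> fin_cases j <;> simp [hks, hq] <;> field_simp
  · rw [pow_two, hk2]
  · rw [pow_two, hk2]
    ring
  · left
    rw [pow_two, hk2]
    ring
  · linear_combination (-2 * s 0 1 0 * s 0 0 1 + s 0 1 1 * (k * k + s 0 0 0) - 1) * hk2 +
      s 0 0 0 / 2 * hdet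

theorem conj_mul_conj (B C X : Matrix (Fin 2) (Fin 2) ℂ) :
    B * C * X * (B * C)ᴴ = B * (C * X * Cᴴ) * Bᴴ := by
  rw [Matrix.conjTranspose_mul]
  simp only [Matrix.mul_assoc]

theorem o_apply_ne {i j : Fin 4} (h : i ≠ j) : o i j = 0 := Matrix.diagonal_apply_ne _ h

/-- Orthogonality to `s 0 = 1` makes `s 3` traceless, and its determinant is `-1`, so it has
eigenvalues `±1`. Diagonalizing it by a special unitary matrix leaves `s 0` alone. -/
theorem IsTetrad.exists_normalize_three {s : Fin 4 → Matrix (Fin 2) (Fin 2) ℂ} (h : IsTetrad s)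
    (h0 : s 0 = 1) :
    ∃ B : Matrix (Fin 2) (Fin 2) ℂ, B.det = 1 ∧ B * Bᴴ = 1 ∧
      B * s 3 * Bᴴ = !![1, 0; 0, -1] := by
  have htr (j : Fin 4) (hj : 0 ≠ j) : s j 1 1 = -s j 0 0 := by
    have := h.polar 0 j
    rw [o_apply_ne hj, h0] at this
    simp at this
    linear_combination this
  have hdet : s 3 0 0 * s 3 1 1 - s 3 0 1 * s 3 1 0 = -1 := by
    have := h.polar 3 3
    have ho : (o 3 3 : ℂ) = -1 := by simp [o]
    rw [ho] at this
    linear_combination this / 2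
  have h11 := htr 3 (by decide)
  have hsing : (s 3 - 1).det = 0 := by
    simp [Matrix.det_fin_two]
    linear_combination hdet - h11
  obtain ⟨v, hv0, hv⟩ := Matrix.exists_vecMul_eq_zero_iff.mpr hsing
  rw [Matrix.vecMul_sub, Matrix.vecMul_one, sub_eq_zero] at hv
  set N : ℝ := Complex.normSq (v 0) + Complex.normSq (v 1) with hN
  have hNpos : 0 < N := by
    have h0 := Complex.normSq_nonneg (v 0)
    have h1 := Complex.normSq_nonneg (v 1)
    rcases (add_nonneg h0 h1).lt_or_eq with h | h
    · exact h
    · refine absurd (funext fun i => ?_) hv0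
      fin_cases i
      · exact Complex.normSq_eq_zero.mp (show Complex.normSq (v 0) = 0 by linarith)
      · exact Complex.normSq_eq_zero.mp (show Complex.normSq (v 1) = 0 by linarith)
  set k : ℂ := ((Real.sqrt N : ℝ) : ℂ) with hk
  have hk0 : k ≠ 0 := by
    rw [hk, Complex.ofReal_ne_zero]
    exact (Real.sqrt_pos.mpr hNpos).ne'
  have hkk : k * k = v 0 * (starRingEnd ℂ) (v 0) + v 1 * (starRingEnd ℂ) (v 1) := by
    rw [Complex.mul_conj, Complex.mul_conj, hk, ← Complex.ofReal_mul,
      Real.mul_self_sqrt hNpos.le, hN, Complex.ofReal_add]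
  have hks : (starRingEnd ℂ) k = k := Complex.conj_ofReal _
  have hv0' : v 0 * s 3 0 0 + v 1 * s 3 1 0 = v 0 := by
    have := congrFun hv 0
    simpa [vecMul, dotProduct, Fin.sum_univ_two] using this
  have hv1' : v 0 * s 3 0 1 + v 1 * s 3 1 1 = v 1 := by
    have := congrFun hv 1
    simpa [vecMul, dotProduct, Fin.sum_univ_two] using this
  obtain ⟨h10, h00, -⟩ := h.entries 3
  have c00 : (starRingEnd ℂ) (s 3 0 0) = s 3 0 0 := (h.hermitian 3).apply 0 0
  have c01 : (starRingEnd ℂ) (s 3 0 1) = s 3 1 0 := (h.hermitian 3).apply 1 0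
  have c10 : (starRingEnd ℂ) (s 3 1 0) = s 3 0 1 := (h.hermitian 3).apply 0 1
  have c11 : (starRingEnd ℂ) (s 3 1 1) = s 3 1 1 := (h.hermitian 3).apply 1 1
  have hc0 := congrArg (starRingEnd ℂ) hv0'
  have hc1 := congrArg (starRingEnd ℂ) hv1'
  simp only [map_add, map_mul, c00, c01, c10, c11] at hc0 hc1
  have hw0 : (starRingEnd ℂ) (v 1) * s 3 0 0 - (starRingEnd ℂ) (v 0) * s 3 1 0 =
      -(starRingEnd ℂ) (v 1) := by
    linear_combination -hc1 + (starRingEnd ℂ) (v 1) * h11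
  have hw1 : (starRingEnd ℂ) (v 1) * s 3 0 1 - (starRingEnd ℂ) (v 0) * s 3 1 1 =
      (starRingEnd ℂ) (v 0) := by
    linear_combination hc0 - (starRingEnd ℂ) (v 0) * h11
  -- The rows are the normalized left eigenvector for `1` and its orthogonal companion, a left
  -- eigenvector for `-1` by `hw0` and `hw1`.
  refine ⟨!![v 0 * k⁻¹, v 1 * k⁻¹; -(starRingEnd ℂ) (v 1) * k⁻¹, (starRingEnd ℂ) (v 0) * k⁻¹],
    ?_, ?_, ?_⟩
  · simp [Matrix.det_fin_two]
    field_simp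
    linear_combination -hkk
  · ext i j
    fin_cases i <;> fin_cases j <;>
      simp [Matrix.mul_apply, Fin.sum_univ_two, hks] <;> field_simp
    · linear_combination -hkk
    · ring
    · ring
    · linear_combination -hkk
  · rw [conj_fin_two]
    ext i j
    fin_cases i <;> fin_cases j <;> simp [hks] <;> field_simp
    · linear_combination -hkk + (starRingEnd ℂ) (v 0) * hv0' + (starRingEnd ℂ) (v 1) * hv1'
    · linear_combination -(v 1) * hv0' + (v 0) * hv1'
    · linear_combination -(starRingEnd ℂ) (v 0) * hw0 - (starRingEnd ℂ) (v 1) * hw1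
    · linear_combination hkk + (v 1) * hw0 - (v 0) * hw1

/-- Conjugation by `diag(u, ū)` multiplies the upper off-diagonal entry by `u²`, so `u` is taken to
be a square root of the conjugate of `z`. -/
theorem exists_sq_mul_eq_one {z : ℂ} (hz : z * (starRingEnd ℂ) z = 1) :
    ∃ u : ℂ, u * (starRingEnd ℂ) u = 1 ∧ u * u * z = 1 := by
  obtain ⟨u, hu⟩ := IsAlgClosed.exists_eq_mul_self ((starRingEnd ℂ) z)
  have h1 : ‖z‖ = 1 := by
    have : (‖z‖ : ℂ) ^ 2 = 1 := by rw [← Complex.mul_conj', hz]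
    have : ‖z‖ ^ 2 = 1 := by exact_mod_cast this
    exact (pow_eq_one_iff_of_nonneg (norm_nonneg _) two_ne_zero).mp this
  have h2 : ‖u‖ = 1 := by
    have := congrArg norm hu
    rw [RCLike.norm_conj, h1, norm_mul, ← pow_two] at this
    exact (pow_eq_one_iff_of_nonneg (norm_nonneg _) two_ne_zero).mp this.symm
  refine ⟨u, ?_, ?_⟩
  · rw [Complex.mul_conj', h2]
    simp
  · rw [← hu, mul_comm, hz]

/-- A Hermitian tetrad with `s₀` positive definite is conjugate to the standard one, up to the
sign of `s₂`. -/
theorem IsTetrad.exists_normal_form {s : Fin 4 → Matrix (Fin 2) (Fin 2) ℂ} (h : IsTetrad s)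
    (hpos : 0 < (s 0 0 0).re) :
    ∃ B : Matrix (Fin 2) (Fin 2) ℂ, B.det = 1 ∧ ∃ κ : ℝ, (κ = 1 ∨ κ = -1) ∧
      ∀ j, B * s j * Bᴴ = (if j = 2 then (κ : ℂ) else 1) • tau j := by
  obtain ⟨B₁, hB₁, e₁⟩ := h.exists_normalize_zero hpos
  obtain ⟨B₂, hB₂, hu₂, e₂⟩ := (h.conj hB₁).exists_normalize_three e₁
  have ht := (h.conj hB₁).conj hB₂
  set t : Fin 4 → Matrix (Fin 2) (Fin 2) ℂ := fun j => B₂ * (B₁ * s j * B₁ᴴ) * B₂ᴴ with htdef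
  have t0 : t 0 = 1 := by simp only [htdef, e₁, Matrix.mul_one, hu₂]
  have t3 : t 3 = !![1, 0; 0, -1] := e₂
  -- Orthogonality to `τ_0 = 1` says that the diagonal entries sum to zero, orthogonality to `τ_3`
  -- that they are equal; both vanish.
  have hoff (j : Fin 4) (h0 : 0 ≠ j) (h3 : 3 ≠ j) : t j 0 0 = 0 ∧ t j 1 1 = 0 := by
    have a := ht.polar 0 j
    have b := ht.polar 3 j
    rw [o_apply_ne h0, t0] at a
    rw [o_apply_ne h3, t3] at b
    simp at a b
    exact ⟨by linear_combination (a - b) / 2, by linear_combination (a + b) / 2⟩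
  obtain ⟨a00, a11⟩ := hoff 1 (by decide) (by decide)
  obtain ⟨b00, b11⟩ := hoff 2 (by decide) (by decide)
  obtain ⟨a10, -, -⟩ := ht.entries 1
  obtain ⟨b10, -, -⟩ := ht.entries 2
  set z := t 1 0 1 with hz
  set w := t 2 0 1 with hw
  have o11 : (o 1 1 : ℂ) = -1 := by simp [o]
  have o22 : (o 2 2 : ℂ) = -1 := by simp [o]
  have hzz : z * (starRingEnd ℂ) z = 1 := by
    have := ht.polar 1 1
    rw [o11, a10, a00, a11, ← hz] at this
    simp only [Complex.star_def] at this
    linear_combination -this / 2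
  have hww : w * (starRingEnd ℂ) w = 1 := by
    have := ht.polar 2 2
    rw [o22, b10, b00, b11, ← hw] at this
    simp only [Complex.star_def] at this
    linear_combination -this / 2
  have hzw : z * (starRingEnd ℂ) w + (starRingEnd ℂ) z * w = 0 := by
    have := ht.polar 1 2
    rw [o_apply_ne (by decide), a10, a00, a11, ← hz, b10, b00, b11, ← hw] at this
    simp only [Complex.star_def, Complex.ofReal_zero] at this
    linear_combination -this
  obtain ⟨u, hu, huz⟩ := exists_sq_mul_eq_one hzz
  -- This is the upper off-diagonal entry of the third matrix after the phase rotation.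
  -- Orthogonality to `τ_1` makes it imaginary and its norm is 1, so it is `±i`: this is the origin
  -- of `κ`.
  set y := u * u * w with hy
  have hyc : (starRingEnd ℂ) (u * u) * (starRingEnd ℂ) z = 1 := by
    rw [← map_mul, huz, map_one]
  have hyy : (starRingEnd ℂ) y = -y := by
    have e1 : (starRingEnd ℂ) (u * u) = z := by
      have : (starRingEnd ℂ) (u * u) * (starRingEnd ℂ) z * z = z := by rw [hyc, one_mul]
      linear_combination this - (starRingEnd ℂ) (u * u) * hzz
    have e2 : (starRingEnd ℂ) z = u * u := by
      rw [← e1, Complex.conj_conj]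
    rw [hy, map_mul, e1, ← e2]
    linear_combination hzw
  have hy1 : y * y = -1 := by
    have : y * (starRingEnd ℂ) y = 1 := by
      rw [hy, map_mul, map_mul]
      linear_combination (u * (starRingEnd ℂ) u) * (w * (starRingEnd ℂ) w) * hu +
        (w * (starRingEnd ℂ) w) * hu + hww
    rw [hyy] at this
    linear_combination -this
  have hκ : ∃ κ : ℝ, (κ = 1 ∨ κ = -1) ∧ y = κ * Complex.I := by
    have : y * y = Complex.I * Complex.I := by rw [hy1, Complex.I_mul_I]
    rcases mul_self_eq_mul_self_iff.mp this with h | h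
    · exact ⟨1, Or.inl rfl, by simp [h]⟩
    · exact ⟨-1, Or.inr rfl, by simp [h]⟩
  obtain ⟨κ, hκ, hyκ⟩ := hκ
  have hI : (starRingEnd ℂ) (u * u) * (starRingEnd ℂ) w = -(κ * Complex.I) := by
    rw [← map_mul, ← hy, hyy, hyκ]
  set C : Matrix (Fin 2) (Fin 2) ℂ := !![u, 0; 0, (starRingEnd ℂ) u] with hC
  refine ⟨C * B₂ * B₁, ?_, κ, hκ, fun j => ?_⟩
  · rw [Matrix.det_mul, Matrix.det_mul, hB₁, hB₂]
    simp [hC, Matrix.det_fin_two, hu]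
  · rw [Matrix.mul_assoc C, conj_mul_conj, conj_mul_conj]
    change C * t j * Cᴴ = _
    have hu' : (starRingEnd ℂ) u * u = 1 := by rw [mul_comm, hu]
    rw [map_mul] at hI hyc
    fin_cases j
    · change C * t 0 * Cᴴ = _
      rw [t0]
      rw [hC, conj_fin_two]
      ext i j
      fin_cases i <;> fin_cases j <;>
        simp [tau, hu, hu']
    · change C * t 1 * Cᴴ = _
      rw [hC, conj_fin_two]
      ext i j
      fin_cases i <;> fin_cases j <;>
        simp [tau, a00, a11, a10, ← hz]
      · linear_combination huz
      · linear_combination hyc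
    · change C * t 2 * Cᴴ = _
      rw [hC, conj_fin_two]
      ext i j
      fin_cases i <;> fin_cases j <;>
        simp [tau, b00, b11, b10, ← hw]
      · rw [← hyκ, hy]
        ring
      · linear_combination hI
    · change C * t 3 * Cᴴ = _
      rw [t3]
      rw [hC, conj_fin_two]
      ext i j
      fin_cases i <;> fin_cases j <;>
        simp [tau, hu, hu']

/-! ### Existence of adapted spin frames at a point -/

section
variable {U : Set Pt} {g ref : Pt → Matrix (Fin 4) (Fin 4) ℝ}
  {σ : Pt → Fin 4 → Matrix (Fin 2) (Fin 2) ℂ} {x : Pt} {T : Matrix (Fin 4) (Fin 4) ℝ}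

/-- The components of Pauli matrices in a frame. -/
def frameComponents (s : Fin 4 → Matrix (Fin 2) (Fin 2) ℂ) (T : Matrix (Fin 4) (Fin 4) ℝ)
    (j : Fin 4) : Matrix (Fin 2) (Fin 2) ℂ :=
  ∑ α, (T⁻¹ α j : ℂ) • s α

theorem sum_frameComponents (s : Fin 4 → Matrix (Fin 2) (Fin 2) ℂ)
    (hT : T.det ≠ 0) (α : Fin 4) : ∑ j, (T j α : ℂ) • frameComponents s T j = s α := by
  simp only [frameComponents, Finset.smul_sum, smul_smul]
  rw [Finset.sum_comm]
  simp only [← Finset.sum_smul]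
  have h (β : Fin 4) : ∑ j, (T j α : ℂ) * (T⁻¹ β j : ℂ) = ((if β = α then 1 else 0 : ℝ) : ℂ) := by
    rw [← Matrix.one_apply, ← Matrix.nonsing_inv_mul T hT.isUnit, Matrix.mul_apply]
    push_cast
    exact Finset.sum_congr rfl fun j _ => mul_comm _ _
  simp only [h]
  simp

theorem frameComponents_frameMat (hT : T.det ≠ 0) (j : Fin 4) :
    frameComponents (frameMat T) T j = tau j := by
  simp only [frameComponents, frameMat, Finset.smul_sum, smul_smul]
  rw [Finset.sum_comm]
  simp only [← Finset.sum_smul]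
  have h (k : Fin 4) : ∑ α, (T⁻¹ α j : ℂ) * (T k α : ℂ) = ((if k = j then 1 else 0 : ℝ) : ℂ) := by
    rw [← Matrix.one_apply, ← Matrix.mul_nonsing_inv T hT.isUnit, Matrix.mul_apply]
    push_cast
    exact Finset.sum_congr rfl fun j _ => mul_comm _ _
  simp only [h]
  simp

theorem frameComponents_conj (s : Fin 4 → Matrix (Fin 2) (Fin 2) ℂ)
    (B C : Matrix (Fin 2) (Fin 2) ℂ) (j : Fin 4) :
    frameComponents (fun α => B * s α * C) T j = B * frameComponents s T j * C := by
  simp only [frameComponents, Finset.mul_sum, Finset.sum_mul, Matrix.mul_smul, Matrix.smul_mul]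

theorem Adapted.frameComponents_eq {s : Fin 4 → Matrix (Fin 2) (Fin 2) ℂ}
    {B : Matrix (Fin 2) (Fin 2) ℂ} (h : Adapted s T B) (hT : T.det ≠ 0) (j : Fin 4) :
    B * frameComponents s T j * Bᴴ = tau j := by
  rw [← frameComponents_conj, ← frameComponents_frameMat hT]
  simp only [h.eq]

theorem isTetrad_frameComponents (hg : IsLorentzianMetric U g) (hσ : IsPauli U g ref σ)
    (hx : x ∈ U) (hm : g x = Tᵀ * o * T) : IsTetrad (frameComponents (σ x) T) where
  hermitian j := by
    simp only [Matrix.IsHermitian, frameComponents, Matrix.conjTranspose_sum,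
      Matrix.conjTranspose_smul, (hσ.hermitian x hx _).eq]
    refine Finset.sum_congr rfl fun α _ => ?_
    rw [Complex.star_def, Complex.conj_ofReal]
  cliff i j := by
    have hT := (frame_det_ne_zero hg hx hm).isUnit
    simp only [frameComponents, cliff_sum_left, cliff_sum_right, hσ.cliff_eq hg hx, smul_smul,
      ← Finset.sum_smul]
    congr 1
    have e : (T⁻¹)ᵀ * g x * T⁻¹ = o := by
      rw [hm]
      calc (T⁻¹)ᵀ * (Tᵀ * o * T) * T⁻¹ = ((T⁻¹)ᵀ * Tᵀ) * o * (T * T⁻¹) := by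
            simp only [Matrix.mul_assoc]
        _ = o := by
            rw [← Matrix.transpose_mul, Matrix.mul_nonsing_inv _ hT, Matrix.transpose_one,
              Matrix.mul_one, Matrix.one_mul]
    have := congrFun (congrFun e i) j
    simp only [Matrix.mul_apply, Matrix.transpose_apply] at this
    rw [← this]
    push_cast
    simp only [Finset.mul_sum, Finset.sum_mul]
    exact Finset.sum_congr rfl fun a _ => Finset.sum_congr rfl fun b _ => by ring

theorem frame_mul_inv_mul (hg : IsLorentzianMetric U g) (hx : x ∈ U) (hm : g x = Tᵀ * o * T) :
    T * (g x)⁻¹ * Tᵀ = o := by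
  have hT := (frame_det_ne_zero hg hx hm).isUnit
  rw [Matrix.mul_assoc, metric_inv_mul_transpose hg hx hm, ← Matrix.mul_assoc,
    Matrix.mul_nonsing_inv _ hT, Matrix.one_mul]

/-- The scalar product of a timelike and a null covector, both directed to the future. -/
theorem timelike_null_pos {a c : Fin 4 → ℝ} (ha : 0 < a 0)
    (ha' : a 0 * a 0 - a 1 * a 1 - a 2 * a 2 - a 3 * a 3 = 1) (hc : 0 < c 0)
    (hc' : c 0 * c 0 - c 1 * c 1 - c 2 * c 2 - c 3 * c 3 = 0) :
    0 < c 0 * a 0 + c 1 * a 1 + c 2 * a 2 + c 3 * a 3 := by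
  -- The Cauchy–Schwarz inequality for the spatial parts, through the Lagrange identity; strictness
  -- comes from `|a|² = a_0² - 1 < a_0²`.
  have hcs : (c 1 * a 1 + c 2 * a 2 + c 3 * a 3) ^ 2 < (c 0 * a 0) ^ 2 := by
    nlinarith [sq_nonneg (c 1 * a 2 - c 2 * a 1), sq_nonneg (c 1 * a 3 - c 3 * a 1),
      sq_nonneg (c 2 * a 3 - c 3 * a 2), mul_pos hc hc]
  have := abs_lt_of_sq_lt_sq hcs (mul_pos hc ha).le
  linarith [(abs_lt.mp this).1]

theorem forwardCone_null {v : Fin 4 → ℂ} (hv : v ∈ forwardCone ref x) :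
    ∃ c : Fin 4 → ℝ, c 0 * c 0 - c 1 * c 1 - c 2 * c 2 - c 3 * c 3 = 0 ∧ 0 < c 0 ∧
      ∀ α, v α = ((∑ j, c j * ref x j α : ℝ) : ℂ) := by
  obtain ⟨c, h1, h2, h3⟩ := hv
  refine ⟨c, ?_, h2, h3⟩
  simp [o, Matrix.diagonal, Fin.sum_univ_four] at h1
  linear_combination h1

/-- The covector `σ_{α00}` is the current of the spinor `(1, 0)`, hence a future null covector. The
entry in question is its scalar product with the future unit timelike covector `ϑ⁰`. -/
theorem frameComponents_zero_pos (hg : IsLorentzianMetric U g) (href : IsCoframe U g ref)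
    (hσ : IsPauli U g ref σ) (hx : x ∈ U) (hm : g x = Tᵀ * o * T)
    (htime : 0 < ∑ α, ∑ β, (g x)⁻¹ α β * ref x 0 α * T 0 β) :
    0 < (frameComponents (σ x) T 0 0 0).re := by
  have hcur : current σ x (Pi.single 0 1) ∈ forwardCone ref x := by
    rw [← hσ.cone x hx]
    exact ⟨_, by simp, rfl⟩
  obtain ⟨c, hc, hc0, hv⟩ := forwardCone_null hcur
  have hv' (α : Fin 4) : σ x α 0 0 = ((∑ j, c j * ref x j α : ℝ) : ℂ) := by
    rw [← hv]
    simp [current, Fin.sum_univ_two]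
  have hsym : ((g x)⁻¹)ᵀ = (g x)⁻¹ := by
    rw [Matrix.transpose_nonsing_inv, hg.transpose_eq hx]
  -- The matrix of scalar products of the two coframes. It is Lorentz, so its column 0 is a unit
  -- timelike vector, and the time condition on `T` makes it future directed.
  set N := ref x * (g x)⁻¹ * Tᵀ with hN
  have hNo : Nᵀ * o * N = o := by
    rw [hN, Matrix.transpose_mul, Matrix.transpose_mul, Matrix.transpose_transpose, hsym]
    calc T * ((g x)⁻¹ * (ref x)ᵀ) * o * (ref x * (g x)⁻¹ * Tᵀ)
        = T * ((g x)⁻¹ * ((ref x)ᵀ * o * ref x)) * (g x)⁻¹ * Tᵀ := by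
          simp only [Matrix.mul_assoc]
      _ = o := by
          rw [← href.2 x hx, Matrix.nonsing_inv_mul _ (hg.det_ne_zero hx).isUnit,
            Matrix.mul_one, frame_mul_inv_mul hg hx hm]
  have hN00 : N 0 0 * N 0 0 - N 1 0 * N 1 0 - N 2 0 * N 2 0 - N 3 0 * N 3 0 = 1 := by
    have := congrFun (congrFun hNo 0) 0
    simp [Matrix.mul_apply, o, Matrix.diagonal, Fin.sum_univ_four] at this
    simp only [Matrix.mul_apply, Fin.sum_univ_four, N] at this ⊢
    linear_combination this
  have hN0 : 0 < N 0 0 := by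
    convert htime using 1
    simp only [hN, Matrix.mul_apply, Matrix.transpose_apply, Finset.sum_mul]
    rw [Finset.sum_comm]
    exact Finset.sum_congr rfl fun a _ => Finset.sum_congr rfl fun b _ => by ring
  have hpos := timelike_null_pos (a := fun j => N j 0) hN0 hN00 hc0 hc
  have he (α : Fin 4) : T⁻¹ α 0 = ∑ β, (g x)⁻¹ α β * T 0 β := by
    have := congrFun (congrFun (metric_inv_mul_transpose hg hx hm) α) 0
    rw [o, Matrix.mul_diagonal] at this
    simp only [Matrix.mul_apply, Matrix.transpose_apply] at this
    rw [this]
    simp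
  have hs : frameComponents (σ x) T 0 0 0 = ((∑ j, c j * N j 0 : ℝ) : ℂ) := by
    simp only [frameComponents, Matrix.sum_apply, Matrix.smul_apply, smul_eq_mul, hv', he, hN,
      Matrix.mul_apply, Matrix.transpose_apply]
    push_cast
    simp only [Fin.sum_univ_four]
    ring
  rw [hs, Complex.ofReal_re, Fin.sum_univ_four]
  exact hpos

/-- Every admissible frame has an adapted spin frame. -/
theorem exists_adapted (hg : IsLorentzianMetric U g) (href : IsCoframe U g ref)
    (hσ : IsPauli U g ref σ) (hx : x ∈ U) (hm : g x = Tᵀ * o * T) (hdet : 0 < T.det)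
    (htime : 0 < ∑ α, ∑ β, (g x)⁻¹ α β * ref x 0 α * T 0 β) :
    ∃ B, Adapted (σ x) T B := by
  obtain ⟨B, hB, κ, hκ, h⟩ := (isTetrad_frameComponents hg hσ hx hm).exists_normal_form
    (frameComponents_zero_pos hg href hσ hx hm htime)
  -- The sign `κ` is absorbed by reflecting `ϑ²`. The frame `D * T` then has an adapted spin frame
  -- and positive determinant, which excludes `κ = -1`.
  let D : Matrix (Fin 4) (Fin 4) ℝ := Matrix.diagonal fun j => if j = 2 then κ else 1
  have hA : Adapted (σ x) (D * T) B := by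
    refine ⟨hB, fun α => ?_⟩
    rw [← sum_frameComponents (σ x) hdet.ne' α]
    simp only [Finset.mul_sum, Finset.sum_mul, Matrix.mul_smul, Matrix.smul_mul, h, frameMat, D,
      Matrix.diagonal_mul, smul_smul]
    refine Finset.sum_congr rfl fun j _ => ?_
    congr 1
    split_ifs <;> simp [mul_comm]
  have hpos := hA.det_pos hg hσ hx
  have hD : D.det = κ := by simp [D]
  rw [Matrix.det_mul, hD] at hpos
  have hκ1 : κ = 1 := by
    refine hκ.resolve_right fun e => ?_
    rw [e] at hpos
    linarith
  have hD1 : D = 1 := by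
    simp [D, hκ1]
  rw [hD1, Matrix.one_mul] at hA
  exact ⟨B, hA⟩

end

/-! ### Smooth matrix fields -/

theorem contDiffOn_ofReal {U : Set Pt} {f : Pt → ℝ} (hf : ContDiffOn ℝ ∞ f U) :
    ContDiffOn ℝ ∞ (fun x => (f x : ℂ)) U :=
  Complex.ofRealCLM.contDiff.comp_contDiffOn hf

theorem contDiffOn_conj {U : Set Pt} {f : Pt → ℂ} (hf : ContDiffOn ℝ ∞ f U) :
    ContDiffOn ℝ ∞ (fun x => (starRingEnd ℂ) (f x)) U :=
  Complex.conjCLE.contDiff.comp_contDiffOn hf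

theorem contDiffOn_re {U : Set Pt} {f : Pt → ℂ} (hf : ContDiffOn ℝ ∞ f U) :
    ContDiffOn ℝ ∞ (fun x => (f x).re) U :=
  Complex.reCLM.contDiff.comp_contDiffOn hf

theorem contDiffOn_im {U : Set Pt} {f : Pt → ℂ} (hf : ContDiffOn ℝ ∞ f U) :
    ContDiffOn ℝ ∞ (fun x => (f x).im) U :=
  Complex.imCLM.contDiff.comp_contDiffOn hf

theorem SmoothMat.det {U : Set Pt} {A : Pt → Matrix (Fin 4) (Fin 4) ℝ} (hA : SmoothMat U A) :
    ContDiffOn ℝ ∞ (fun x => (A x).det) U := by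
  simp only [Matrix.det_apply']
  exact ContDiffOn.sum fun p _ => contDiffOn_const.mul (contDiffOn_prod fun i _ => hA _ _)

theorem SmoothMat.inv {U : Set Pt} {A : Pt → Matrix (Fin 4) (Fin 4) ℝ} (hA : SmoothMat U A)
    (hdet : ∀ x ∈ U, (A x).det ≠ 0) : SmoothMat U fun x => (A x)⁻¹ := by
  intro i j
  simp only [Matrix.inv_def, Ring.inverse_eq_inv', Matrix.smul_apply, smul_eq_mul,
    Matrix.adjugate_apply]
  refine (hA.det.inv hdet).mul (SmoothMat.det fun k l => ?_)
  simp only [Matrix.updateRow_apply]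
  split_ifs
  · exact contDiffOn_const
  · exact hA k l

/-- A smooth field of complex `2 × 2` matrices on `U`. -/
def SmoothSpin (U : Set Pt) (B : Pt → Matrix (Fin 2) (Fin 2) ℂ) : Prop :=
  ∀ a b, ContDiffOn ℝ ∞ (fun x => B x a b) U

namespace SmoothSpin

variable {U : Set Pt} {A B : Pt → Matrix (Fin 2) (Fin 2) ℂ}

theorem mul (hA : SmoothSpin U A) (hB : SmoothSpin U B) : SmoothSpin U fun x => A x * B x := by
  intro a b
  simp only [Matrix.mul_apply]
  exact ContDiffOn.sum fun k _ => (hA a k).mul (hB k b)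

theorem add (hA : SmoothSpin U A) (hB : SmoothSpin U B) : SmoothSpin U fun x => A x + B x :=
  fun a b => (hA a b).add (hB a b)

theorem smul {f : Pt → ℂ} (hf : ContDiffOn ℝ ∞ f U) (hB : SmoothSpin U B) :
    SmoothSpin U fun x => f x • B x :=
  fun a b => hf.mul (hB a b)

theorem const (A : Matrix (Fin 2) (Fin 2) ℂ) : SmoothSpin U fun _ => A :=
  fun _ _ => contDiffOn_const

theorem sum {ι : Type*} (S : Finset ι) {A : ι → Pt → Matrix (Fin 2) (Fin 2) ℂ}
    (hA : ∀ i, SmoothSpin U (A i)) : SmoothSpin U fun x => ∑ i ∈ S, A i x := by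
  intro a b
  simp only [Matrix.sum_apply]
  exact ContDiffOn.sum fun i _ => hA i a b

theorem conjTranspose (hA : SmoothSpin U A) : SmoothSpin U fun x => (A x)ᴴ :=
  fun a b => contDiffOn_conj (hA b a)

theorem adjugate (hA : SmoothSpin U A) : SmoothSpin U fun x => (A x).adjugate := by
  intro a b
  simp only [Matrix.adjugate_fin_two]
  fin_cases a <;> fin_cases b
  · exact hA 1 1
  · exact (hA 0 1).neg
  · exact (hA 1 0).neg
  · exact hA 0 0

end SmoothSpin

theorem smoothSpin_frameComponents {U : Set Pt} {σ : Pt → Fin 4 → Matrix (Fin 2) (Fin 2) ℂ}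
    (hσ : ∀ α a b, ContDiffOn ℝ ∞ (fun x => σ x α a b) U)
    {θ : Pt → Matrix (Fin 4) (Fin 4) ℝ} (hθ : SmoothMat U θ) (hdet : ∀ x ∈ U, (θ x).det ≠ 0)
    (j : Fin 4) : SmoothSpin U fun x => frameComponents (σ x) (θ x) j :=
  SmoothSpin.sum _ fun α => SmoothSpin.smul (contDiffOn_ofReal (hθ.inv hdet α j)) (hσ α)

/-! ### Smooth adapted spin frames of coframes -/

section
variable {s : Fin 4 → Matrix (Fin 2) (Fin 2) ℂ} {T : Matrix (Fin 4) (Fin 4) ℝ}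
  {B : Matrix (Fin 2) (Fin 2) ℂ}

theorem Adapted.neg (h : Adapted s T B) : Adapted s T (-B) where
  det := by
    rw [Matrix.det_neg, h.det]
    simp
  eq α := by
    rw [← h.eq]
    simp

/-- Each component is `B⁻¹ τ_j (Bᴴ)⁻¹`; multiplication by the adjugate of the zeroth one removes
`Bᴴ`, and only a similarity by `B` remains. This lets `B` be recovered algebraically from smooth
data. -/
theorem Adapted.mul_adjugate_components (h : Adapted s T B) (hT : T.det ≠ 0) (c : ℂ) :
    (frameComponents s T 1 + c • frameComponents s T 2) * (frameComponents s T 0).adjugate =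
      B.adjugate * (tau 1 + c • tau 2) * B := by
  have hBH : Bᴴ * Bᴴ.adjugate = 1 := by
    rw [Matrix.mul_adjugate, det_conjTranspose_eq_one h.det, one_smul]
  have hs (j : Fin 4) : frameComponents s T j = B.adjugate * tau j * Bᴴ.adjugate := by
    rw [← h.frameComponents_eq hT j]
    calc frameComponents s T j
        = (B.adjugate * B) * frameComponents s T j * (Bᴴ * Bᴴ.adjugate) := by
          rw [h.adjugate_mul, hBH, Matrix.one_mul, Matrix.mul_one]
      _ = _ := by simp only [Matrix.mul_assoc]
  have hadj (M : Matrix (Fin 2) (Fin 2) ℂ) : M.adjugate.adjugate = M := by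
    ext i j
    fin_cases i <;> fin_cases j <;> simp [Matrix.adjugate_fin_two]
  rw [hs, hs, hs, Matrix.adjugate_mul_distrib, Matrix.adjugate_mul_distrib, hadj, hadj]
  have h0 : (tau 0).adjugate = 1 := by simp [tau]
  have hBH' : Bᴴ.adjugate * Bᴴ = 1 := by
    rw [Matrix.adjugate_mul, det_conjTranspose_eq_one h.det, one_smul]
  rw [h0, Matrix.one_mul]
  calc (B.adjugate * tau 1 * Bᴴ.adjugate + c • (B.adjugate * tau 2 * Bᴴ.adjugate)) * (Bᴴ * B)
      = B.adjugate * (tau 1 + c • tau 2) * (Bᴴ.adjugate * Bᴴ) * B := by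
        simp only [Matrix.mul_add, Matrix.add_mul, Matrix.mul_smul, Matrix.smul_mul,
          Matrix.mul_assoc]
    _ = _ := by rw [hBH', Matrix.mul_one]

/-- The combination `τ_1 + iτ_2` is twice a matrix unit, so its conjugate by `B` has rank one and,
after multiplication by `eps`, is the symmetric square of the first row. The frame thus fixes that
row up to sign, with smooth symmetric square. -/
theorem Adapted.row_zero_mul (h : Adapted s T B) (hT : T.det ≠ 0) (a b : Fin 2) :
    B 0 a * B 0 b = ((1 / 2 : ℂ) • (eps * ((frameComponents s T 1 +
      Complex.I • frameComponents s T 2) * (frameComponents s T 0).adjugate))) a b := by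
  rw [h.mul_adjugate_components hT]
  have : tau 1 + Complex.I • tau 2 = !![0, 0; 2, 0] := by
    ext i j
    fin_cases i <;> fin_cases j <;> simp [tau]
    norm_num
  rw [this]
  fin_cases a <;> fin_cases b <;>
    simp [Matrix.vecMul, dotProduct, Fin.sum_univ_two, Matrix.adjugate_fin_two, eps] <;> ring

/-- The combination `τ_1 - iτ_2` is twice the matrix unit sending the first basis row to the second.
Once the first row is smooth, the second therefore follows linearly, with no further choice of sign.
-/
theorem Adapted.row_one (h : Adapted s T B) (hT : T.det ≠ 0) :
    B 1 = B 0 ᵥ* ((1 / 2 : ℂ) • ((frameComponents s T 1 +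
      (-Complex.I) • frameComponents s T 2) * (frameComponents s T 0).adjugate)) := by
  rw [h.mul_adjugate_components hT]
  have h1 : tau 1 + (-Complex.I) • tau 2 = !![0, 2; 0, 0] := by
    ext i j
    fin_cases i <;> fin_cases j <;> simp [tau]
    norm_num
  have h0 : B 0 = Pi.single 0 1 ᵥ* B := by
    rw [Matrix.single_one_vecMul]
    rfl
  have e : (1 / 2 : ℂ) • (B.adjugate * !![0, 2; 0, 0] * B) = B.adjugate * !![0, 1; 0, 0] * B := by
    rw [← Matrix.smul_mul, ← Matrix.mul_smul]
    congr 2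
    ext i j
    fin_cases i <;> fin_cases j <;> simp
  rw [h1, e, h0, Matrix.vecMul_vecMul, Matrix.mul_assoc, ← Matrix.mul_assoc B, h.mul_adjugate,
    Matrix.one_mul, ← Matrix.vecMul_vecMul]
  have : (Pi.single 0 1 : Fin 2 → ℂ) ᵥ* !![0, 1; 0, 0] = Pi.single 1 1 := by
    ext i
    fin_cases i <;> simp
  rw [this, Matrix.single_one_vecMul]
  rfl

end

section
variable {U : Set Pt} {g ref : Pt → Matrix (Fin 4) (Fin 4) ℝ}
  {σ : Pt → Fin 4 → Matrix (Fin 2) (Fin 2) ℂ}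

/-- Over a simply connected domain every admissible coframe has a smooth adapted spin frame. -/
theorem exists_smooth_adapted (hU : IsOpen U) (hUsc : IsSimplyConnected U)
    (hg : IsLorentzianMetric U g) (href : IsCoframe U g ref) (hσ : IsPauli U g ref σ)
    {θ : Pt → Matrix (Fin 4) (Fin 4) ℝ} (hθ : IsAdmissible U g ref θ) :
    ∃ B, SmoothSpin U B ∧ ∀ x ∈ U, Adapted (σ x) (θ x) (B x) := by
  have hdet (x : Pt) (hx : x ∈ U) : (θ x).det ≠ 0 := (hθ.2.1 x hx).ne'
  have key (x : Pt) : ∃ B, x ∈ U → Adapted (σ x) (θ x) B := by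
    by_cases hx : x ∈ U
    · obtain ⟨B, hB⟩ := exists_adapted hg href hσ hx (hθ.1.2 x hx) (hθ.2.1 x hx) (hθ.2.2 x hx)
      exact ⟨B, fun _ => hB⟩
    · exact ⟨1, fun h => absurd h hx⟩
  choose B₀ hB₀ using key
  have hs := smoothSpin_frameComponents hσ.smooth hθ.1.1 hdet
  have hform (c : ℂ) : SmoothSpin U fun x => (frameComponents (σ x) (θ x) 1 +
      c • frameComponents (σ x) (θ x) 2) * (frameComponents (σ x) (θ x) 0).adjugate :=
    ((hs 1).add (SmoothSpin.smul contDiffOn_const (hs 2))).mul (hs 0).adjugate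
  obtain ⟨ξ, hξ, hξ'⟩ := exists_contDiffOn_lift hU hUsc (fun x => B₀ x 0)
    (fun x hx h => by
      have h1 := (hB₀ x hx).det
      rw [Matrix.det_fin_two, congrFun h 0, congrFun h 1] at h1
      simp at h1)
    (fun a b => by
      refine ContDiffOn.congr ?_ fun x hx => (hB₀ x hx).row_zero_mul (hdet x hx) a b
      exact SmoothSpin.smul contDiffOn_const ((SmoothSpin.const eps).mul (hform Complex.I)) a b)
  let Ψ : Pt → Matrix (Fin 2) (Fin 2) ℂ := fun x =>
    (1 / 2 : ℂ) • ((frameComponents (σ x) (θ x) 1 +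
      (-Complex.I) • frameComponents (σ x) (θ x) 2) * (frameComponents (σ x) (θ x) 0).adjugate)
  have hΨ : SmoothSpin U Ψ := SmoothSpin.smul contDiffOn_const (hform (-Complex.I))
  -- The second row is rebuilt from the lifted first row, so a change of sign affects both rows and
  -- the result is `±B₀`.
  refine ⟨fun x => Matrix.of ![ξ x, ξ x ᵥ* Ψ x], fun a b => ?_, fun x hx => ?_⟩
  · fin_cases a
    · exact hξ b
    · change ContDiffOn ℝ ∞ (fun x => ∑ k, ξ x k * Ψ x k b) U
      exact ContDiffOn.sum fun k _ => (hξ k).mul (hΨ k b)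
  · have hB := hB₀ x hx
    rcases hξ' x hx with e | e
    · convert hB
      ext i j
      fin_cases i
      · simp [e]
      · simp [e, hB.row_one (hdet x hx), Ψ]
    · convert hB.neg
      ext i j
      fin_cases i
      · simp [e]
      · simp [e, hB.row_one (hdet x hx), Ψ, Matrix.neg_vecMul]

/-! ### Coframes of spinor fields -/

/-- The scalar product of `ref⁰` with a covector of the forward cone. -/
theorem forwardCone_time (hg : IsLorentzianMetric U g) (href : IsCoframe U g ref) {x : Pt}
    (hx : x ∈ U) {v : Fin 4 → ℂ} (hv : v ∈ forwardCone ref x) :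
    0 < ∑ α, ∑ β, (g x)⁻¹ α β * ref x 0 α * (v β).re := by
  obtain ⟨c, -, hc0, h⟩ := forwardCone_null hv
  have e := frame_mul_inv_mul hg hx (href.2 x hx)
  have : ∑ α, ∑ β, (g x)⁻¹ α β * ref x 0 α * (v β).re =
      ∑ j, c j * (ref x * (g x)⁻¹ * (ref x)ᵀ) 0 j := by
    simp only [h, Complex.ofReal_re, Matrix.mul_apply, Matrix.transpose_apply, Fin.sum_univ_four]
    ring
  rw [this, e]
  simpa [o, Fin.sum_univ_four] using hc0

/-- The matrices `tau` are a real basis of the Hermitian 2 × 2 matrices, and the displayed rows are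
the coordinates of `B s_α Bᴴ` in it. -/
theorem adapted_of_hermitian {s : Fin 4 → Matrix (Fin 2) (Fin 2) ℂ}
    {B : Matrix (Fin 2) (Fin 2) ℂ} (hs : ∀ α, (s α).IsHermitian) (hB : B.det = 1) :
    Adapted s (Matrix.of ![fun α => (((B * s α * Bᴴ) 0 0).re + ((B * s α * Bᴴ) 1 1).re) / 2,
      fun α => ((B * s α * Bᴴ) 0 1).re, fun α => ((B * s α * Bᴴ) 0 1).im,
      fun α => (((B * s α * Bᴴ) 0 0).re - ((B * s α * Bᴴ) 1 1).re) / 2]) B := by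
  refine ⟨hB, fun α => ?_⟩
  have hF := Matrix.isHermitian_mul_mul_conjTranspose B (hs α)
  set F := B * s α * Bᴴ with hFdef
  have h00 : ((F 0 0).re : ℂ) = F 0 0 := Complex.conj_eq_iff_re.mp (hF.apply 0 0)
  have h11 : ((F 1 1).re : ℂ) = F 1 1 := Complex.conj_eq_iff_re.mp (hF.apply 1 1)
  have h10 : F 1 0 = (starRingEnd ℂ) (F 0 1) := (hF.apply 1 0).symm
  rw [frameMat_eq]
  ext i j
  fin_cases i <;> fin_cases j
  · simp [← hFdef, h00, h11]
    ring
  · simp [← hFdef, mul_comm Complex.I, Complex.re_add_im]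
  · simp only [Fin.mk_one, Fin.zero_eta, h10]
    apply Complex.ext <;> simp [← hFdef]
  · simp [← hFdef, h00, h11]
    ring

/-- Every nonvanishing spinor field is the first row of a smooth adapted spin frame of some
admissible coframe. -/
theorem exists_coframe_of_spinor (hg : IsLorentzianMetric U g) (href : IsCoframe U g ref)
    (hσ : IsPauli U g ref σ) {ξ : Pt → Fin 2 → ℂ}
    (hξ : ∀ a, ContDiffOn ℝ ∞ (fun x => ξ x a) U) (hξ0 : ∀ x ∈ U, ξ x ≠ 0) :
    ∃ θ B, IsAdmissible U g ref θ ∧ SmoothSpin U B ∧ (∀ x ∈ U, Adapted (σ x) (θ x) (B x)) ∧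
      ∀ x, B x 0 = ξ x := by
  let N : Pt → ℂ := fun x =>
    ξ x 0 * (starRingEnd ℂ) (ξ x 0) + ξ x 1 * (starRingEnd ℂ) (ξ x 1)
  have hN : ContDiffOn ℝ ∞ N U :=
    ((hξ 0).mul (contDiffOn_conj (hξ 0))).add ((hξ 1).mul (contDiffOn_conj (hξ 1)))
  have hN0 (x : Pt) (hx : x ∈ U) : N x ≠ 0 := by
    intro h
    simp only [N, Complex.mul_conj] at h
    have h' : Complex.normSq (ξ x 0) + Complex.normSq (ξ x 1) = 0 := by exact_mod_cast h
    have h0 := Complex.normSq_nonneg (ξ x 0)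
    have h1 := Complex.normSq_nonneg (ξ x 1)
    refine hξ0 x hx (funext fun i => ?_)
    fin_cases i
    · exact Complex.normSq_eq_zero.mp (show Complex.normSq (ξ x 0) = 0 by linarith)
    · exact Complex.normSq_eq_zero.mp (show Complex.normSq (ξ x 1) = 0 by linarith)
  -- The second row is orthogonal to `ξ` and divided by `N = |ξ|²`, which gives determinant 1 and is
  -- smooth wherever `ξ ≠ 0`.
  let B : Pt → Matrix (Fin 2) (Fin 2) ℂ := fun x =>
    Matrix.of ![ξ x, ![-(starRingEnd ℂ) (ξ x 1) * (N x)⁻¹, (starRingEnd ℂ) (ξ x 0) * (N x)⁻¹]]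
  have hB : SmoothSpin U B := by
    intro a b
    fin_cases a
    · exact hξ b
    · fin_cases b
      · exact (contDiffOn_conj (hξ 1)).neg.mul (hN.inv hN0)
      · exact (contDiffOn_conj (hξ 0)).mul (hN.inv hN0)
  have hBdet (x : Pt) (hx : x ∈ U) : (B x).det = 1 := by
    have := hN0 x hx
    simp [Matrix.det_fin_two, B]
    field_simp
    simp [N]
  let F : Pt → Fin 4 → Matrix (Fin 2) (Fin 2) ℂ := fun x α => B x * σ x α * (B x)ᴴ
  have hF (α : Fin 4) : SmoothSpin U fun x => F x α := (hB.mul (hσ.smooth α)).mul hB.conjTranspose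
  let θ : Pt → Matrix (Fin 4) (Fin 4) ℝ := fun x =>
    Matrix.of ![fun α => ((F x α 0 0).re + (F x α 1 1).re) / 2,
      fun α => (F x α 0 1).re, fun α => (F x α 0 1).im,
      fun α => ((F x α 0 0).re - (F x α 1 1).re) / 2]
  have hθ : SmoothMat U θ := by
    intro j α
    fin_cases j
    · exact ((contDiffOn_re (hF α 0 0)).add (contDiffOn_re (hF α 1 1))).div_const 2
    · exact contDiffOn_re (hF α 0 1)
    · exact contDiffOn_im (hF α 0 1)
    · exact ((contDiffOn_re (hF α 0 0)).sub (contDiffOn_re (hF α 1 1))).div_const 2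
  have hA (x : Pt) (hx : x ∈ U) : Adapted (σ x) (θ x) (B x) :=
    adapted_of_hermitian (hσ.hermitian x hx) (hBdet x hx)
  refine ⟨θ, B, ⟨⟨hθ, fun x hx => (hA x hx).metric_eq hg hσ hx⟩,
    fun x hx => (hA x hx).det_pos hg hσ hx, fun x hx => ?_⟩, hB, hA, fun x => rfl⟩
  -- The diagonal entries of `B σ Bᴴ` are the currents of the rows of `B`, so both lie in the
  -- forward cone, and `ϑ⁰` is half their sum.
  have hrow (i : Fin 2) : 0 < ∑ α, ∑ β, (g x)⁻¹ α β * ref x 0 α * (F x β i i).re := by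
    refine forwardCone_time (v := fun β => F x β i i) hg href hx ?_
    rw [← hσ.cone x hx]
    refine ⟨B x i, fun h => ?_, funext fun β => ?_⟩
    · have h1 := hBdet x hx
      rw [Matrix.det_fin_two] at h1
      fin_cases i
      · have e0 : B x 0 0 = 0 := congrFun h 0
        have e1 : B x 0 1 = 0 := congrFun h 1
        simp [e0, e1] at h1
      · have e0 : B x 1 0 = 0 := congrFun h 0
        have e1 : B x 1 1 = 0 := congrFun h 1
        simp [e0, e1] at h1
    · simp only [F, current, Matrix.mul_apply, Fin.sum_univ_two, Matrix.conjTranspose_apply,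
        Complex.star_def]
      ring
  have : ∑ α, ∑ β, (g x)⁻¹ α β * ref x 0 α * θ x 0 β =
      (∑ α, ∑ β, (g x)⁻¹ α β * ref x 0 α * (F x β 0 0).re +
        ∑ α, ∑ β, (g x)⁻¹ α β * ref x 0 α * (F x β 1 1).re) / 2 := by
    simp only [← Finset.sum_add_distrib, Finset.sum_div]
    refine Finset.sum_congr rfl fun α _ => Finset.sum_congr rfl fun β _ => ?_
    simp only [θ, Matrix.of_apply, Matrix.cons_val_zero]
    ring
  rw [this]
  linarith [hrow 0, hrow 1]

end

/-! ### Derivatives of matrix fields -/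

section
variable {x : Pt} {α : Fin 4}

theorem pd_congr {F : Type*} [NormedAddCommGroup F] [NormedSpace ℝ F] {f h : Pt → F}
    (e : f =ᶠ[𝓝 x] h) : pd α f x = pd α h x := by
  rw [pd, pd, e.fderiv_eq]

theorem pd_const {F : Type*} [NormedAddCommGroup F] [NormedSpace ℝ F] (c : F) :
    pd α (fun _ => c) x = 0 := by
  simp [pd]

theorem pd_mul {f h : Pt → ℂ} (hf : DifferentiableAt ℝ f x) (hh : DifferentiableAt ℝ h x) :
    pd α (fun y => f y * h y) x = pd α f x * h x + f x * pd α h x := by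
  unfold pd
  rw [fderiv_fun_mul hf hh]
  simp
  ring

theorem pd_sum {ι : Type*} (S : Finset ι) {f : ι → Pt → ℂ}
    (hf : ∀ i, DifferentiableAt ℝ (f i) x) :
    pd α (fun y => ∑ i ∈ S, f i y) x = ∑ i ∈ S, pd α (f i) x := by
  unfold pd
  rw [fderiv_fun_sum fun i _ => hf i]
  simp

theorem pd_conj {f : Pt → ℂ} (hf : DifferentiableAt ℝ f x) :
    pd α (fun y => (starRingEnd ℂ) (f y)) x = (starRingEnd ℂ) (pd α f x) := by
  unfold pd
  have : HasFDerivAt (fun y => (starRingEnd ℂ) (f y))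
      ((Complex.conjCLE : ℂ →L[ℝ] ℂ).comp (fderiv ℝ f x)) x :=
    (Complex.conjCLE : ℂ →L[ℝ] ℂ).hasFDerivAt.comp x hf.hasFDerivAt
  rw [this.fderiv]
  simp

theorem pd_ofReal {f : Pt → ℝ} (hf : DifferentiableAt ℝ f x) :
    pd α (fun y => (f y : ℂ)) x = ((pd α f x : ℝ) : ℂ) := by
  unfold pd
  have : HasFDerivAt (fun y => (f y : ℂ)) (Complex.ofRealCLM.comp (fderiv ℝ f x)) x :=
    Complex.ofRealCLM.hasFDerivAt.comp x hf.hasFDerivAt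
  rw [this.fderiv]
  simp

/-- Entrywise partial derivative of a matrix field. -/
def pdMat {m n : Type*} (α : Fin 4) (A : Pt → Matrix m n ℂ) (x : Pt) : Matrix m n ℂ :=
  fun i j => pd α (fun y => A y i j) x

/-- Entrywise differentiability at a point. -/
def DiffMat {m n : Type*} (A : Pt → Matrix m n ℂ) (x : Pt) : Prop :=
  ∀ i j, DifferentiableAt ℝ (fun y => A y i j) x

theorem pdMat_congr {m n : Type*} {A A' : Pt → Matrix m n ℂ} (h : ∀ᶠ y in 𝓝 x, A y = A' y) :
    pdMat α A x = pdMat α A' x := by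
  ext i j
  exact pd_congr (h.mono fun y hy => congrFun (congrFun hy i) j)

theorem DiffMat.mul {m n p : Type*} [Fintype n] {A : Pt → Matrix m n ℂ} {B : Pt → Matrix n p ℂ}
    (hA : DiffMat A x) (hB : DiffMat B x) : DiffMat (fun y => A y * B y) x := by
  intro i j
  simp only [Matrix.mul_apply]
  exact DifferentiableAt.fun_sum fun k _ => (hA i k).mul (hB k j)

theorem pdMat_mul {m n p : Type*} [Fintype n] {A : Pt → Matrix m n ℂ} {B : Pt → Matrix n p ℂ}
    (hA : DiffMat A x) (hB : DiffMat B x) :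
    pdMat α (fun y => A y * B y) x = pdMat α A x * B x + A x * pdMat α B x := by
  ext i j
  simp only [pdMat, Matrix.mul_apply, Matrix.add_apply]
  rw [pd_sum _ fun k => (hA i k).fun_mul (hB k j), ← Finset.sum_add_distrib]
  exact Finset.sum_congr rfl fun k _ => pd_mul (hA i k) (hB k j)

theorem DiffMat.conjTranspose {m n : Type*} {A : Pt → Matrix m n ℂ} (hA : DiffMat A x) :
    DiffMat (fun y => (A y)ᴴ) x := fun i j =>
  (Complex.conjCLE : ℂ →L[ℝ] ℂ).differentiableAt.comp x (hA j i)

theorem pdMat_conjTranspose {m n : Type*} {A : Pt → Matrix m n ℂ} (hA : DiffMat A x) :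
    pdMat α (fun y => (A y)ᴴ) x = (pdMat α A x)ᴴ := by
  ext i j
  exact pd_conj (hA j i)

theorem SmoothSpin.diffMat {U : Set Pt} (hU : IsOpen U) (hx : x ∈ U)
    {A : Pt → Matrix (Fin 2) (Fin 2) ℂ} (hA : SmoothSpin U A) : DiffMat A x := fun i j =>
  ((hA i j).contDiffAt (hU.mem_nhds hx)).differentiableAt (by simp)

/-- The logarithmic derivative of a unimodular matrix field is traceless. -/
theorem trace_pdMat_mul_adjugate {B : Pt → Matrix (Fin 2) (Fin 2) ℂ} (hB : DiffMat B x)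
    (hdet : ∀ᶠ y in 𝓝 x, (B y).det = 1) : (pdMat α B x * (B x).adjugate).trace = 0 := by
  have h : pd α (fun y => B y 0 0 * B y 1 1 + -B y 0 1 * B y 1 0) x = 0 := by
    rw [← pd_const (α := α) (x := x) (1 : ℂ)]
    refine pd_congr (hdet.mono fun y hy => ?_)
    rw [Matrix.det_fin_two] at hy
    simp only [← hy]
    ring
  have hs : pd α (fun y => B y 0 0 * B y 1 1 + -B y 0 1 * B y 1 0) x =
      pd α (fun y => B y 0 0) x * B x 1 1 + B x 0 0 * pd α (fun y => B y 1 1) x -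
      (pd α (fun y => B y 0 1) x * B x 1 0 + B x 0 1 * pd α (fun y => B y 1 0) x) := by
    rw [← pd_mul (hB 0 0) (hB 1 1), ← pd_mul (hB 0 1) (hB 1 0)]
    unfold pd
    simp only [neg_mul, ← sub_eq_add_neg]
    rw [fderiv_fun_sub ((hB 0 0).fun_mul (hB 1 1)) ((hB 0 1).fun_mul (hB 1 0))]
    rfl
  rw [hs] at h
  simp [Matrix.trace_fin_two, Matrix.mul_apply, Fin.sum_univ_two, Matrix.adjugate_fin_two, pdMat]
  linear_combination h

end

/-! ### The spinor connection in an adapted spin frame -/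

/-- The completeness (Fierz) relation: `o_{jj}` times the adjugate of `τ_j` is `τ_j` itself, and `Σ
τ_j M τ_j = 2 tr M`. -/
theorem sum_tau_mul_adjugate (M : Matrix (Fin 2) (Fin 2) ℂ) :
    ∑ j, (o j j : ℂ) • (tau j * M * (tau j).adjugate) = (2 * M.trace) • 1 := by
  have h0 : tau 0 = !![1, 0; 0, 1] := by
    rw [← Matrix.one_fin_two]
    rfl
  have h1 : tau 1 = !![0, 1; 1, 0] := rfl
  have h2 : tau 2 = !![0, Complex.I; -Complex.I, 0] := rfl
  have h3 : tau 3 = !![1, 0; 0, -1] := rfl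
  rw [Fin.sum_univ_four, h0, h1, h2, h3]
  ext i j
  fin_cases i <;> fin_cases j <;>
    simp [o, Matrix.adjugate_fin_two, Matrix.vecMul, dotProduct, Fin.sum_univ_two,
      Matrix.trace_fin_two, Matrix.mul_apply] <;> ring_nf <;> simp <;> ring

/-- The change of the connection coefficients under a change of spin frame. -/
theorem connection_conj {B dB : Matrix (Fin 2) (Fin 2) ℂ}
    {s su dsu F τu dτu : Fin 4 → Matrix (Fin 2) (Fin 2) ℂ} (Γ : Fin 4 → Fin 4 → ℂ)
    (hdet : B.det = 1) (htr : (dB * B.adjugate).trace = 0)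
    (hF : ∀ β, B * s β * Bᴴ = F β) (hτ : ∀ β, B * su β * Bᴴ = τu β)
    (hd : ∀ β, dτu β = dB * su β * Bᴴ + B * dsu β * Bᴴ + B * su β * dBᴴ)
    (hsum : ∀ M : Matrix (Fin 2) (Fin 2) ℂ, ∑ β, τu β * M * (F β).adjugate = (2 * M.trace) • 1) :
    (dB + (1 / 4 : ℂ) • ∑ β, B * (dsu β + ∑ γ, Γ β γ • su γ) * (s β).adjugate) * B.adjugate =
      (1 / 4 : ℂ) • ∑ β, (dτu β + ∑ γ, Γ β γ • τu γ) * (F β).adjugate := by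
  have hBC : B * B.adjugate = 1 := by rw [Matrix.mul_adjugate, hdet, one_smul]
  have hCB : B.adjugate * B = 1 := by rw [Matrix.adjugate_mul, hdet, one_smul]
  have hdetH := det_conjTranspose_eq_one hdet
  have hBC' : Bᴴ * Bᴴ.adjugate = 1 := by rw [Matrix.mul_adjugate, hdetH, one_smul]
  have hCB' : (B.adjugate)ᴴ * Bᴴ = 1 := by
    rw [← Matrix.conjTranspose_mul, hBC, Matrix.conjTranspose_one]
  have hBC'' : Bᴴ * (B.adjugate)ᴴ = 1 := by
    rw [← Matrix.conjTranspose_mul, hCB, Matrix.conjTranspose_one]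
  have hadj (β : Fin 4) : (s β).adjugate * B.adjugate = Bᴴ * (F β).adjugate := by
    rw [← hF, Matrix.adjugate_mul_distrib, Matrix.adjugate_mul_distrib, ← Matrix.mul_assoc, hBC',
      Matrix.one_mul]
  -- The logarithmic derivative of the spin frame, which produces all the inhomogeneous terms.
  set D := dB * B.adjugate with hD
  have hdB : dB = D * B := by rw [hD, Matrix.mul_assoc, hCB, Matrix.mul_one]
  have key (β : Fin 4) : B * (dsu β + ∑ γ, Γ β γ • su γ) * (s β).adjugate * B.adjugate =
      (dτu β + ∑ γ, Γ β γ • τu γ) * (F β).adjugate - D * (τu β * 1 * (F β).adjugate) -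
        τu β * Dᴴ * (F β).adjugate := by
    have e1 : dB * su β * Bᴴ = D * τu β := by
      rw [hdB, ← hτ]
      simp only [Matrix.mul_assoc]
    have e2 : B * su β * dBᴴ = τu β * Dᴴ := by
      rw [hdB, ← hτ, Matrix.conjTranspose_mul]
      simp only [Matrix.mul_assoc]
    have e3 : B * dsu β * Bᴴ = dτu β - D * τu β - τu β * Dᴴ := by
      rw [hd, e1, e2]
      abel
    rw [Matrix.mul_assoc, hadj, ← Matrix.mul_assoc, Matrix.mul_add, Matrix.add_mul, e3,
      Finset.mul_sum, Finset.sum_mul]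
    simp only [Matrix.mul_smul, Matrix.smul_mul, hτ]
    simp only [Matrix.add_mul, Matrix.sub_mul, Matrix.mul_one, Matrix.mul_assoc]
    abel
  have hDH : Dᴴ.trace = 0 := by rw [Matrix.trace_conjTranspose, htr, star_zero]
  rw [Matrix.add_mul, Matrix.smul_mul, Finset.sum_mul]
  simp only [key, Finset.sum_sub_distrib]
  -- Completeness with `M = 1` gives `4D`, which with the factor `1/4` cancels the derivative of
  -- `B`; with `M = Dᴴ` it gives zero because `D` is traceless.
  rw [hsum, ← Finset.mul_sum, hsum, hDH]
  rw [← hD]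
  ext i j
  simp
  ring

/-! ### The teleparallel Lagrangian in frame components -/

section
variable {R : Type*} [CommRing R]

theorem wedge_eq_det4 (u v w z : Fin 4 → R) (κ μ ν ρ : Fin 4) :
    wedge13 u (wedge12 v (wedge11 w z)) κ μ ν ρ =
      det4 (u ∘ ![κ, μ, ν, ρ]) (v ∘ ![κ, μ, ν, ρ]) (w ∘ ![κ, μ, ν, ρ]) (z ∘ ![κ, μ, ν, ρ]) := by
  simp [wedge13, wedge12, wedge11, det4_eq]
  ring

end

theorem det4_comp (u v w z : Fin 4 → ℝ) (κ μ ν ρ : Fin 4) :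
    det4 (u ∘ ![κ, μ, ν, ρ]) (v ∘ ![κ, μ, ν, ρ]) (w ∘ ![κ, μ, ν, ρ]) (z ∘ ![κ, μ, ν, ρ]) =
      det4 u v w z * leviCivita κ μ ν ρ := by
  have : Matrix.of ![u ∘ ![κ, μ, ν, ρ], v ∘ ![κ, μ, ν, ρ], w ∘ ![κ, μ, ν, ρ],
      z ∘ ![κ, μ, ν, ρ]] = Matrix.of ![u, v, w, z] *
        (Matrix.of fun i j : Fin 4 => if ![κ, μ, ν, ρ] i = j then (1 : ℝ) else 0)ᵀ := by
    ext i j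
    fin_cases i <;> simp [Matrix.mul_apply]
  rw [det4, this, Matrix.det_mul, Matrix.det_transpose]
  rfl

/-- The covector `l = ϑ⁰ + ϑ³` is itself a combination of the frame, so only the symbols with first
index 0 or 3 occur. -/
theorem det4_frame (T : Matrix (Fin 4) (Fin 4) ℝ) (i j k : Fin 4) :
    det4 (fun α => T 0 α + T 3 α) (T i) (T j) (T k) =
      T.det * (leviCivita 0 i j k + leviCivita 3 i j k) := by
  have h (i : Fin 4) : T i = Tᵀ *ᵥ Pi.single i 1 := by
    funext α
    simp
  have hl : (fun α => T 0 α + T 3 α) = Tᵀ *ᵥ (Pi.single 0 1 + Pi.single 3 1) := by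
    rw [Matrix.mulVec_add, ← h, ← h]
    rfl
  rw [hl, h i, h j, h k, det4_mulVec, Matrix.det_transpose, leviCivita_eq, leviCivita_eq]
  congr 1
  simp only [det4_eq, Pi.add_apply]
  ring

/-- The components `e_j^α e_k^β ∂_α ϑ^i_β`. -/
def frameDeriv (θ : Pt → Matrix (Fin 4) (Fin 4) ℝ) (x : Pt) (i j k : Fin 4) : ℝ :=
  ∑ α, ∑ β, (θ x)⁻¹ α j * (θ x)⁻¹ β k * pd α (fun y => θ y i β) x

theorem extD_eq_frameDeriv {θ : Pt → Matrix (Fin 4) (Fin 4) ℝ} {x : Pt} (hdet : (θ x).det ≠ 0)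
    (i α β : Fin 4) :
    extD (fun y => θ y i) x α β =
      ∑ j, ∑ k, frameDeriv θ x i j k * wedge11 (θ x j) (θ x k) α β := by
  have h (α β : Fin 4) : ∑ j, (θ x)⁻¹ α j * θ x j β = if α = β then 1 else 0 := by
    rw [← Matrix.mul_apply, Matrix.nonsing_inv_mul _ hdet.isUnit, Matrix.one_apply]
  have key (α β : Fin 4) : ∑ j, ∑ k, frameDeriv θ x i j k * (θ x j α * θ x k β) =
      pd α (fun y => θ y i β) x := by
    have : ∑ j, ∑ k, frameDeriv θ x i j k * (θ x j α * θ x k β) =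
        ∑ α', ∑ β', (∑ j, (θ x)⁻¹ α' j * θ x j α) * (∑ k, (θ x)⁻¹ β' k * θ x k β) *
          pd α' (fun y => θ y i β') x := by
      simp only [frameDeriv, Finset.sum_mul, Finset.mul_sum]
      have (j : Fin 4) : ∑ k, ∑ a, ∑ b, (θ x)⁻¹ a j * (θ x)⁻¹ b k *
          pd a (fun y => θ y i b) x * (θ x j α * θ x k β) =
          ∑ a, ∑ b, ∑ k, (θ x)⁻¹ a j * (θ x)⁻¹ b k *
          pd a (fun y => θ y i b) x * (θ x j α * θ x k β) := by
        rw [Finset.sum_comm]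
        exact Finset.sum_congr rfl fun a _ => Finset.sum_comm
      simp only [this]
      rw [Finset.sum_comm]
      refine Finset.sum_congr rfl fun a _ => ?_
      rw [Finset.sum_comm]
      refine Finset.sum_congr rfl fun b _ => ?_
      rw [Finset.sum_comm]
      refine Finset.sum_congr rfl fun k _ => Finset.sum_congr rfl fun j _ => ?_
      ring
    rw [this]
    simp [h]
  rw [extD, ← key α β, ← key β α, ← Finset.sum_sub_distrib]
  refine Finset.sum_congr rfl fun j _ => ?_
  rw [← Finset.sum_sub_distrib]
  refine Finset.sum_congr rfl fun k _ => ?_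
  rw [wedge11]
  ring

/-- Expanding `dϑ^i` in the frame leaves only the 4-forms `l ∧ ϑ^i ∧ ϑ^j ∧ ϑ^k`, each a multiple of
the volume form. This is the expression with which the Weyl density is compared. -/
theorem teleLagrangian_eq {θ : Pt → Matrix (Fin 4) (Fin 4) ℝ} {x : Pt} (hdet : (θ x).det ≠ 0)
    (κ μ ν ρ : Fin 4) :
    teleLagrangian θ x κ μ ν ρ = (1 / 3) * (θ x).det * leviCivita κ μ ν ρ *
      ∑ i, ∑ j, ∑ k, o i i * (leviCivita 0 i j k + leviCivita 3 i j k) *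
        frameDeriv θ x i j k := by
  have hw (i j k : Fin 4) : wedge13 (lForm θ x) (wedge12 (θ x i) (wedge11 (θ x j) (θ x k))) κ μ ν ρ
      = (θ x).det * (leviCivita 0 i j k + leviCivita 3 i j k) * leviCivita κ μ ν ρ := by
    rw [wedge_eq_det4, det4_comp]
    congr 1
    exact det4_frame (θ x) i j k
  have hax : axialTorsion θ x = fun α β γ => ∑ i, ∑ j, ∑ k, (1 / 3) * o i i *
      frameDeriv θ x i j k * wedge12 (θ x i) (wedge11 (θ x j) (θ x k)) α β γ := by
    funext α β γ
    rw [axialTorsion, Finset.mul_sum]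
    refine Finset.sum_congr rfl fun i _ => ?_
    rw [Finset.sum_eq_single i (fun b _ hb => by rw [o_apply_ne hb.symm, zero_mul]) (by simp)]
    simp only [wedge12, extD_eq_frameDeriv hdet, Finset.mul_sum, ← Finset.sum_add_distrib]
    refine Finset.sum_congr rfl fun j _ => Finset.sum_congr rfl fun k _ => ?_
    ring
  rw [teleLagrangian, hax]
  simp only [wedge13, Finset.mul_sum, ← Finset.sum_sub_distrib, ← Finset.sum_add_distrib]
  refine Finset.sum_congr rfl fun i _ => Finset.sum_congr rfl fun j _ =>
    Finset.sum_congr rfl fun k _ => ?_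
  have := hw i j k
  rw [wedge13] at this
  linear_combination (1 / 3) * o i i * frameDeriv θ x i j k * this

/-! ### The Weyl Lagrangian in an adapted spin frame -/

/-- The constants through which the connection enters the Weyl Lagrangian. -/
def tauCubic (k i j : Fin 4) : ℝ := ((tau k * (tau i).adjugate * tau j) 0 0).im

/-- In a product of three Pauli matrices the parts containing a metric factor are real combinations
of Hermitian matrices, with real diagonal. The imaginary part of the `00` entry thus comes from the
totally antisymmetric part, dual to one Pauli matrix, and only `τ_0` and `τ_3` have a nonzero `00`
entry: the two constituents of `l`. -/
theorem tauCubic_eq (i j k : Fin 4) :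
    o k k * o j j * tauCubic k i j = -(o i i * (leviCivita 0 i j k + leviCivita 3 i j k)) := by
  have h0 : tau 0 = !![1, 0; 0, 1] := by
    rw [← Matrix.one_fin_two]
    rfl
  have h1 : tau 1 = !![0, 1; 1, 0] := rfl
  have h2 : tau 2 = !![0, Complex.I; -Complex.I, 0] := rfl
  have h3 : tau 3 = !![1, 0; 0, -1] := rfl
  rw [leviCivita_eq, leviCivita_eq]
  fin_cases i <;> fin_cases j <;> fin_cases k <;>
    simp [o, tauCubic, h0, h1, h2, h3, Matrix.adjugate_fin_two, det4_eq]

theorem tauCubic_antisymm (i j k : Fin 4) :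
    o j j * o k k * tauCubic j i k = -(o k k * o j j * tauCubic k i j) := by
  rw [tauCubic_eq, tauCubic_eq]
  have h (a : Fin 4) : leviCivita a i k j = -leviCivita a i j k := by
    simp only [leviCivita_eq, det4_eq]
    ring
  rw [h, h]
  ring

/-- Contraction of the totally antisymmetric constants: only the torsion of the frame survives. -/
theorem sum_tauCubic {T e : Matrix (Fin 4) (Fin 4) ℝ} {Q de : Fin 4 → Matrix (Fin 4) (Fin 4) ℝ}
    {Γ : Fin 4 → Fin 4 → Fin 4 → ℝ} (hΓ : ∀ β α γ, Γ β α γ = Γ β γ α)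
    (hd : ∀ α i k, ∑ β, T i β * de α β k = -∑ β, Q α i β * e β k) :
    ∑ α, ∑ β, ∑ k, ∑ i, ∑ j, o k k * (de α β k + ∑ γ, Γ β α γ * e γ k) * T i β *
      (e α j * o j j) * tauCubic k i j =
    ∑ i, ∑ j, ∑ k, o i i * (leviCivita 0 i j k + leviCivita 3 i j k) *
      ∑ α, ∑ β, e α j * e β k * Q α i β := by
  -- `P` collects the frame components of the derivatives of `ϑ^i`, `S` those of the Christoffel
  -- symbols.
  let P (i j k : Fin 4) : ℝ := ∑ α, ∑ β, e α j * e β k * Q α i β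
  let S (i j k : Fin 4) : ℝ := ∑ α, ∑ β, ∑ γ, e α j * T i β * Γ β α γ * e γ k
  have hS (i j k : Fin 4) : S i j k = S i k j := by
    simp only [S]
    rw [Finset.sum_comm]
    rw [Finset.sum_comm (s := Finset.univ (α := Fin 4)) (t := Finset.univ (α := Fin 4))
      (f := fun α β => ∑ γ, e α k * T i β * Γ β α γ * e γ j)]
    refine Finset.sum_congr rfl fun β _ => ?_
    rw [Finset.sum_comm]
    refine Finset.sum_congr rfl fun α _ => Finset.sum_congr rfl fun γ _ => ?_
    rw [hΓ]
    ring
  have h1 : ∑ α, ∑ β, ∑ k, ∑ i, ∑ j, o k k * (de α β k + ∑ γ, Γ β α γ * e γ k) * T i β *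
      (e α j * o j j) * tauCubic k i j =
      ∑ i, ∑ j, ∑ k, o k k * o j j * tauCubic k i j * (-P i j k + S i j k) := by
    have hP (i j k : Fin 4) : -P i j k = ∑ α, ∑ β, e α j * (T i β * de α β k) := by
      simp only [← Finset.mul_sum, hd, P, mul_neg, Finset.sum_neg_distrib]
      congr 1
      refine Finset.sum_congr rfl fun α _ => ?_
      rw [Finset.mul_sum]
      exact Finset.sum_congr rfl fun β _ => by ring
    simp only [hP, S, ← Finset.sum_add_distrib, Finset.mul_sum]
    calc _ = ∑ i, ∑ j, ∑ k, ∑ α, ∑ β, o k k * (de α β k + ∑ γ, Γ β α γ * e γ k) * T i β *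
          (e α j * o j j) * tauCubic k i j := by
          have c1 (f : Fin 4 → Fin 4 → Fin 4 → Fin 4 → Fin 4 → ℝ) :
              ∑ α, ∑ β, ∑ k, ∑ i, ∑ j, f α β k i j = ∑ i, ∑ j, ∑ k, ∑ α, ∑ β, f α β k i j := by
            calc _ = ∑ p : Fin 4 × Fin 4 × Fin 4 × Fin 4 × Fin 4,
                  f p.1 p.2.1 p.2.2.1 p.2.2.2.1 p.2.2.2.2 := by
                  simp only [Fintype.sum_prod_type]
              _ = ∑ p : Fin 4 × Fin 4 × Fin 4 × Fin 4 × Fin 4,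
                  f p.2.2.2.1 p.2.2.2.2 p.2.2.1 p.1 p.2.1 :=
                  -- The reordering `(α, β, k, i, j) ↦ (i, j, k, α, β)` is an involution, hence the
                  -- same map in both directions.
                  Fintype.sum_equiv
                    ⟨fun p => (p.2.2.2.1, p.2.2.2.2, p.2.2.1, p.1, p.2.1),
                      fun p => (p.2.2.2.1, p.2.2.2.2, p.2.2.1, p.1, p.2.1),
                      fun _ => rfl, fun _ => rfl⟩ _ _ fun _ => rfl
              _ = _ := by simp only [Fintype.sum_prod_type]
          exact c1 _
      _ = _ := by
          refine Finset.sum_congr rfl fun i _ => Finset.sum_congr rfl fun j _ =>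
            Finset.sum_congr rfl fun k _ => Finset.sum_congr rfl fun α _ =>
              Finset.sum_congr rfl fun β _ => ?_
          rw [mul_add, mul_add, add_mul, add_mul, add_mul, Finset.mul_sum, Finset.sum_mul,
            Finset.sum_mul, Finset.sum_mul, Finset.mul_sum]
          congr 1
          · ring
          · exact Finset.sum_congr rfl fun γ _ => by ring
  -- `S` is symmetric in `j, k` because the connection is torsion free, while the coefficients are
  -- antisymmetric: the sum equals its own negative.
  have h2 : ∑ i, ∑ j, ∑ k, o k k * o j j * tauCubic k i j * S i j k = 0 := by
    refine Finset.sum_eq_zero fun i _ => ?_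
    have : ∑ j, ∑ k, o k k * o j j * tauCubic k i j * S i j k =
        -∑ j, ∑ k, o k k * o j j * tauCubic k i j * S i j k := by
      conv_lhs => rw [Finset.sum_comm]
      simp only [← Finset.sum_neg_distrib]
      refine Finset.sum_congr rfl fun j _ => Finset.sum_congr rfl fun k _ => ?_
      rw [hS i k j]
      linear_combination S i j k * tauCubic_antisymm i j k
    linarith
  rw [h1]
  simp only [mul_add, Finset.sum_add_distrib]
  rw [h2, add_zero]
  refine Finset.sum_congr rfl fun i _ => Finset.sum_congr rfl fun j _ =>
    Finset.sum_congr rfl fun k _ => ?_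
  rw [tauCubic_eq]
  simp only [P]
  ring

section
variable {U : Set Pt} {g ref : Pt → Matrix (Fin 4) (Fin 4) ℝ}
  {σ : Pt → Fin 4 → Matrix (Fin 2) (Fin 2) ℂ} {x : Pt}

theorem tensUp_isHermitian (hσ : IsPauli U g ref σ) (hx : x ∈ U) (α : Fin 4) :
    (tensUp g σ x α).IsHermitian := by
  rw [tensUp_eq]
  simp only [Matrix.IsHermitian, Matrix.conjTranspose_sum, Matrix.conjTranspose_smul,
    (hσ.hermitian x hx _).eq]
  refine Finset.sum_congr rfl fun β _ => ?_
  rw [Complex.star_def, Complex.conj_ofReal]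

/-- The complex density `ξ̄^ḃ σ^α_{aḃ} ∇_α ξ^a`. -/
def weylDensity (g : Pt → Matrix (Fin 4) (Fin 4) ℝ)
    (σ : Pt → Fin 4 → Matrix (Fin 2) (Fin 2) ℂ) (ξ : Pt → Fin 2 → ℂ) (x : Pt) : ℂ :=
  ∑ α, ∑ a, ∑ b, (starRingEnd ℂ) (ξ x b) * tensUp g σ x α a b * covDeriv g σ ξ x α a

/-- Since `σ^α` is Hermitian, the second term of the Lagrangian is the conjugate of the first, and
`(i/2)(z - z̄) = -Im z`. It remains to compute one imaginary part. -/
theorem weylLagrangian_eq (hσ : IsPauli U g ref σ) (hx : x ∈ U) (ξ : Pt → Fin 2 → ℂ)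
    (κ μ ν ρ : Fin 4) :
    weylLagrangian g σ ξ x κ μ ν ρ =
      ((-(weylDensity g σ ξ x).im * (Real.sqrt |(g x).det| * leviCivita κ μ ν ρ) : ℝ) : ℂ) := by
  have hconj : ∑ α, ∑ a, ∑ b, ξ x a * tensUp g σ x α a b *
      (starRingEnd ℂ) (covDeriv g σ ξ x α b) = (starRingEnd ℂ) (weylDensity g σ ξ x) := by
    simp only [weylDensity, map_sum, map_mul, Complex.conj_conj]
    refine Finset.sum_congr rfl fun α _ => ?_
    rw [Finset.sum_comm]
    refine Finset.sum_congr rfl fun b _ => Finset.sum_congr rfl fun a _ => ?_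
    rw [← (tensUp_isHermitian hσ hx α).apply a b, Complex.star_def]
  have : weylLagrangian g σ ξ x κ μ ν ρ =
      Complex.I / 2 * (weylDensity g σ ξ x - (starRingEnd ℂ) (weylDensity g σ ξ x)) *
        ((Real.sqrt |(g x).det| * leviCivita κ μ ν ρ : ℝ) : ℂ) := by
    rw [weylLagrangian, ← hconj, weylDensity]
    simp only [← Finset.sum_sub_distrib]
  rw [this, Complex.sub_conj]
  push_cast
  linear_combination ((weylDensity g σ ξ x).im : ℂ) * Real.sqrt |(g x).det| *
    leviCivita κ μ ν ρ * Complex.I_mul_I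

/-- Raising the index with `g` turns `ϑ^k` into the dual frame vector `e_k` times `o_{kk}`, by `g⁻¹
Tᵀ = T⁻¹ o`. -/
theorem tensUp_conj (hg : IsLorentzianMetric U g) (hσ : IsPauli U g ref σ) (hx : x ∈ U)
    {T : Matrix (Fin 4) (Fin 4) ℝ} {B : Matrix (Fin 2) (Fin 2) ℂ} (h : Adapted (σ x) T B)
    (α : Fin 4) :
    B * tensUp g σ x α * Bᴴ = ∑ k, ((T⁻¹ α k * o k k : ℝ) : ℂ) • tau k := by
  have hm := h.metric_eq hg hσ hx
  have hHT (k : Fin 4) : ∑ β, ((g x)⁻¹ α β : ℂ) * T k β = ((T⁻¹ α k * o k k : ℝ) : ℂ) := by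
    have := congrFun (congrFun (metric_inv_mul_transpose hg hx hm) α) k
    rw [o, Matrix.mul_diagonal] at this
    simp only [Matrix.mul_apply, Matrix.transpose_apply] at this
    have := congrArg (fun r : ℝ => (r : ℂ)) this
    push_cast at this
    rw [this]
    simp [o]
  rw [tensUp_eq, Finset.mul_sum, Finset.sum_mul]
  simp only [Matrix.mul_smul, Matrix.smul_mul, h.eq, frameMat, Finset.smul_sum, smul_smul]
  rw [Finset.sum_comm]
  simp only [← Finset.sum_smul, hHT]

theorem smoothSpin_tensUp (hg : IsLorentzianMetric U g) (hσ : IsPauli U g ref σ) (α : Fin 4) :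
    SmoothSpin U fun x => tensUp g σ x α := by
  simp only [tensUp_eq]
  exact SmoothSpin.sum _ fun β => SmoothSpin.smul
    (contDiffOn_ofReal (hg.1.inv (fun x hx => hg.det_ne_zero hx) α β)) (hσ.smooth β)

theorem covDeriv_eq (B : Pt → Matrix (Fin 2) (Fin 2) ℂ) (α : Fin 4) (a : Fin 2) :
    covDeriv g σ (fun y => B y 0) x α a =
      (pdMat α B x + (1 / 4 : ℂ) • ∑ β, B x * (pdMat α (fun y => tensUp g σ y β) x +
        ∑ γ, (christoffel g x β α γ : ℂ) • tensUp g σ x γ) * (σ x β).adjugate) 0 a := by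
  have h (β : Fin 4) : ∑ b, ∑ c, spinUp (σ x β) a c *
      (pd α (fun y => tensUp g σ y β b c) x +
        ∑ γ, (christoffel g x β α γ : ℂ) * tensUp g σ x γ b c) * B x 0 b =
      (B x * (pdMat α (fun y => tensUp g σ y β) x +
        ∑ γ, (christoffel g x β α γ : ℂ) • tensUp g σ x γ) * (σ x β).adjugate) 0 a := by
    rw [← mul_eps_conj_transpose]
    simp only [Matrix.mul_apply, Matrix.add_apply, Matrix.sum_apply, Matrix.smul_apply,
      smul_eq_mul, pdMat, Finset.sum_mul]
    rw [Finset.sum_comm]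
    refine Finset.sum_congr rfl fun c _ => Finset.sum_congr rfl fun b _ => ?_
    ring
  simp only [covDeriv, h, Matrix.add_apply, Matrix.smul_apply, Matrix.sum_apply, smul_eq_mul]
  rfl

/-- Inserting `B⁻¹ B` puts both the derivative and `σ^α` into the adapted spin frame, where the
spinor has components `(1, 0)`; hence the `00` entry. -/
theorem weylDensity_eq (ξ : Pt → Fin 2 → ℂ) (B : Matrix (Fin 2) (Fin 2) ℂ) (hdet : B.det = 1)
    (hξ : ξ x = B 0) (N : Fin 4 → Matrix (Fin 2) (Fin 2) ℂ)
    (hN : ∀ α a, covDeriv g σ ξ x α a = N α 0 a) :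
    weylDensity g σ ξ x =
      ∑ α, (N α * B.adjugate * (B * tensUp g σ x α * Bᴴ)) 0 0 := by
  have hCB : B.adjugate * B = 1 := by rw [Matrix.adjugate_mul, hdet, one_smul]
  have h (α : Fin 4) : N α * B.adjugate * (B * tensUp g σ x α * Bᴴ) =
      N α * tensUp g σ x α * Bᴴ := by
    calc _ = N α * (B.adjugate * B) * tensUp g σ x α * Bᴴ := by simp only [Matrix.mul_assoc]
      _ = _ := by rw [hCB, Matrix.mul_one]
  simp only [weylDensity, h, hN, hξ]
  refine Finset.sum_congr rfl fun α _ => ?_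
  simp only [Matrix.mul_apply, Fin.sum_univ_two, Matrix.conjTranspose_apply, Complex.star_def]
  ring

theorem christoffel_symm (hg : IsLorentzianMetric U g) (hU : IsOpen U) (hx : x ∈ U)
    (β α γ : Fin 4) : christoffel g x β α γ = christoffel g x β γ α := by
  have hs (i j δ : Fin 4) : pd δ (fun y => g y i j) x = pd δ (fun y => g y j i) x :=
    pd_congr ((hU.eventually_mem hx).mono fun y hy =>
      congrFun (congrFun (hg.transpose_eq hy) j) i)
  simp only [christoffel]
  congr 1
  refine Finset.sum_congr rfl fun δ _ => ?_
  rw [hs α γ]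
  ring

theorem smul_sum_mul_sum_mul_sum_apply (c : ℂ) (p q r : Fin 4 → ℂ)
    (X Y Z : Fin 4 → Matrix (Fin 2) (Fin 2) ℂ) (a b : Fin 2) :
    ((c • ((∑ k, p k • X k) * ∑ i, q i • Y i)) * ∑ j, r j • Z j) a b =
      ∑ k, ∑ i, ∑ j, c * (p k * q i * r j) * (X k * Y i * Z j) a b := by
  have h : (∑ k, p k • X k) * ∑ i, q i • Y i = ∑ k, ∑ i, (p k * q i) • (X k * Y i) := by
    rw [Finset.sum_mul_sum]
    refine Finset.sum_congr rfl fun k _ => Finset.sum_congr rfl fun i _ => ?_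
    rw [Matrix.smul_mul, Matrix.mul_smul, smul_smul]
  rw [h]
  simp only [Finset.smul_sum, Finset.sum_mul, Matrix.sum_apply]
  refine Finset.sum_congr rfl fun k _ => Finset.sum_congr rfl fun i _ => ?_
  simp only [Finset.mul_sum, Matrix.sum_apply, Matrix.smul_mul, Matrix.mul_smul,
    Matrix.smul_apply, smul_eq_mul]
  refine Finset.sum_congr rfl fun j _ => ?_
  ring

/-- The Weyl density in terms of the derivatives of the adapted frame. -/
theorem weylDensity_im (hU : IsOpen U) (hg : IsLorentzianMetric U g) (hσ : IsPauli U g ref σ)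
    {θ : Pt → Matrix (Fin 4) (Fin 4) ℝ} (hθ : SmoothMat U θ)
    {B : Pt → Matrix (Fin 2) (Fin 2) ℂ} (hB : SmoothSpin U B)
    (hA : ∀ x ∈ U, Adapted (σ x) (θ x) (B x)) (hx : x ∈ U) :
    (weylDensity g σ (fun y => B y 0) x).im =
      (1 / 4) * ∑ i, ∑ j, ∑ k, o i i * (leviCivita 0 i j k + leviCivita 3 i j k) *
        frameDeriv θ x i j k := by
  have hdetθ (y : Pt) (hy : y ∈ U) : (θ y).det ≠ 0 := ((hA y hy).det_pos hg hσ hy).ne'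
  have he := hθ.inv hdetθ
  have hUx := hU.eventually_mem hx
  have diff {f : Pt → ℝ} (hf : ContDiffOn ℝ ∞ f U) : DifferentiableAt ℝ f x :=
    (hf.contDiffAt (hU.mem_nhds hx)).differentiableAt (by simp)
  set e := (θ x)⁻¹ with hedef
  let de (α : Fin 4) : Matrix (Fin 4) (Fin 4) ℝ := fun β k => pd α (fun y => (θ y)⁻¹ β k) x
  let Q (α : Fin 4) : Matrix (Fin 4) (Fin 4) ℝ := fun i β => pd α (fun y => θ y i β) x
  let τu (y : Pt) (β : Fin 4) : Matrix (Fin 2) (Fin 2) ℂ :=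
    ∑ k, (((θ y)⁻¹ β k * o k k : ℝ) : ℂ) • tau k
  have hdτ (α β : Fin 4) : pdMat α (fun y => τu y β) x =
      ∑ k, ((de α β k * o k k : ℝ) : ℂ) • tau k := by
    ext a b
    simp only [pdMat, τu, Matrix.sum_apply, Matrix.smul_apply, smul_eq_mul]
    have hd (k : Fin 4) : DifferentiableAt ℝ (fun y => (((θ y)⁻¹ β k * o k k : ℝ) : ℂ)) x :=
      Complex.ofRealCLM.differentiableAt.comp x ((diff (he β k)).mul_const _)
    rw [pd_sum _ fun k => (hd k).fun_mul (differentiableAt_const (tau k a b))]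
    refine Finset.sum_congr rfl fun k _ => ?_
    rw [pd_mul (hd k) (differentiableAt_const _), pd_const, mul_zero, add_zero,
      pd_ofReal ((diff (he β k)).mul_const _)]
    congr 2
    simp only [pd, de]
    rw [fderiv_mul_const (diff (he β k))]
    simp [mul_comm]
  have hτ (y : Pt) (hy : y ∈ U) (β : Fin 4) : B y * tensUp g σ y β * (B y)ᴴ = τu y β :=
    tensUp_conj hg hσ hy (hA y hy) β
  have hBd : DiffMat B x := hB.diffMat hU hx
  have hsum (M : Matrix (Fin 2) (Fin 2) ℂ) :
      ∑ β, τu x β * M * (frameMat (θ x) β).adjugate = (2 * M.trace) • 1 := by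
    rw [← sum_tau_mul_adjugate]
    simp only [τu, frameMat, adjugate_sum_two, adjugate_smul_two, Finset.sum_mul, Finset.mul_sum,
      Matrix.smul_mul, Matrix.mul_smul, smul_smul]
    have h (i k : Fin 4) : ∑ β, ((θ x i β : ℂ) * (((θ x)⁻¹ β k * o k k : ℝ) : ℂ)) =
        if i = k then (o k k : ℂ) else 0 := by
      have : ∑ β, θ x i β * (θ x)⁻¹ β k = if i = k then 1 else 0 := by
        rw [← Matrix.mul_apply, Matrix.mul_nonsing_inv _ (hdetθ x hx).isUnit, Matrix.one_apply]
      have := congrArg (fun r : ℝ => (r : ℂ) * (o k k : ℂ)) this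
      push_cast at this
      rw [Finset.sum_mul] at this
      push_cast
      simp only [← mul_assoc]
      rw [this]
      split_ifs <;> simp
    rw [Finset.sum_comm]
    refine Finset.sum_congr rfl fun k _ => ?_
    rw [Finset.sum_comm]
    simp only [← Finset.sum_smul, h]
    rw [Finset.sum_eq_single k (fun i _ hi => by rw [if_neg (Ne.symm hi), zero_smul]) (by simp), if_pos rfl]
  have hd (α β : Fin 4) : pdMat α (fun y => τu y β) x =
      pdMat α B x * tensUp g σ x β * (B x)ᴴ +
        B x * pdMat α (fun y => tensUp g σ y β) x * (B x)ᴴ +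
        B x * tensUp g σ x β * (pdMat α B x)ᴴ := by
    have hsd : DiffMat (fun y => tensUp g σ y β) x := (smoothSpin_tensUp hg hσ β).diffMat hU hx
    rw [← pdMat_congr (hUx.mono fun y hy => hτ y hy β),
      pdMat_mul (hBd.mul hsd) hBd.conjTranspose, pdMat_mul hBd hsd, pdMat_conjTranspose hBd,
      Matrix.add_mul]
  have hconn (α : Fin 4) := connection_conj (fun β γ => (christoffel g x β α γ : ℂ))
    (hA x hx).det (trace_pdMat_mul_adjugate (α := α) hBd (hUx.mono fun y hy => (hA y hy).det))
    (hA x hx).eq (hτ x hx) (hd α) hsum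
  have hterm (α β : Fin 4) : pdMat α (fun y => τu y β) x +
      ∑ γ, (christoffel g x β α γ : ℂ) • τu x γ =
      ∑ k, ((o k k * (de α β k + ∑ γ, christoffel g x β α γ * e γ k) : ℝ) : ℂ) • tau k := by
    rw [hdτ]
    simp only [τu, Finset.smul_sum, smul_smul]
    rw [Finset.sum_comm (f := fun γ k => ((christoffel g x β α γ : ℂ) *
      (((θ x)⁻¹ γ k * o k k : ℝ) : ℂ)) • tau k), ← Finset.sum_add_distrib]
    refine Finset.sum_congr rfl fun k _ => ?_
    rw [← Finset.sum_smul, ← add_smul]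
    congr 1
    push_cast
    rw [mul_add, Finset.mul_sum]
    congr 1
    · ring
    · exact Finset.sum_congr rfl fun γ _ => by rw [← hedef]; ring
  have hX : weylDensity g σ (fun y => B y 0) x = ∑ α, ∑ β, ∑ k, ∑ i, ∑ j,
      ((1 / 4 * (o k k * (de α β k + ∑ γ, christoffel g x β α γ * e γ k) * θ x i β *
        (e α j * o j j)) : ℝ) : ℂ) * (tau k * (tau i).adjugate * tau j) 0 0 := by
    rw [weylDensity_eq (fun y => B y 0) (B x) (hA x hx).det rfl _ (covDeriv_eq B)]
    refine Finset.sum_congr rfl fun α _ => ?_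
    rw [hconn α, hτ x hx]
    rw [Finset.smul_sum, Finset.sum_mul, Matrix.sum_apply]
    refine Finset.sum_congr rfl fun β _ => ?_
    rw [hterm]
    simp only [τu, frameMat, adjugate_sum_two, adjugate_smul_two]
    rw [smul_sum_mul_sum_mul_sum_apply]
    refine Finset.sum_congr rfl fun k _ => Finset.sum_congr rfl fun i _ =>
      Finset.sum_congr rfl fun j _ => ?_
    rw [← hedef]
    push_cast
    ring
  -- Differentiation of `ϑ^i(e_k) = δ^i_k` trades derivatives of the dual frame for those of the
  -- coframe.
  have hd' (α i k : Fin 4) : ∑ β, θ x i β * de α β k = -∑ β, Q α i β * e β k := by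
    have h1 : pd α (fun y => ∑ β, θ y i β * (θ y)⁻¹ β k) x = 0 := by
      rw [← pd_const (α := α) (x := x) (if i = k then (1 : ℝ) else 0)]
      refine pd_congr (hUx.mono fun y hy => ?_)
      change (θ y * (θ y)⁻¹) i k = _
      rw [Matrix.mul_nonsing_inv _ (hdetθ y hy).isUnit, Matrix.one_apply]
    have h2 : pd α (fun y => ∑ β, θ y i β * (θ y)⁻¹ β k) x =
        ∑ β, (θ x i β * de α β k + Q α i β * e β k) := by
      simp only [pd, de, Q]
      rw [fderiv_fun_sum fun β _ => (diff (hθ i β)).fun_mul (diff (he β k))]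
      simp only [FunLike.coe_sum, Finset.sum_apply]
      refine Finset.sum_congr rfl fun β _ => ?_
      rw [fderiv_fun_mul (diff (hθ i β)) (diff (he β k))]
      simp [← hedef]
      ring
    rw [h2, Finset.sum_add_distrib] at h1
    linarith
  have hfinal := sum_tauCubic (T := θ x) (e := e) (Q := Q) (de := de)
    (Γ := fun β α γ => christoffel g x β α γ) (christoffel_symm hg hU hx) hd'
  rw [hX]
  simp only [Complex.im_sum, Complex.im_ofReal_mul]
  have : (∑ i, ∑ j, ∑ k, o i i * (leviCivita 0 i j k + leviCivita 3 i j k) *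
        frameDeriv θ x i j k) = ∑ i, ∑ j, ∑ k, o i i * (leviCivita 0 i j k + leviCivita 3 i j k) *
      ∑ α, ∑ β, e α j * e β k * Q α i β := rfl
  rw [this, ← hfinal]
  simp only [Finset.mul_sum (a := (1 / 4 : ℝ)), tauCubic, mul_assoc]

/-- Both 4-forms are multiples of the same sum of frame derivatives times the volume form: `1/3` on
the teleparallel side and `-1/4` on the Weyl side. Positive orientation identifies `√|det g|` with
`det ϑ`. -/
theorem teleLagrangian_eq_weylLagrangian (hU : IsOpen U) (hg : IsLorentzianMetric U g)
    (hσ : IsPauli U g ref σ) {θ : Pt → Matrix (Fin 4) (Fin 4) ℝ} (hθ : SmoothMat U θ)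
    {B : Pt → Matrix (Fin 2) (Fin 2) ℂ} (hB : SmoothSpin U B)
    (hA : ∀ x ∈ U, Adapted (σ x) (θ x) (B x)) (hx : x ∈ U) (κ μ ν ρ : Fin 4) :
    (teleLagrangian θ x κ μ ν ρ : ℂ) =
      -(4 / 3) * weylLagrangian g σ (fun y => B y 0) x κ μ ν ρ := by
  have hpos := (hA x hx).det_pos hg hσ hx
  have hsqrt : Real.sqrt |(g x).det| = (θ x).det := by
    rw [(hA x hx).metric_eq hg hσ hx, Matrix.det_mul, Matrix.det_mul, Matrix.det_transpose, det_o]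
    rw [show (θ x).det * -1 * (θ x).det = -((θ x).det ^ 2) by ring, abs_neg, abs_sq,
      Real.sqrt_sq hpos.le]
  rw [weylLagrangian_eq hσ hx, weylDensity_im hU hg hσ hθ hB hA hx, hsqrt,
    teleLagrangian_eq hpos.ne']
  push_cast
  ring

end

/-! ### The bivector `l ∧ m` determines the spinor -/

/-- The components of `l ∧ m` with respect to the frame itself. -/
def lmMat : Matrix (Fin 4) (Fin 4) ℂ :=
  !![0, 1, Complex.I, 0; -1, 0, 0, -1; -Complex.I, 0, 0, -Complex.I; 0, 1, Complex.I, 0]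

theorem lmAt_eq (T : Matrix (Fin 4) (Fin 4) ℝ) (α β : Fin 4) :
    lmAt T α β = ((T.map Complex.ofReal)ᵀ * lmMat * T.map Complex.ofReal) α β := by
  simp only [Matrix.mul_apply, Fin.sum_univ_four, Matrix.transpose_apply, Matrix.map_apply]
  simp [lmAt, lmMat]
  ring

theorem bivectorMat_apply (s : Fin 4 → Matrix (Fin 2) (Fin 2) ℂ) (α β : Fin 4) (a c : Fin 2) :
    bivectorMat s α β a c = 1 / 2 * (s α a 0 * s β c 1 - s α a 1 * s β c 0 -
      (s β a 0 * s α c 1 - s β a 1 * s α c 0)) := by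
  simp [bivectorMat, eps, Matrix.mul_apply, Fin.sum_univ_two]
  ring

theorem bivectorMat_frameMat (T : Matrix (Fin 4) (Fin 4) ℝ) (w : Fin 2 → ℂ) (α β : Fin 4) :
    w ⬝ᵥ (bivectorMat (frameMat T) α β *ᵥ w) = ((T.map Complex.ofReal)ᵀ *
      (Matrix.of fun j k => w ⬝ᵥ (bivectorMat tau j k *ᵥ w)) * T.map Complex.ofReal) α β := by
  simp only [Matrix.mul_apply, Fin.sum_univ_four, Matrix.transpose_apply, Matrix.map_apply,
    Matrix.of_apply, dotProduct, Matrix.mulVec, Fin.sum_univ_two, bivectorMat_apply, frameMat_eq]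
  simp [tau]
  ring

theorem transpose_mul_mul_cancel {T : Matrix (Fin 4) (Fin 4) ℝ} (hT : T.det ≠ 0)
    {M N : Matrix (Fin 4) (Fin 4) ℂ}
    (h : (T.map Complex.ofReal)ᵀ * M * T.map Complex.ofReal =
      (T.map Complex.ofReal)ᵀ * N * T.map Complex.ofReal) : M = N := by
  have hu : IsUnit (T.map Complex.ofReal) := by
    rw [Matrix.isUnit_iff_isUnit_det]
    have : (T.map Complex.ofReal).det = (T.det : ℂ) := (Complex.ofRealHom.map_det T).symm
    rw [this]
    exact (Complex.ofReal_ne_zero.mpr hT).isUnit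
  have hut : IsUnit (T.map Complex.ofReal)ᵀ := by
    rw [Matrix.isUnit_iff_isUnit_det] at hu ⊢
    rwa [Matrix.det_transpose]
  exact hut.mul_left_cancel (hu.mul_right_cancel h)

/-- Referred to the frame, the hypothesis compares constant matrices. Its `01` and `02` entries read
`w_0² - w_1² = c` and `i(w_0² + w_1²) = ic`, and these already suffice. -/
theorem components_of_quadratic_eq {T : Matrix (Fin 4) (Fin 4) ℝ} (hT : T.det ≠ 0)
    {w : Fin 2 → ℂ} {c : ℂ}
    (h : ∀ α β, w ⬝ᵥ (bivectorMat (frameMat T) α β *ᵥ w) = c * lmAt T α β) :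
    w 1 = 0 ∧ w 0 ^ 2 = c := by
  have e : (Matrix.of fun j k => w ⬝ᵥ (bivectorMat tau j k *ᵥ w)) = c • lmMat := by
    refine transpose_mul_mul_cancel hT ?_
    ext α β
    rw [← bivectorMat_frameMat, h, lmAt_eq, Matrix.mul_smul, Matrix.smul_mul, Matrix.smul_apply,
      smul_eq_mul]
  have e1 := congrFun (congrFun e 0) 1
  have e2 := congrFun (congrFun e 0) 2
  simp [bivectorMat_apply, tau, lmMat, dotProduct, Matrix.mulVec, Fin.sum_univ_two] at e1 e2
  have hI := Complex.I_mul_I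
  have h1 : w 1 ^ 2 = 0 := by
    linear_combination (-1 / 2 : ℂ) * e1 + (-Complex.I / 2) * e2 +
      (w 1 ^ 2 / 2 - c / 2 + w 0 ^ 2 / 2) * hI
  have h1' : w 1 = 0 := by simpa using h1
  refine ⟨h1', ?_⟩
  simp [h1'] at e1
  linear_combination e1

section
variable {U : Set Pt} {g ref : Pt → Matrix (Fin 4) (Fin 4) ℝ}
  {σ : Pt → Fin 4 → Matrix (Fin 2) (Fin 2) ℂ}

theorem Adapted.spinorForm_row_zero {θ : Pt → Matrix (Fin 4) (Fin 4) ℝ}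
    {B : Pt → Matrix (Fin 2) (Fin 2) ℂ} {x : Pt} (h : Adapted (σ x) (θ x) (B x)) :
    spinorForm σ (fun y => B y 0) x = lm θ x := by
  ext α β
  rw [spinorForm_eq, h.row_zero, lm_eq]

theorem spinorForm_congr {ξ η : Pt → Fin 2 → ℂ} {x : Pt} (h : ξ x = η x) :
    spinorForm σ ξ x = spinorForm σ η x := by
  ext α β
  simp only [spinorForm, h]

theorem EqModU1.spinorForm {ξ η : Pt → Fin 2 → ℂ} (h : EqModU1 U ξ η) :
    EqModU1 U (spinorForm σ ξ) (WeylTele.spinorForm σ η) := by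
  obtain ⟨c, hc, h⟩ := h
  refine ⟨c ^ 2, by simp [hc], fun x hx => ?_⟩
  ext α β
  simp only [WeylTele.spinorForm, h x hx, Pi.smul_apply, smul_eq_mul, Finset.mul_sum]
  refine Finset.sum_congr rfl fun a _ => Finset.sum_congr rfl fun b _ => ?_
  ring

/-- In the adapted spin frame `ξ` has components `(w_0, 0)` with `w_0² = c`. A continuous square
root of a nonzero constant on a preconnected set is constant, and `|c| = 1` puts it in `U(1)`. -/
theorem eqModU1_row_zero (hU : IsPreconnected U) {θ : Pt → Matrix (Fin 4) (Fin 4) ℝ}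
    (hdet : ∀ x ∈ U, (θ x).det ≠ 0) {B : Pt → Matrix (Fin 2) (Fin 2) ℂ} (hB : SmoothSpin U B)
    (hA : ∀ x ∈ U, Adapted (σ x) (θ x) (B x)) {ξ : Pt → Fin 2 → ℂ}
    (hξ : ∀ a, ContDiffOn ℝ ∞ (fun x => ξ x a) U)
    (h : EqModU1 U (spinorForm σ ξ) (lm θ)) : EqModU1 U ξ fun x => B x 0 := by
  obtain ⟨c, hc, h⟩ := h
  let w : Pt → Fin 2 → ℂ := fun x => ξ x ᵥ* (B x).adjugate
  have hw (x : Pt) (hx : x ∈ U) : ξ x = w x ᵥ* B x := by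
    rw [Matrix.vecMul_vecMul, (hA x hx).adjugate_mul, Matrix.vecMul_one]
  have key (x : Pt) (hx : x ∈ U) : w x 1 = 0 ∧ w x 0 ^ 2 = c := by
    refine components_of_quadratic_eq (hdet x hx) fun α β => ?_
    rw [← (hA x hx).quadratic, ← hw x hx, ← spinorForm_eq, h x hx, ← lm_eq]
    rfl
  have hrow (x : Pt) (hx : x ∈ U) : ξ x = w x 0 • B x 0 := by
    rw [hw x hx]
    ext b
    simp [Matrix.vecMul, dotProduct, Fin.sum_univ_two, (key x hx).1]
  rcases U.eq_empty_or_nonempty with rfl | ⟨x₀, hx₀⟩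
  · exact ⟨1, by simp, by simp⟩
  have hcont : ContinuousOn (fun x => w x 0) U := by
    change ContinuousOn (fun x => ∑ a, ξ x a * (B x).adjugate a 0) U
    exact continuousOn_finsetSum _ fun a _ =>
      ((hξ a).continuousOn).mul (hB.adjugate a 0).continuousOn
  have hnorm : ‖w x₀ 0‖ = 1 := by
    have := congrArg norm (key x₀ hx₀).2
    rw [norm_pow, hc] at this
    nlinarith [norm_nonneg (w x₀ 0)]
  have hw0 : w x₀ 0 ≠ 0 := by
    intro h0
    simp [h0] at hnorm
  rcases hU.eq_or_eq_neg_of_sq_eq hcont (continuousOn_const (c := w x₀ 0))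
    (fun x hx => by simp [(key x hx).2, (key x₀ hx₀).2]) (fun _ => hw0) with e | e
  · exact ⟨w x₀ 0, hnorm, fun x hx => by rw [hrow x hx, show w x 0 = w x₀ 0 from e hx]⟩
  · exact ⟨-w x₀ 0, by rw [norm_neg, hnorm], fun x hx => by
      rw [hrow x hx, show w x 0 = -w x₀ 0 from e hx]⟩

/-! ### The bivector `l ∧ m` determines the coframe modulo `H` -/

/-- The only candidate is `Λ = θ' θ⁻¹`. In every frame `l ∧ m` has the same constant components
`lmMat`, so preserving it is the condition `lmMat = c Λᵀ lmMat Λ` on `Λ` alone. If it holds for the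
one coframe `θ`, it holds for all, with the same `c`, as membership in `H` demands. -/
theorem coframeEquiv_iff (θ θ' : Coframe U g ref) :
    CoframeEquiv U g ref θ θ' ↔ EqModU1 U (lm θ.1) (lm θ'.1) := by
  constructor
  · rintro ⟨Λ, hΛ, h⟩
    exact (hΛ.2 _ θ.2.1).congr_right fun x hx => lm_congr (h x hx).symm
  · rintro ⟨c, hc, h⟩
    have hdet (x : Pt) (hx : x ∈ U) : IsUnit (θ.1 x).det := (θ.2.2.1 x hx).ne'.isUnit
    have hact (x : Pt) (hx : x ∈ U) : θ'.1 x = act (fun y => θ'.1 y * (θ.1 y)⁻¹) θ.1 x := by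
      rw [act, Matrix.nonsing_inv_mul_cancel_right _ _ (hdet x hx)]
    refine ⟨fun x => θ'.1 x * (θ.1 x)⁻¹,
      ⟨⟨θ'.2.1.1.mul (θ.2.1.1.inv fun x hx => (hdet x hx).ne_zero), fun x hx => ?_⟩,
        fun η _ => ⟨c, hc, fun x hx => ?_⟩⟩, hact⟩
    · have e : (θ'.1 x)ᵀ * o * θ'.1 x = (θ.1 x)ᵀ * o * θ.1 x := by
        rw [← θ'.2.1.2 x hx, ← θ.2.1.2 x hx]
      calc (θ'.1 x * (θ.1 x)⁻¹)ᵀ * o * (θ'.1 x * (θ.1 x)⁻¹)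
          = ((θ.1 x)⁻¹)ᵀ * ((θ'.1 x)ᵀ * o * θ'.1 x) * (θ.1 x)⁻¹ := by
            simp only [Matrix.transpose_mul, Matrix.mul_assoc]
        _ = (θ.1 x * (θ.1 x)⁻¹)ᵀ * o * (θ.1 x * (θ.1 x)⁻¹) := by
            rw [e]
            simp only [Matrix.transpose_mul, Matrix.mul_assoc]
        _ = o := by
            rw [Matrix.mul_nonsing_inv _ (hdet x hx)]
            simp
    · have hlm (A : Pt → Matrix (Fin 4) (Fin 4) ℝ) : lm A x =
          (((A x).map Complex.ofReal)ᵀ * lmMat * (A x).map Complex.ofReal) := by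
        ext α β
        rw [lm_eq, lmAt_eq]
      have hmap (A B : Matrix (Fin 4) (Fin 4) ℝ) :
          (A * B).map Complex.ofReal = A.map Complex.ofReal * B.map Complex.ofReal :=
        Matrix.map_mul (f := Complex.ofRealHom)
      set Λ := θ'.1 x * (θ.1 x)⁻¹ with hΛ
      have hx' := h x hx
      rw [lm_congr (hact x hx), hlm, hlm, act, hmap, Matrix.transpose_mul] at hx'
      have e : lmMat = c • ((Λ.map Complex.ofReal)ᵀ * lmMat * Λ.map Complex.ofReal) := by
        refine transpose_mul_mul_cancel (hdet x hx).ne_zero ?_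
        refine hx'.trans ?_
        rw [Matrix.mul_smul, Matrix.smul_mul]
        simp only [Matrix.mul_assoc]
        rfl
      rw [hlm, hlm, act, hmap, Matrix.transpose_mul]
      conv_lhs => rw [e]
      rw [Matrix.mul_smul, Matrix.smul_mul]
      simp only [Matrix.mul_assoc]
      rfl

/-! ### Phase invariance of the Weyl Lagrangian -/

/-- The covariant derivative is complex linear and the phase is constant, so the density acquires
only the factor `c̄ c = 1`. -/
theorem EqModU1.weylLagrangian (hU : IsOpen U) (hσ : IsPauli U g ref σ) {ξ η : Pt → Fin 2 → ℂ}
    (hη : ∀ a, ContDiffOn ℝ ∞ (fun x => η x a) U) (h : EqModU1 U ξ η) {x : Pt} (hx : x ∈ U)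
    (κ μ ν ρ : Fin 4) :
    weylLagrangian g σ ξ x κ μ ν ρ = WeylTele.weylLagrangian g σ η x κ μ ν ρ := by
  obtain ⟨c, hc, h⟩ := h
  have hcov (α : Fin 4) (a : Fin 2) : covDeriv g σ ξ x α a = c * covDeriv g σ η x α a := by
    have hd : DifferentiableAt ℝ (fun y => η y a) x :=
      ((hη a).contDiffAt (hU.mem_nhds hx)).differentiableAt (by simp)
    have e : pd α (fun y => ξ y a) x = c * pd α (fun y => η y a) x := by
      rw [pd_congr (h := fun y => c * η y a) ((hU.eventually_mem hx).mono fun y hy => by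
        simp [h y hy]), pd_mul (differentiableAt_const c) hd, pd_const]
      simp
    simp only [covDeriv, e, h x hx, Pi.smul_apply, smul_eq_mul, mul_add, Finset.mul_sum]
    congr 1
    refine Finset.sum_congr rfl fun β _ => Finset.sum_congr rfl fun b _ =>
      Finset.sum_congr rfl fun d _ => ?_
    ring
  have hcc : (starRingEnd ℂ) c * c = 1 := by
    rw [mul_comm, Complex.mul_conj, Complex.normSq_eq_norm_sq, hc]
    simp
  have hdens : weylDensity g σ ξ x = weylDensity g σ η x := by
    simp only [weylDensity, hcov, h x hx, Pi.smul_apply, smul_eq_mul, map_mul]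
    refine Finset.sum_congr rfl fun α _ => Finset.sum_congr rfl fun a _ =>
      Finset.sum_congr rfl fun b _ => ?_
    linear_combination (starRingEnd ℂ) (η x b) * tensUp g σ x α a b *
      covDeriv g σ η x α a * hcc
  rw [weylLagrangian_eq hσ hx, weylLagrangian_eq hσ hx, hdens]

/-! ### The correspondence -/

theorem exists_spinor_of_coframe (hU : IsOpen U) (hUsc : IsSimplyConnected U)
    (hg : IsLorentzianMetric U g) (href : IsCoframe U g ref) (hσ : IsPauli U g ref σ)
    (θ : Coframe U g ref) : ∃ ξ : Spinor U, EqModU1 U (lm θ.1) (spinorForm σ ξ.1) := by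
  obtain ⟨B, hB, hA⟩ := exists_smooth_adapted hU hUsc hg href hσ θ.2
  refine ⟨⟨fun x => B x 0, hB 0, fun x hx h0 => ?_⟩,
    (EqModU1.refl U _).congr_right fun x hx => (hA x hx).spinorForm_row_zero.symm⟩
  have h1 := (hA x hx).det
  have h0' : B x 0 = 0 := h0
  rw [Matrix.det_fin_two, congrFun h0' 0, congrFun h0' 1] at h1
  simp at h1

/-- For the nontrivial direction, a coframe built from `η` presents its bivector as an `l ∧ m`, so
the comparison with `ξ` takes place in a spin frame whose first row is `η`. -/
theorem eqModU1_spinorForm_iff (hUsc : IsSimplyConnected U)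
    (hg : IsLorentzianMetric U g) (href : IsCoframe U g ref) (hσ : IsPauli U g ref σ)
    (ξ η : Spinor U) :
    EqModU1 U (spinorForm σ ξ.1) (spinorForm σ η.1) ↔ EqModU1 U ξ.1 η.1 := by
  refine ⟨fun h => ?_, EqModU1.spinorForm⟩
  obtain ⟨θ, B, hθ, hB, hA, hrow⟩ := exists_coframe_of_spinor hg href hσ η.2.1 η.2.2
  refine (eqModU1_row_zero hUsc.isPathConnected.isConnected.isPreconnected
    (fun x hx => (hθ.2.1 x hx).ne') hB hA ξ.2.1
    (h.congr_right fun x hx => ?_)).congr_right fun x _ => hrow x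
  rw [← (hA x hx).spinorForm_row_zero]
  exact spinorForm_congr (hrow x).symm

end

end WeylTele

end

/-! ### The bijection of classes and the identity of Lagrangians -/

theorem theorem2 (U : Set WeylTele.Pt) (hU : IsOpen U) (hUsc : IsSimplyConnected U)
    (g : WeylTele.Pt → Matrix (Fin 4) (Fin 4) ℝ) (hg : WeylTele.IsLorentzianMetric U g)
    (ref : WeylTele.Pt → Matrix (Fin 4) (Fin 4) ℝ) (href : WeylTele.IsCoframe U g ref)
    (hrefpos : ∀ x ∈ U, 0 < (ref x).det)
    (σ : WeylTele.Pt → Fin 4 → Matrix (Fin 2) (Fin 2) ℂ) (hσ : WeylTele.IsPauli U g ref σ) :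
    ∃ Φ : Quotient (WeylTele.coframeSetoid U g ref) ≃ Quotient (WeylTele.spinorSetoid U),
      (∀ (θ : WeylTele.Coframe U g ref) (ξ : WeylTele.Spinor U),
        Φ (Quotient.mk _ θ) = Quotient.mk _ ξ ↔
          WeylTele.EqModU1 U (WeylTele.lm θ.1) (WeylTele.spinorForm σ ξ.1)) ∧
      (∀ (θ : WeylTele.Coframe U g ref) (ξ : WeylTele.Spinor U),
        Φ (Quotient.mk _ θ) = Quotient.mk _ ξ →
          ∀ x ∈ U, ∀ α β γ δ : Fin 4,
            (WeylTele.teleLagrangian θ.1 x α β γ δ : ℂ) =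
              -(4 / 3) * WeylTele.weylLagrangian g σ ξ.1 x α β γ δ) := by
  choose F hF using WeylTele.exists_spinor_of_coframe hU hUsc hg href hσ
  have hiff (θ : WeylTele.Coframe U g ref) (ξ : WeylTele.Spinor U) :
      WeylTele.EqModU1 U (F θ).1 ξ.1 ↔
        WeylTele.EqModU1 U (WeylTele.lm θ.1) (WeylTele.spinorForm σ ξ.1) := by
    rw [← WeylTele.eqModU1_spinorForm_iff hUsc hg href hσ]
    exact ⟨fun h => (hF θ).trans h, fun h => (hF θ).symm.trans h⟩
  -- Independence of representatives: equivalent coframes have equal `l ∧ m` modulo `U(1)`, and a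
  -- bivector determines its spinor modulo `U(1)`.
  let φ : Quotient (WeylTele.coframeSetoid U g ref) → Quotient (WeylTele.spinorSetoid U) :=
    Quotient.lift (fun θ => Quotient.mk _ (F θ)) fun θ θ' h => Quotient.sound <|
      (hiff θ (F θ')).mpr (((WeylTele.coframeEquiv_iff θ θ').mp h).trans (hF θ'))
  have hφ (θ : WeylTele.Coframe U g ref) (ξ : WeylTele.Spinor U) :
      φ (Quotient.mk _ θ) = Quotient.mk _ ξ ↔
        WeylTele.EqModU1 U (WeylTele.lm θ.1) (WeylTele.spinorForm σ ξ.1) := by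
    rw [← hiff]
    exact Quotient.eq
  have hbij : Function.Bijective φ := by
    refine ⟨fun p q => ?_, fun q => ?_⟩
    · induction p, q using Quotient.inductionOn₂ with
      | h θ θ' =>
        intro h
        have h' := (hφ θ (F θ')).mp h
        exact Quotient.sound ((WeylTele.coframeEquiv_iff θ θ').mpr (h'.trans (hF θ').symm))
    · induction q using Quotient.inductionOn with
      | h ξ =>
        obtain ⟨θ, B, hθ, -, hA, hrow⟩ :=
          WeylTele.exists_coframe_of_spinor hg href hσ ξ.2.1 ξ.2.2
        refine ⟨Quotient.mk _ ⟨θ, hθ⟩, (hφ _ ξ).mpr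
          ((WeylTele.EqModU1.refl U _).congr_right fun x hx => ?_)⟩
        rw [← (hA x hx).spinorForm_row_zero]
        exact WeylTele.spinorForm_congr (hrow x)
  refine ⟨Equiv.ofBijective φ hbij, hφ, fun θ ξ h x hx α β γ δ => ?_⟩
  -- The identity is computed for the spinor `B 0` of a smooth adapted spin frame; `ξ` differs from
  -- it by a constant phase, to which the Weyl Lagrangian is insensitive.
  obtain ⟨B, hB, hA⟩ := WeylTele.exists_smooth_adapted hU hUsc hg href hσ θ.2
  have hξ : WeylTele.EqModU1 U ξ.1 fun x => B x 0 :=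
    WeylTele.eqModU1_row_zero hUsc.isPathConnected.isConnected.isPreconnected
      (fun x hx => (θ.2.2.1 x hx).ne') hB hA ξ.2.1 ((hφ θ ξ).mp h).symm
  rw [WeylTele.teleLagrangian_eq_weylLagrangian hU hg hσ θ.2.1.1 hB hA hx,
    hξ.weylLagrangian hU hσ (hB 0) hx]
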